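/- Let $\eta(\tau)=q^{1/24}\prod_{m\ge1}(1-q^m)$, $q=e^{2\pi i\tau}$, be the Dedekind eta function on the upper half-plane $\mathbb{H}$, and let $$g(\tau)=\frac{\eta^2(2\tau)\,\eta^4(5\tau)}{\eta^4(\tau)\,\eta^2(10\tau)} .$$ For every integer $a$ coprime to $10$ fix a matrix $\sigma_a\in\mathrm{SL}_2(\mathbb{Z})$ with $\sigma_a\equiv\begin{bmatrix}a^{-1}&0\\0&a\end{bmatrix}\pmod{10}$. Let $n$ be a positive integer coprime to $10$, put $\alpha_{a,b}=\sigma_a\begin{bmatrix}a&b\\0&n/a\end{bmatrix}$ (acting on $\mathbb{H}$ by linear fractional transformations), $\psi(n)=n\prod_{p\mid n}(1+1/p)$ (the product over the primes dividing $n$), and $$\Phi_n(X,\tau)=\prod_{0<a\mid n}\ \prod_{\substack{0\le b<n/a\\ \gcd(a,b,n/a)=1}}\bigl(X-(g\circ\alpha_{a,b})(\tau)\bigr)\qquad(\tau\in\mathbb{H}).$$ Then there is a unique polynomial $\Phi_n(X,Y)$ in $X$ with coefficients in $\mathbb{C}(Y)$ such that $\Phi_n(X,g(\tau))=\Phi_n(X,\tau)$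 (as an identity of polynomials in $X$ whose coefficients are meromorphic functions of $\tau$), and it has the following properties. 1. $\Phi_n(X,Y)\in\mathbb{Z}[X,Y]$ and $\deg_X\Phi_n(X,Y)=\deg_Y\Phi_n(X,Y)=\psi(n)$. 2. $\Phi_n(X,Y)$ is irreducible both as a polynomial in $X$ over $\mathbb{C}(Y)$ and as a polynomial in $Y$ over $\mathbb{C}(X)$. 3. If $n>1$, then $\Phi_n(X,Y)=\Phi_n(Y,X)$. 4. (Kronecker congruence) If $n=p$ is an odd prime with $p\ne5$, then $$\Phi_p(X,Y)\equiv(X^p-Y)(X-Y^p)\pmod{p\,\mathbb{Z}[X,Y]} .$$ -/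

import Mathlib

open Polynomial UpperHalfPlane
open scoped Polynomial.Bivariate MatrixGroups

namespace ModularPolynomialTen

/-- The eta quotient `g(τ) = η(2τ)² η(5τ)⁴ / (η(τ)⁴ η(10τ)²)`. It is only ever used at points of
the upper half-plane, where the infinite products defining `η` converge and do not vanish. -/
noncomputable def g (z : ℂ) : ℂ :=
  ModularForm.eta (2 * z) ^ 2 * ModularForm.eta (5 * z) ^ 4 /
    (ModularForm.eta z ^ 4 * ModularForm.eta (10 * z) ^ 2)

/-- The linear fractional transformation attached to an integral `2 × 2` matrix. -/
noncomputable def moebius (M : Matrix (Fin 2) (Fin 2) ℤ) (z : ℂ) : ℂ :=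
  ((M 0 0 : ℂ) * z + (M 0 1 : ℂ)) / ((M 1 0 : ℂ) * z + (M 1 1 : ℂ))

/-- The matrix `γ ∈ SL₂(ℤ)` is congruent to `diag(a⁻¹, a)` modulo `10`. -/
def IsSigma (a : ℤ) (γ : SL(2, ℤ)) : Prop :=
  a * γ 0 0 ≡ 1 [ZMOD 10] ∧ γ 0 1 ≡ 0 [ZMOD 10] ∧ γ 1 0 ≡ 0 [ZMOD 10] ∧ γ 1 1 ≡ a [ZMOD 10]

/-- Such matrices exist for every integer `a` coprime to `10`. -/
theorem exists_isSigma (a : ℤ) (ha : IsCoprime a 10) : ∃ γ : SL(2, ℤ), IsSigma a γ := by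
  obtain ⟨x, y, hxy⟩ : IsCoprime a (10 * 10) := ha.mul_right ha
  refine ⟨⟨!![x, 10; -10 * y, a], ?_⟩, ?_, ?_, ?_, ?_⟩
  · rw [Matrix.det_fin_two_of]; linarith
  · simp only [Matrix.of_apply, Matrix.cons_val', Matrix.cons_val_zero, Matrix.cons_val_fin_one]
    refine Int.modEq_iff_dvd.2 ⟨10 * y, ?_⟩
    linarith
  · simp [Int.ModEq]
  · simp [Int.ModEq]
  · simp [Int.ModEq]

/-- The matrix `α_{a,b} = σ_a (a b; 0 n/a)`, where `a` is a divisor of `n`. -/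
def alpha (σ : ℤ → SL(2, ℤ)) (n a b : ℕ) : Matrix (Fin 2) (Fin 2) ℤ :=
  (σ (a : ℤ) : Matrix (Fin 2) (Fin 2) ℤ) * !![(a : ℤ), (b : ℤ); 0, ((n / a : ℕ) : ℤ)]

/-- The polynomial `Φ_n(X, τ) = ∏ (X - g(α_{a,b} τ))`, the product being over `0 < a ∣ n` and
`0 ≤ b < n / a` with `gcd(a, b, n / a) = 1`. -/
noncomputable def modularProduct (σ : ℤ → SL(2, ℤ)) (n : ℕ) (τ : ℍ) : ℂ[X] :=
  ∏ a ∈ n.divisors, ∏ b ∈ (Finset.range (n / a)).filter (fun b => (a.gcd b).gcd (n / a) = 1),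
    (Polynomial.X - Polynomial.C (g (moebius (alpha σ n a b) (τ : ℂ))))

/-- `F(X, Y) ∈ ℂ(Y)[X]` is the modular polynomial of level `n` for `g`: substituting `Y = g(τ)`
gives `Φ_n(X, τ)`. The coefficients are compared as meromorphic functions of `τ`, that is, at all
points `τ` where the coefficient of `F` has no pole at `Y = g(τ)`. -/
def IsModularPolynomial (σ : ℤ → SL(2, ℤ)) (n : ℕ) (F : (RatFunc ℂ)[X]) : Prop :=
  ∀ (k : ℕ) (τ : ℍ), (F.coeff k).denom.eval (g (τ : ℂ)) ≠ 0 →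
    (F.coeff k).eval (RingHom.id ℂ) (g (τ : ℂ)) = (modularProduct σ n τ).coeff k

/-- `Φ(X, Y) ∈ ℤ[X, Y]` seen as a polynomial in `Y` over the field `ℂ(X)`. -/
noncomputable def inYOverRatFunc (Φ : ℤ[X][Y]) : (RatFunc ℂ)[X] :=
  Φ.map ((algebraMap ℂ[X] (RatFunc ℂ)).comp (Polynomial.mapRingHom (Int.castRingHom ℂ)))

/-- `Φ(X, Y) ∈ ℤ[X, Y]` seen as a polynomial in `X` over the field `ℂ(Y)`. -/
noncomputable def inXOverRatFunc (Φ : ℤ[X][Y]) : (RatFunc ℂ)[X] :=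
  inYOverRatFunc (Bivariate.swap Φ)

/-- The degree of `Φ(X, Y)` in `Y`. -/
noncomputable def degY (Φ : ℤ[X][Y]) : ℕ := Φ.natDegree

/-- The degree of `Φ(X, Y)` in `X`. -/
noncomputable def degX (Φ : ℤ[X][Y]) : ℕ := (Bivariate.swap Φ).natDegree

/-- `ψ(n) = n ∏_{p ∣ n} (1 + 1 / p)`, the product being over the primes dividing `n`. -/
def psi (n : ℕ) : ℚ := (n : ℚ) * ∏ p ∈ n.primeFactors, (1 + 1 / (p : ℚ))

end ModularPolynomialTen

open ModularPolynomialTen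

/-! `g` is a Hauptmodul for Γ₀(10) whose only pole, a simple one, is at the cusp 0. Hence a
Γ₀(10)-invariant holomorphic function that is bounded at the other cusps and of moderate growth at 0
is a polynomial in `g` (`exists_eq_eval_g`): subtract multiples of powers of `g` until no pole is
left. The matrices (a b; 0 n/a) represent the left Γ₀(10)-cosets of primitive matrices of
determinant n and level 10. Right multiplication by Γ₀(10) permutes these cosets, so the
coefficients of ∏ (X - g∘α) are polynomials P_k in `g`.

Integrality is read off from the Atkin-Lehner image `gTwo`, with expansion V = q + ⋯ in ℤ[[q]], to
which the same P_k apply (`exists_prodPoly_coeff_eq`). With t = exp(2πiτ/n) and ζ = exp(2πi/n), the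
conjugates of `gTwo` are V(ζ^{ab} t^{a²}). The Galois group of ℚ(ζ) permutes them, so their
symmetric functions have integer coefficients (`exists_int_coeff_prodSeries`), and V = q + ⋯ passes
this on to P_k. For n = p, reduction replaces ζ by 1, and Frobenius turns the product into
Kronecker's two factors.

Γ₀(10) acts transitively on the cosets, so a relation between gTwo(z) and gTwo(nz) holds for every
conjugate; one of degree below the number of cosets is zero (`eq_zero_of_evalEval_gTwo`). This gives
irreducibility, and also divisibility of the swapped polynomial by the original one, whence symmetry
up to sign. The number of cosets is ψ(n) by multiplicativity. -/

namespace ModularPolynomialTen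

/-! ### Linear fractional transformations -/

theorem moebius_denom_ne_zero {M : Matrix (Fin 2) (Fin 2) ℤ} (hM : 0 < M.det) {z : ℂ}
    (hz : 0 < z.im) : (M 1 0 : ℂ) * z + (M 1 1 : ℂ) ≠ 0 := by
  intro h
  have h1 := congrArg Complex.im h
  have h2 := congrArg Complex.re h
  simp at h1 h2
  rcases h1 with h1 | h1
  · rw [Matrix.det_fin_two] at hM
    rw [h1] at h2 hM
    simp at h2
    rw [h2] at hM
    simp at hM
  · exact hz.ne' h1

theorem moebius_im (M : Matrix (Fin 2) (Fin 2) ℤ) (z : ℂ) :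
    (moebius M z).im = M.det * z.im / Complex.normSq ((M 1 0 : ℂ) * z + (M 1 1 : ℂ)) := by
  rw [moebius, Complex.div_im, Matrix.det_fin_two]
  simp
  ring

theorem moebius_im_pos {M : Matrix (Fin 2) (Fin 2) ℤ} (hM : 0 < M.det) {z : ℂ}
    (hz : 0 < z.im) : 0 < (moebius M z).im := by
  rw [moebius_im]
  have := Complex.normSq_pos.2 (moebius_denom_ne_zero hM hz)
  have : (0 : ℝ) < M.det := by exact_mod_cast hM
  positivity

theorem moebius_cocycle (M : Matrix (Fin 2) (Fin 2) ℤ) {N : Matrix (Fin 2) (Fin 2) ℤ}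
    (hN : 0 < N.det) {z : ℂ} (hz : 0 < z.im) :
    ((M * N) 1 0 : ℂ) * z + ((M * N) 1 1 : ℂ) =
      ((M 1 0 : ℂ) * moebius N z + (M 1 1 : ℂ)) * ((N 1 0 : ℂ) * z + (N 1 1 : ℂ)) := by
  have h := moebius_denom_ne_zero hN hz
  rw [add_mul, moebius, mul_assoc, div_mul_cancel₀ _ h]
  simp only [Matrix.mul_apply, Fin.sum_univ_two]
  push_cast
  ring

theorem moebius_mul {M N : Matrix (Fin 2) (Fin 2) ℤ} (hM : 0 < M.det) (hN : 0 < N.det) {z : ℂ}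
    (hz : 0 < z.im) : moebius (M * N) z = moebius M (moebius N z) := by
  have h1 := moebius_denom_ne_zero hM (moebius_im_pos hN hz)
  have h2 := moebius_denom_ne_zero hN hz
  have h3 := moebius_cocycle M hN hz
  have h4 : ((M * N) 0 0 : ℂ) * z + ((M * N) 0 1 : ℂ) =
      ((M 0 0 : ℂ) * moebius N z + (M 0 1 : ℂ)) * ((N 1 0 : ℂ) * z + (N 1 1 : ℂ)) := by
    rw [add_mul, moebius, mul_assoc, div_mul_cancel₀ _ h2]
    simp only [Matrix.mul_apply, Fin.sum_univ_two]
    push_cast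
    ring
  calc moebius (M * N) z = _ / _ := by rw [moebius, h3, h4]
    _ = moebius M (moebius N z) := by rw [mul_div_mul_right _ _ h2]; rfl

theorem moebius_one (z : ℂ) : moebius 1 z = z := by simp [moebius]

/-! ### The square of the Dedekind eta function -/

/-- The square of the Dedekind eta function. -/
noncomputable def etaSq (z : ℂ) : ℂ := ModularForm.eta z ^ 2

/-- The twelfth root of unity `exp(πi/6)`. -/
noncomputable def unit12 : ℂ := Complex.exp (Real.pi * Complex.I / 6)

theorem unit12_pow_twelve : unit12 ^ 12 = 1 := by
  rw [unit12, ← Complex.exp_nat_mul, ← Complex.exp_two_pi_mul_I]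
  congr 1
  push_cast
  ring

theorem unit12_ne_zero : unit12 ≠ 0 := Complex.exp_ne_zero _

theorem norm_unit12 : ‖unit12‖ = 1 := by
  rw [unit12, show (Real.pi * Complex.I / 6 : ℂ) = ((Real.pi / 6 : ℝ) : ℂ) * Complex.I by
    push_cast; ring, Complex.norm_exp_ofReal_mul_I]

theorem unit12_pow_three : unit12 ^ 3 = Complex.I := by
  rw [unit12, ← Complex.exp_nat_mul]
  refine Eq.trans ?_ Complex.exp_pi_div_two_mul_I
  refine congrArg Complex.exp ?_
  push_cast
  ring

theorem unit12_zpow_congr {m n : ℤ} (h : m ≡ n [ZMOD 12]) : unit12 ^ m = unit12 ^ n := by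
  obtain ⟨k, hk⟩ := h.symm.dvd
  rw [show m = n + 12 * k by linarith, zpow_add₀ unit12_ne_zero, zpow_mul]
  have : unit12 ^ (12 : ℤ) = 1 := by exact_mod_cast unit12_pow_twelve
  rw [this, one_zpow, mul_one]

theorem etaSq_ne_zero {z : ℂ} (hz : 0 < z.im) : etaSq z ≠ 0 :=
  pow_ne_zero _ (ModularForm.eta_ne_zero hz)

theorem etaSq_add_one (z : ℂ) : etaSq (z + 1) = unit12 * etaSq z := by
  have h1 : Function.Periodic.qParam 1 (z + 1) = Function.Periodic.qParam 1 z := by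
    simp only [Function.Periodic.qParam]
    rw [Complex.exp_eq_exp_iff_exists_int]
    exact ⟨1, by push_cast; ring⟩
  have h2 : Function.Periodic.qParam 24 (z + 1) ^ 2 =
      unit12 * Function.Periodic.qParam 24 z ^ 2 := by
    simp only [Function.Periodic.qParam, unit12, ← Complex.exp_nat_mul, ← Complex.exp_add]
    congr 1
    push_cast
    ring
  simp only [etaSq, ModularForm.eta, mul_pow, h2, ModularForm.eta_q, h1]
  ring

/-- Squaring η removes the choice of square root: the factor becomes z / i. This is why `etaSq`, of
weight one, is used throughout. -/
theorem etaSq_neg_one_div {z : ℂ} (hz : 0 < z.im) :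
    etaSq (-1 / z) = -Complex.I * z * etaSq z := by
  have h := ModularForm.eta_comp_eq_csqrt_I_inv (x := z) hz
  have hs : ∀ w : ℂ, w ≠ 0 → Complex.sqrt w ^ 2 = w := fun w hw => by
    rw [sqrt_eq_exp hw, ← Complex.exp_nat_mul, Nat.cast_ofNat, mul_div_cancel₀ _ two_ne_zero,
      Complex.exp_log hw]
  simp only [Function.comp, Pi.smul_apply, Pi.mul_apply, smul_eq_mul] at h
  have hz0 : z ≠ 0 := by rintro rfl; simp at hz
  rw [etaSq, h, mul_pow, mul_pow, inv_pow, hs _ Complex.I_ne_zero, hs _ hz0, Complex.inv_I, etaSq]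
  ring

/-- The exponent, modulo `12`, of the multiplier of the square of the Dedekind eta function. -/
def etaExp (a b c d : ℤ) : ℤ :=
  (1 - c ^ 2) * (b * d + 3 * (c - 1) * d + c + 3) + c * (a + d - 3)

/-- `etaExp` is a polynomial, so congruences for it are finite checks; the Chinese remainder theorem
cuts 12⁴ cases to 3⁴ and 4⁴. -/
theorem modEq_twelve_of_three_of_four {m n : ℤ} (h3 : (m : ZMod 3) = n) (h4 : (m : ZMod 4) = n) :
    m ≡ n [ZMOD 12] := by
  have h3' := (ZMod.intCast_eq_intCast_iff _ _ _).1 h3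
  have h4' := (ZMod.intCast_eq_intCast_iff _ _ _).1 h4
  have := (Int.modEq_and_modEq_iff_modEq_mul (m := 3) (n := 4) (by decide)).1 ⟨h3', h4'⟩
  simpa using this

/-- The shift by 1 matches η²(z + 1) = ζ₁₂ η²(z). -/
theorem etaExp_T_mul {a b c d : ℤ} (h : a * d - b * c = 1) :
    etaExp (a + c) (b + d) c d ≡ etaExp a b c d + 1 [ZMOD 12] := by
  apply modEq_twelve_of_three_of_four
  · have h' := congrArg (Int.cast : ℤ → ZMod 3) h
    simp only [etaExp]
    push_cast at h' ⊢
    generalize (a : ZMod 3) = a at *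
    generalize (b : ZMod 3) = b at *
    generalize (c : ZMod 3) = c at *
    generalize (d : ZMod 3) = d at *
    revert a b c d
    decide
  · have h' := congrArg (Int.cast : ℤ → ZMod 4) h
    simp only [etaExp]
    push_cast at h' ⊢
    generalize (a : ZMod 4) = a at *
    generalize (b : ZMod 4) = b at *
    generalize (c : ZMod 4) = c at *
    generalize (d : ZMod 4) = d at *
    revert a b c d
    decide

/-- The shift by -3 matches the factor -i = ζ₁₂⁻³ in the inversion formula. -/
theorem etaExp_S_mul {a b c d : ℤ} (h : a * d - b * c = 1) :
    etaExp (-c) (-d) a b ≡ etaExp a b c d - 3 [ZMOD 12] := by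
  apply modEq_twelve_of_three_of_four
  · have h' := congrArg (Int.cast : ℤ → ZMod 3) h
    simp only [etaExp]
    push_cast at h' ⊢
    generalize (a : ZMod 3) = a at *
    generalize (b : ZMod 3) = b at *
    generalize (c : ZMod 3) = c at *
    generalize (d : ZMod 3) = d at *
    revert a b c d
    decide
  · have h' := congrArg (Int.cast : ℤ → ZMod 4) h
    simp only [etaExp]
    push_cast at h' ⊢
    generalize (a : ZMod 4) = a at *
    generalize (b : ZMod 4) = b at *
    generalize (c : ZMod 4) = c at *
    generalize (d : ZMod 4) = d at *
    revert a b c d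
    decide

/-- Conjugating (a b; 10c d) by diag(δ, 1) gives (a δb; 10c/δ d). The congruence says that the
multipliers of the four eta factors of `g` cancel. -/
theorem etaExp_level_ten {a b c d : ℤ} (h : a * d - 10 * b * c = 1) :
    etaExp a (2 * b) (5 * c) d + 2 * etaExp a (5 * b) (2 * c) d ≡
      2 * etaExp a b (10 * c) d + etaExp a (10 * b) c d [ZMOD 12] := by
  apply modEq_twelve_of_three_of_four
  · have h' := congrArg (Int.cast : ℤ → ZMod 3) h
    simp only [etaExp]
    push_cast at h' ⊢
    generalize (a : ZMod 3) = a at *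
    generalize (b : ZMod 3) = b at *
    generalize (c : ZMod 3) = c at *
    generalize (d : ZMod 3) = d at *
    revert a b c d
    decide
  · have h' := congrArg (Int.cast : ℤ → ZMod 4) h
    simp only [etaExp]
    push_cast at h' ⊢
    generalize (a : ZMod 4) = a at *
    generalize (b : ZMod 4) = b at *
    generalize (c : ZMod 4) = c at *
    generalize (d : ZMod 4) = d at *
    revert a b c d
    decide

/-- The transformation law of `η²` under `γ ∈ SL₂(ℤ)`. -/
def EtaSqLaw (γ : SL(2, ℤ)) : Prop :=
  ∀ z : ℂ, 0 < z.im → etaSq (moebius γ z) =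
    unit12 ^ etaExp (γ 0 0) (γ 0 1) (γ 1 0) (γ 1 1) *
      ((γ 1 0 : ℂ) * z + (γ 1 1 : ℂ)) * etaSq z

theorem det_coe_pos (γ : SL(2, ℤ)) : 0 < (γ : Matrix (Fin 2) (Fin 2) ℤ).det := by
  rw [γ.det_coe]; norm_num

theorem SL_det_eq (γ : SL(2, ℤ)) : γ 0 0 * γ 1 1 - γ 0 1 * γ 1 0 = 1 := by
  have := γ.det_coe
  rwa [Matrix.det_fin_two] at this

theorem moebius_T (z : ℂ) : moebius (ModularGroup.T : SL(2, ℤ)) z = z + 1 := by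
  simp [moebius, ModularGroup.T]

theorem moebius_S (z : ℂ) : moebius (ModularGroup.S : SL(2, ℤ)) z = -1 / z := by
  simp [moebius, ModularGroup.S]

/-- An equivalence is needed because the induction over generators must also pass through inverses.
-/
theorem etaSqLaw_T_mul_iff (γ : SL(2, ℤ)) : EtaSqLaw (ModularGroup.T * γ) ↔ EtaSqLaw γ := by
  refine forall_congr' fun z => forall_congr' fun hz => ?_
  rw [Matrix.SpecialLinearGroup.coe_mul,
    moebius_mul (det_coe_pos _) (det_coe_pos _) hz, moebius_T, etaSq_add_one]
  have e := unit12_zpow_congr (etaExp_T_mul (SL_det_eq γ))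
  rw [zpow_add_one₀ unit12_ne_zero] at e
  have h00 : (ModularGroup.T * γ) 0 0 = γ 0 0 + γ 1 0 := by
    rw [Matrix.SpecialLinearGroup.coe_mul, Matrix.mul_apply]; simp [ModularGroup.T]
  have h01 : (ModularGroup.T * γ) 0 1 = γ 0 1 + γ 1 1 := by
    rw [Matrix.SpecialLinearGroup.coe_mul, Matrix.mul_apply]; simp [ModularGroup.T]
  have h10 : (ModularGroup.T * γ) 1 0 = γ 1 0 := by
    rw [Matrix.SpecialLinearGroup.coe_mul, Matrix.mul_apply]; simp [ModularGroup.T]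
  have h11 : (ModularGroup.T * γ) 1 1 = γ 1 1 := by
    rw [Matrix.SpecialLinearGroup.coe_mul, Matrix.mul_apply]; simp [ModularGroup.T]
  rw [← Matrix.SpecialLinearGroup.coe_mul, h00, h01, h10, h11, e]
  constructor
  · intro h
    apply mul_left_cancel₀ unit12_ne_zero
    linear_combination h
  · intro h
    linear_combination unit12 * h

theorem etaSqLaw_S_mul_iff (γ : SL(2, ℤ)) : EtaSqLaw (ModularGroup.S * γ) ↔ EtaSqLaw γ := by
  refine forall_congr' fun z => forall_congr' fun hz => ?_
  have hp := moebius_im_pos (det_coe_pos γ) hz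
  rw [Matrix.SpecialLinearGroup.coe_mul,
    moebius_mul (det_coe_pos _) (det_coe_pos _) hz, moebius_S, etaSq_neg_one_div hp]
  have e := unit12_zpow_congr (etaExp_S_mul (SL_det_eq γ))
  have e3 : unit12 ^ (3 : ℤ) = Complex.I := by exact_mod_cast unit12_pow_three
  rw [zpow_sub₀ unit12_ne_zero, e3] at e
  have h00 : (ModularGroup.S * γ) 0 0 = -γ 1 0 := by
    rw [Matrix.SpecialLinearGroup.coe_mul, Matrix.mul_apply]; simp [ModularGroup.S]
  have h01 : (ModularGroup.S * γ) 0 1 = -γ 1 1 := by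
    rw [Matrix.SpecialLinearGroup.coe_mul, Matrix.mul_apply]; simp [ModularGroup.S]
  have h10 : (ModularGroup.S * γ) 1 0 = γ 0 0 := by
    rw [Matrix.SpecialLinearGroup.coe_mul, Matrix.mul_apply]; simp [ModularGroup.S]
  have h11 : (ModularGroup.S * γ) 1 1 = γ 0 1 := by
    rw [Matrix.SpecialLinearGroup.coe_mul, Matrix.mul_apply]; simp [ModularGroup.S]
  rw [← Matrix.SpecialLinearGroup.coe_mul, h00, h01, h10, h11, e]
  have hm : (γ 0 0 : ℂ) * z + (γ 0 1 : ℂ) =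
      moebius γ z * ((γ 1 0 : ℂ) * z + (γ 1 1 : ℂ)) := by
    rw [moebius, div_mul_cancel₀ _ (moebius_denom_ne_zero (det_coe_pos γ) hz)]
  have hm0 : moebius γ z ≠ 0 := by
    intro h0; rw [h0] at hp; simp at hp
  rw [hm, div_eq_mul_inv, Complex.inv_I]
  constructor
  · intro h
    apply mul_left_cancel₀ (mul_ne_zero Complex.I_ne_zero hm0)
    linear_combination -h
  · intro h
    linear_combination (-Complex.I * moebius γ z) * h

theorem etaSqLaw (γ : SL(2, ℤ)) : EtaSqLaw γ := by
  have hγ : γ ∈ Subgroup.closure {ModularGroup.S, ModularGroup.T} := by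
    rw [SpecialLinearGroup.SL2Z_generators]; trivial
  induction hγ using Subgroup.closure_induction_left with
  | one =>
    intro z _
    simp [moebius, etaExp]
  | mul_left x hx y _ ih =>
    rcases hx with rfl | rfl
    · exact (etaSqLaw_S_mul_iff y).2 ih
    · exact (etaSqLaw_T_mul_iff y).2 ih
  | inv_mul_cancel x hx y _ ih =>
    rcases hx with rfl | rfl
    · exact (etaSqLaw_S_mul_iff _).1 (by rwa [mul_inv_cancel_left])
    · exact (etaSqLaw_T_mul_iff _).1 (by rwa [mul_inv_cancel_left])

theorem etaSq_moebius_of {a b c d : ℤ} (h : a * d - b * c = 1) {z : ℂ} (hz : 0 < z.im) :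
    etaSq ((a * z + b) / (c * z + d)) =
      unit12 ^ etaExp a b c d * (c * z + d) * etaSq z := by
  have := etaSqLaw ⟨!![a, b; c, d], by rw [Matrix.det_fin_two_of]; exact h⟩ z hz
  simpa [moebius] using this

/-! ### The Hauptmoduln -/

theorem g_eq (z : ℂ) :
    g z = etaSq (2 * z) * etaSq (5 * z) ^ 2 / (etaSq z ^ 2 * etaSq (10 * z)) := by
  simp only [g, etaSq, ← pow_mul]

/-- The eta quotient `η(τ)² η(10τ)⁴ / (η(2τ)⁴ η(5τ)²)`, the image of `g` under an
Atkin-Lehner involution. -/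
noncomputable def gTwo (z : ℂ) : ℂ :=
  etaSq z * etaSq (10 * z) ^ 2 / (etaSq (2 * z) ^ 2 * etaSq (5 * z))

theorem im_natCast_mul_pos {z : ℂ} (hz : 0 < z.im) {m : ℕ} (hm : 0 < m) :
    0 < ((m : ℂ) * z).im := by
  have h : ((m : ℂ) * z).im = m * z.im := by simp
  rw [h]
  have : (0 : ℝ) < m := by exact_mod_cast hm
  positivity

theorem im_two_mul_pos {z : ℂ} (hz : 0 < z.im) : 0 < (2 * z).im := by
  simpa using im_natCast_mul_pos hz (m := 2) (by norm_num)

theorem im_five_mul_pos {z : ℂ} (hz : 0 < z.im) : 0 < (5 * z).im := by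
  simpa using im_natCast_mul_pos hz (m := 5) (by norm_num)

theorem im_ten_mul_pos {z : ℂ} (hz : 0 < z.im) : 0 < (10 * z).im := by
  simpa using im_natCast_mul_pos hz (m := 10) (by norm_num)

/-- `g` is invariant under `Γ₀(10)`. -/
theorem g_moebius {γ : SL(2, ℤ)} (hγ : (10 : ℤ) ∣ γ 1 0) {z : ℂ} (hz : 0 < z.im) :
    g (moebius γ z) = g z := by
  obtain ⟨c, hc⟩ := hγ
  have hdet := SL_det_eq γ
  have hd := moebius_denom_ne_zero (det_coe_pos γ) hz
  simp only [moebius]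
  simp only [hc] at hd hdet ⊢
  generalize γ.1 0 0 = a at *
  generalize γ.1 0 1 = b at *
  generalize γ.1 1 1 = d at *
  push_cast at hd ⊢
  -- For δ = 1, 2, 5, 10 one has δ·γz = γ_δ(δz) with γ_δ in SL₂(ℤ), and all four automorphy factors
  -- equal 10cz + d.
  have e1 := etaSq_moebius_of (a := a) (b := b) (c := 10 * c) (d := d) (by linarith) hz
  have e2 := etaSq_moebius_of (a := a) (b := 2 * b) (c := 5 * c) (d := d) (by linarith)
    (im_two_mul_pos hz)
  have e5 := etaSq_moebius_of (a := a) (b := 5 * b) (c := 2 * c) (d := d) (by linarith)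
    (im_five_mul_pos hz)
  have e10 := etaSq_moebius_of (a := a) (b := 10 * b) (c := c) (d := d) (by linarith)
    (im_ten_mul_pos hz)
  have hu := unit12_zpow_congr (etaExp_level_ten (a := a) (b := b) (c := c) (d := d)
    (by linarith))
  rw [zpow_add₀ unit12_ne_zero, zpow_add₀ unit12_ne_zero, mul_comm (2 : ℤ) (etaExp a (5 * b) (2 * c) d),
    mul_comm (2 : ℤ) (etaExp a b (10 * c) d), zpow_mul, zpow_mul] at hu
  rw [g_eq, g_eq]
  push_cast at e1 e2 e5 e10
  rw [show 2 * ((a * z + b) / (10 * c * z + d)) = (a * (2 * z) + 2 * b) / (5 * c * (2 * z) + d) by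
      rw [mul_div_assoc']; congr 1 <;> ring,
    show 5 * ((a * z + b) / (10 * c * z + d)) = (a * (5 * z) + 5 * b) / (2 * c * (5 * z) + d) by
      rw [mul_div_assoc']; congr 1 <;> ring,
    show 10 * ((a * z + b) / (10 * c * z + d)) = (a * (10 * z) + 10 * b) / (c * (10 * z) + d) by
      rw [mul_div_assoc']; congr 1 <;> ring, e1, e2, e5, e10]
  have n1 := etaSq_ne_zero hz
  have n10 := etaSq_ne_zero (im_ten_mul_pos hz)
  have nu (k : ℤ) : unit12 ^ k ≠ 0 := zpow_ne_zero _ unit12_ne_zero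
  rw [show (5 * c * (2 * z) + d : ℂ) = 10 * c * z + d by ring,
    show (2 * c * (5 * z) + d : ℂ) = 10 * c * z + d by ring,
    show (c * (10 * z) + d : ℂ) = 10 * c * z + d by ring]
  generalize (10 * c * z + d : ℂ) = w at *
  have k1 := nu (etaExp a b (10 * c) d)
  have k10 := nu (etaExp a (10 * b) c d)
  rw [div_eq_div_iff (by positivity) (by positivity)]
  have hu' : unit12 ^ etaExp a (2 * b) (5 * c) d * (unit12 ^ etaExp a (5 * b) (2 * c) d) ^ 2 =
    (unit12 ^ etaExp a b (10 * c) d) ^ 2 * unit12 ^ etaExp a (10 * b) c d := by exact_mod_cast hu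
  linear_combination (w ^ 3 * etaSq (2 * z) * etaSq (5 * z) ^ 2 * etaSq z ^ 2 * etaSq (10 * z)) * hu'

/-- The matrix of an Atkin-Lehner involution at the prime `2` in level `10`. -/
def atkinLehnerTwo : Matrix (Fin 2) (Fin 2) ℤ := !![2, 1; 10, 6]

/-- The involution exchanges the divisors 1 ↔ 2 and 5 ↔ 10: δWz is an SL₂(ℤ)-image of δ'z for the
partner δ'. The roots of unity cancel exactly, with no constant left. -/
theorem g_moebius_atkinLehnerTwo {z : ℂ} (hz : 0 < z.im) :
    g (moebius atkinLehnerTwo z) = gTwo z := by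
  have hd : (10 * z + 6 : ℂ) ≠ 0 := by
    have := moebius_denom_ne_zero (M := atkinLehnerTwo)
      (by simp [atkinLehnerTwo, Matrix.det_fin_two_of]) hz
    simpa [atkinLehnerTwo] using this
  have e2 := etaSq_moebius_of (a := 2) (b := 1) (c := 5) (d := 3) (by norm_num) hz
  have e1 := etaSq_moebius_of (a := 1) (b := 1) (c := 5) (d := 6) (by norm_num)
    (im_two_mul_pos hz)
  have e5 := etaSq_moebius_of (a := 1) (b := 5) (c := 1) (d := 6) (by norm_num)
    (im_ten_mul_pos hz)
  have e10 := etaSq_moebius_of (a := 2) (b := 5) (c := 1) (d := 3) (by norm_num)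
    (im_five_mul_pos hz)
  have hm : moebius atkinLehnerTwo z = (2 * z + 1) / (10 * z + 6) := by
    simp [moebius, atkinLehnerTwo]
  push_cast at e1 e2 e5 e10
  have hd' : (5 * z + 3 : ℂ) ≠ 0 := fun h => hd (by linear_combination 2 * h)
  have hu : unit12 ^ etaExp 2 1 5 3 * (unit12 ^ etaExp 1 5 1 6) ^ 2 =
      (unit12 ^ etaExp 1 1 5 6) ^ 2 * unit12 ^ etaExp 2 5 1 3 := by
    have : etaExp 2 1 5 3 + etaExp 1 5 1 6 * 2 ≡ etaExp 1 1 5 6 * 2 + etaExp 2 5 1 3 [ZMOD 12] := by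
      decide
    have := unit12_zpow_congr this
    rw [zpow_add₀ unit12_ne_zero, zpow_add₀ unit12_ne_zero, zpow_mul, zpow_mul] at this
    exact_mod_cast this
  rw [hm, g_eq, gTwo,
    show 2 * ((2 * z + 1) / (10 * z + 6)) = (2 * z + 1) / (5 * z + 3) by
      rw [mul_div_assoc', div_eq_div_iff hd hd']; ring,
    show (2 * z + 1) / (10 * z + 6) = (1 * (2 * z) + 1) / (5 * (2 * z) + 6) by congr 1 <;> ring,
    show 5 * ((1 * (2 * z) + 1) / (5 * (2 * z) + 6)) = (1 * (10 * z) + 5) / (1 * (10 * z) + 6) by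
      rw [mul_div_assoc']; congr 1 <;> ring,
    show 10 * ((1 * (2 * z) + 1) / (5 * (2 * z) + 6)) = (2 * (5 * z) + 5) / (1 * (5 * z) + 3) by
      rw [show (5 * (2 * z) + 6 : ℂ) = 10 * z + 6 by ring, one_mul, one_mul, mul_div_assoc',
        div_eq_div_iff hd hd']; ring,
    e2, e1, e5, e10]
  have nu (k : ℤ) : unit12 ^ k ≠ 0 := zpow_ne_zero _ unit12_ne_zero
  have k1 := nu (etaExp 1 1 5 6)
  have k10 := nu (etaExp 2 5 1 3)
  have n2 := etaSq_ne_zero (im_two_mul_pos hz)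
  have n5 := etaSq_ne_zero (im_five_mul_pos hz)
  rw [show (5 * (2 * z) + 6 : ℂ) = 10 * z + 6 by ring, one_mul, one_mul]
  rw [div_eq_div_iff (by positivity) (by positivity)]
  linear_combination ((5 * z + 3) * (10 * z + 6) ^ 2 * etaSq z * etaSq (10 * z) ^ 2 *
    etaSq (2 * z) ^ 2 * etaSq (5 * z)) * hu

open Filter Topology

/-! ### Growth at the cusps -/

/-- Bézout completes the first column, divided by its gcd, to a matrix in SL₂(ℤ). The triangular
factor then governs the behaviour at i∞. -/
theorem exists_hermite {M : Matrix (Fin 2) (Fin 2) ℤ} (hM : 0 < M.det) :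
    ∃ (γ : SL(2, ℤ)) (A B D : ℤ), 0 < A ∧ 0 < D ∧ A * D = M.det ∧
      A = Int.gcd (M 0 0) (M 1 0) ∧ M = γ * !![A, B; 0, D] := by
  have hdet := hM
  rw [Matrix.det_fin_two] at hdet
  have hg : 0 < Int.gcd (M 0 0) (M 1 0) := by
    rw [Int.gcd_pos_iff]
    by_contra! h
    rw [h.1, h.2] at hdet
    simp at hdet
  obtain ⟨A, hA⟩ : ∃ A : ℤ, A = Int.gcd (M 0 0) (M 1 0) := ⟨_, rfl⟩
  obtain ⟨a, ha⟩ : A ∣ M 0 0 := hA ▸ Int.gcd_dvd_left _ _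
  obtain ⟨c, hc⟩ : A ∣ M 1 0 := hA ▸ Int.gcd_dvd_right _ _
  have hA0 : 0 < A := by rw [hA]; exact_mod_cast hg
  have hb := Int.gcd_eq_gcd_ab (M 0 0) (M 1 0)
  rw [← hA] at hb
  generalize Int.gcdA (M 0 0) (M 1 0) = x at hb
  generalize Int.gcdB (M 0 0) (M 1 0) = y at hb
  have hxy : a * x + c * y = 1 := by
    rw [ha, hc] at hb
    exact mul_left_cancel₀ hA0.ne' (by linear_combination -hb)
  have hD : A * (a * M 1 1 - c * M 0 1) = M.det := by
    rw [Matrix.det_fin_two, ha, hc]; ring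
  refine ⟨⟨!![a, -y; c, x], by rw [Matrix.det_fin_two_of]; linarith⟩, A, x * M 0 1 + y * M 1 1,
    a * M 1 1 - c * M 0 1, hA0, pos_of_mul_pos_right (hD ▸ hM) hA0.le, hD, hA, ?_⟩
  ext i j
  fin_cases i <;> fin_cases j <;> simp [Matrix.mul_apply, Fin.sum_univ_two]
  · linarith
  · linear_combination -(M 0 1) * hxy
  · linarith
  · linear_combination -(M 1 1) * hxy

/-- Twelfth root of the product formula for Δ = η²⁴; working with norms makes the root unambiguous.
-/
theorem tendsto_norm_etaSq :
    Tendsto (fun τ : ℍ => ‖etaSq τ‖ * Real.exp (Real.pi / 6 * τ.im)) atImInfty (𝓝 1) := by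
  have h1 := ModularForm.tendsto_atImInfty_tprod_one_sub_eta_q_pow.norm
  have h2 : ∀ τ : ℍ, ‖∏' n : ℕ, (1 - ModularForm.eta_q n τ) ^ 24‖ =
      (‖etaSq τ‖ * Real.exp (Real.pi / 6 * τ.im)) ^ 12 := by
    intro τ
    have h := congrArg norm (ModularForm.discriminant_eq_q_prod τ)
    rw [ModularForm.discriminant, norm_mul, Function.Periodic.norm_qParam] at h
    rw [mul_pow, etaSq, ← norm_pow, ← pow_mul, h, ← Real.exp_nat_mul, mul_right_comm,
      ← Real.exp_add]
    have : -2 * Real.pi * (τ : ℂ).im / 1 + (12 : ℕ) * (Real.pi / 6 * τ.im) = 0 := by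
      push_cast
      rw [coe_im]
      ring
    rw [this, Real.exp_zero, one_mul]
  simp_rw [h2, norm_one] at h1
  have h3 := h1.rpow_const (p := ((12 : ℕ) : ℝ)⁻¹) (Or.inl one_ne_zero)
  rw [Real.one_rpow] at h3
  refine h3.congr fun τ => ?_
  exact Real.pow_rpow_inv_natCast (by positivity) (by norm_num)

/-- Writing M = γ(A B; 0 D), the multiplier of γ has norm 1, and the triangular matrix scales the
imaginary part by A/D = A²/det M. The limit is 1/D. -/
theorem tendsto_norm_etaSq_moebius {M : Matrix (Fin 2) (Fin 2) ℤ} (hM : 0 < M.det) :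
    ∃ K : ℝ, 0 < K ∧ Tendsto (fun τ : ℍ => ‖etaSq (moebius M τ)‖ /
      ‖(M 1 0 : ℂ) * τ + (M 1 1 : ℂ)‖ *
      Real.exp (Real.pi / 6 * ((Int.gcd (M 0 0) (M 1 0) : ℝ) ^ 2 / M.det) * τ.im))
      atImInfty (𝓝 K) := by
  obtain ⟨γ, A, B, D, hA, hD, hAD, hAg, hMγ⟩ := exists_hermite hM
  have hA' : (0 : ℝ) < A := by exact_mod_cast hA
  have hD' : (0 : ℝ) < D := by exact_mod_cast hD
  refine ⟨1 / D, by positivity, ?_⟩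
  have hU : 0 < (!![A, B; 0, D] : Matrix (Fin 2) (Fin 2) ℤ).det := by
    rw [Matrix.det_fin_two_of, mul_zero, sub_zero]; positivity
  let φ : ℍ → ℍ := fun τ => ⟨moebius !![A, B; 0, D] τ, moebius_im_pos hU τ.im_pos⟩
  have him : ∀ τ : ℍ, (φ τ).im = A / D * τ.im := by
    intro τ
    change (moebius !![A, B; 0, D] (τ : ℂ)).im = _
    rw [moebius_im, Matrix.det_fin_two_of, mul_zero, sub_zero]
    simp only [Matrix.of_apply, Matrix.cons_val', Matrix.cons_val_zero, Matrix.cons_val_one,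
      Matrix.cons_val_fin_one]
    have : ((0 : ℤ) : ℂ) * (τ : ℂ) + (D : ℂ) = ((D : ℝ) : ℂ) := by push_cast; ring
    rw [this, Complex.normSq_ofReal]
    push_cast
    rw [coe_im]
    field_simp
  have hφ : Tendsto φ atImInfty atImInfty := by
    rw [atImInfty, tendsto_comap_iff]
    have : UpperHalfPlane.im ∘ φ = fun τ => (A / D : ℝ) * τ.im := funext him
    rw [this]
    exact tendsto_comap.const_mul_atTop (by positivity)
  refine ((tendsto_norm_etaSq.comp hφ).div_const (D : ℝ)).congr fun τ => ?_
  have hw : 0 < (φ τ : ℂ).im := (φ τ).im_pos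
  have h1 : moebius M τ = moebius γ (φ τ) := by
    conv_lhs => rw [hMγ]
    exact moebius_mul (det_coe_pos γ) hU τ.im_pos
  have h2 : (M 1 0 : ℂ) * τ + (M 1 1 : ℂ) = ((γ 1 0 : ℂ) * (φ τ : ℂ) + (γ 1 1 : ℂ)) * D := by
    have := moebius_cocycle γ hU τ.im_pos
    rw [← hMγ] at this
    rw [this]
    simp [φ]
  have h3 := moebius_denom_ne_zero (det_coe_pos γ) hw
  rw [h1, etaSqLaw γ _ hw, h2, norm_mul, norm_mul, norm_mul, norm_zpow, norm_unit12, one_zpow,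
    one_mul, Complex.norm_intCast, abs_of_pos hD', ← hAD, ← Int.cast_natCast, ← hAg]
  simp only [Function.comp, him]
  have h3' : ‖(γ 1 0 : ℂ) * (φ τ : ℂ) + (γ 1 1 : ℂ)‖ ≠ 0 := norm_ne_zero_iff.2 h3
  have h4 : Real.pi / 6 * ((A : ℝ) ^ 2 / ((A * D : ℤ) : ℝ)) * τ.im =
      Real.pi / 6 * (A / D * τ.im) := by
    push_cast
    field_simp
  rw [h4]
  field_simp

/-- `24` times the order of `g ∘ M` at `i∞`, divided by two. -/
noncomputable def cuspExponent (M : Matrix (Fin 2) (Fin 2) ℤ) : ℝ :=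
  ((Int.gcd (2 * M 0 0) (M 1 0) : ℝ) ^ 2 / 2 + 2 * (Int.gcd (5 * M 0 0) (M 1 0) : ℝ) ^ 2 / 5
    - 2 * (Int.gcd (M 0 0) (M 1 0) : ℝ) ^ 2 - (Int.gcd (10 * M 0 0) (M 1 0) : ℝ) ^ 2 / 10) / M.det

theorem tendsto_norm_etaSq_mul_moebius {M : Matrix (Fin 2) (Fin 2) ℤ} (hM : 0 < M.det)
    {δ : ℕ} (hδ : 0 < δ) :
    ∃ K : ℝ, 0 < K ∧ Tendsto (fun τ : ℍ => ‖etaSq (δ * moebius M τ)‖ /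
      ‖(M 1 0 : ℂ) * τ + (M 1 1 : ℂ)‖ *
      Real.exp (Real.pi / 6 * ((Int.gcd (δ * M 0 0) (M 1 0) : ℝ) ^ 2 / δ / M.det) * τ.im))
      atImInfty (𝓝 K) := by
  have hdet : (!![δ * M 0 0, δ * M 0 1; M 1 0, M 1 1] : Matrix (Fin 2) (Fin 2) ℤ).det =
      δ * M.det := by
    rw [Matrix.det_fin_two_of, Matrix.det_fin_two]; ring
  have hδ' : (0 : ℤ) < δ := by exact_mod_cast hδ
  obtain ⟨K, hK, h⟩ := tendsto_norm_etaSq_moebius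
    (M := !![δ * M 0 0, δ * M 0 1; M 1 0, M 1 1]) (by rw [hdet]; positivity)
  refine ⟨K, hK, h.congr fun τ => ?_⟩
  rw [hdet]
  have hm : moebius !![δ * M 0 0, δ * M 0 1; M 1 0, M 1 1] τ = δ * moebius M τ := by
    simp [moebius]
    ring
  rw [hm]
  simp only [Matrix.of_apply, Matrix.cons_val', Matrix.cons_val_zero, Matrix.cons_val_one,
      Matrix.cons_val_fin_one]
  push_cast
  rw [div_div]

theorem tendsto_norm_g_moebius {M : Matrix (Fin 2) (Fin 2) ℤ} (hM : 0 < M.det) :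
    ∃ K : ℝ, 0 < K ∧ Tendsto (fun τ : ℍ => ‖g (moebius M τ)‖ *
      Real.exp (Real.pi / 6 * cuspExponent M * τ.im)) atImInfty (𝓝 K) := by
  obtain ⟨K1, h1, t1⟩ := tendsto_norm_etaSq_moebius hM
  obtain ⟨K2, h2, t2⟩ := tendsto_norm_etaSq_mul_moebius hM (δ := 2) (by norm_num)
  obtain ⟨K5, h5, t5⟩ := tendsto_norm_etaSq_mul_moebius hM (δ := 5) (by norm_num)
  obtain ⟨K10, h10, t10⟩ := tendsto_norm_etaSq_mul_moebius hM (δ := 10) (by norm_num)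
  refine ⟨K2 * K5 ^ 2 / (K1 ^ 2 * K10), by positivity,
    ((t2.mul (t5.pow 2)).div ((t1.pow 2).mul t10) (by positivity)).congr fun τ => ?_⟩
  have hc : ‖(M 1 0 : ℂ) * τ + (M 1 1 : ℂ)‖ ≠ 0 :=
    norm_ne_zero_iff.2 (moebius_denom_ne_zero hM τ.im_pos)
  have hp := moebius_im_pos hM τ.im_pos
  have n1 : ‖etaSq (moebius M τ)‖ ≠ 0 := norm_ne_zero_iff.2 (etaSq_ne_zero hp)
  have n10 : ‖etaSq (10 * moebius M τ)‖ ≠ 0 :=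
    norm_ne_zero_iff.2 (etaSq_ne_zero (im_ten_mul_pos hp))
  have hd : (M.det : ℝ) ≠ 0 := by exact_mod_cast hM.ne'
  push_cast
  rw [g_eq, norm_div, norm_mul, norm_mul, norm_pow, norm_pow]
  simp only [mul_pow, div_pow, ← Real.exp_nat_mul]
  have key : ∀ x2 x5 x1 x10 y2 y5 y1 y10 c s : ℝ, c ≠ 0 → y1 ≠ 0 → y10 ≠ 0 →
      x2 + x5 - x1 - x10 = s →
      y2 / c * Real.exp x2 * (y5 ^ 2 / c ^ 2 * Real.exp x5) /
        (y1 ^ 2 / c ^ 2 * Real.exp x1 * (y10 / c * Real.exp x10)) =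
      y2 * y5 ^ 2 / (y1 ^ 2 * y10) * Real.exp s := by
    rintro x2 x5 x1 x10 y2 y5 y1 y10 c s hc h1 h10 rfl
    rw [Real.exp_sub, Real.exp_sub, Real.exp_add]
    have := Real.exp_ne_zero x1
    have := Real.exp_ne_zero x10
    field_simp
  -- The powers of the automorphy factor cancel because `g` has weight 1 + 2 - 2 - 1 = 0.
  refine key _ _ _ _ _ _ _ _ _ _ hc n1 n10 ?_
  rw [cuspExponent]
  push_cast
  field_simp

theorem g_moebius_isBigO {M : Matrix (Fin 2) (Fin 2) ℤ} (hM : 0 < M.det) :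
    (fun τ : ℍ => g (moebius M τ)) =O[atImInfty]
      fun τ : ℍ => Real.exp (-(Real.pi / 6 * cuspExponent M) * τ.im) := by
  obtain ⟨K, _, hK⟩ := tendsto_norm_g_moebius hM
  have h := (hK.isBigO_one ℝ).mul (Asymptotics.isBigO_refl
    (fun τ : ℍ => Real.exp (-(Real.pi / 6 * cuspExponent M) * τ.im)) atImInfty)
  simp only [one_mul] at h
  refine (Asymptotics.isBigO_norm_left.1 (h.congr_left fun τ => ?_))
  rw [mul_assoc, ← Real.exp_add]
  ring_nf
  simp

theorem g_moebius_isBoundedAtImInfty {M : Matrix (Fin 2) (Fin 2) ℤ} (hM : 0 < M.det)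
    (h : 0 ≤ cuspExponent M) : IsBoundedAtImInfty fun τ : ℍ => g (moebius M τ) := by
  refine (g_moebius_isBigO hM).trans ?_
  refine Asymptotics.IsBigO.of_bound 1 (Eventually.of_forall fun τ => ?_)
  have := τ.im_pos
  simp only [Real.norm_eq_abs, Real.abs_exp, Pi.one_apply, mul_one, norm_one]
  rw [Real.exp_le_one_iff]
  have := Real.pi_pos
  have : 0 ≤ Real.pi / 6 * cuspExponent M * τ.im := by positivity
  linarith

theorem gcd_mul_of_isCoprime {s a c : ℤ} (h : IsCoprime a c) (m : ℤ) :
    (Int.gcd (m * (s * a)) (s * c) : ℝ) = |(s : ℝ)| * (Int.gcd m c : ℝ) := by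
  rw [show m * (s * a) = s * (m * a) by ring, Int.gcd_mul_left,
    Int.gcd_mul_left_left_of_gcd_eq_one (Int.isCoprime_iff_gcd_eq_one.1 h)]
  push_cast
  rw [Nat.cast_natAbs, Int.cast_abs]

/-- Let c be the lower left entry of γ in the Hermite form, x = gcd(2, c), y = gcd(5, c). The
numerator is A²(x²/2 + 2y²/5 - 2 - x²y²/10), whose bracket is -6/5, 0, 6, 0 for (x, y) = (1,1),
(2,1), (1,5), (2,5). So only c prime to 10 gives a pole. Coprimality of det M with 10 transfers the
divisibility from M to γ. -/
theorem cuspExponent_nonneg {M : Matrix (Fin 2) (Fin 2) ℤ} (hM : 0 < M.det)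
    (h10 : IsCoprime M.det 10) (h : 2 ∣ M 1 0 ∨ 5 ∣ M 1 0) : 0 ≤ cuspExponent M := by
  obtain ⟨γ, A, B, D, hA, hD, hAD, hAg, hMγ⟩ := exists_hermite hM
  have ha : M 0 0 = A * γ 0 0 := by
    rw [hMγ]; simp [Matrix.mul_apply, Fin.sum_univ_two, mul_comm]
  have hc : M 1 0 = A * γ 1 0 := by
    rw [hMγ]; simp [Matrix.mul_apply, Fin.sum_univ_two, mul_comm]
  have hcop : IsCoprime (γ 0 0) (γ 1 0) := ⟨γ 1 1, -γ 0 1, by linarith [SL_det_eq γ]⟩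
  have hA10 : IsCoprime A 10 := IsCoprime.of_mul_left_left (hAD.symm ▸ h10)
  have hA2 : IsCoprime 2 A := (IsCoprime.of_mul_right_left (y := 2) (z := 5) (by simpa using hA10)).symm
  have hA5 : IsCoprime 5 A :=
    (IsCoprime.of_mul_right_right (y := 2) (z := 5) (by simpa using hA10)).symm
  have h' : 2 ∣ γ 1 0 ∨ 5 ∣ γ 1 0 := by
    rw [hc] at h
    exact h.imp hA2.dvd_of_dvd_mul_left hA5.dvd_of_dvd_mul_left
  have hd : (0 : ℝ) < M.det := by exact_mod_cast hM
  have e1 := gcd_mul_of_isCoprime (s := A) hcop 1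
  rw [one_mul] at e1
  refine div_nonneg ?_ hd.le
  rw [ha, hc, gcd_mul_of_isCoprime hcop, gcd_mul_of_isCoprime hcop, gcd_mul_of_isCoprime hcop, e1]
  generalize γ.1 1 0 = c at *
  have g2 : Int.gcd 2 c = 1 ∨ Int.gcd 2 c = 2 :=
    (Nat.dvd_prime Nat.prime_two).1 (by simpa using Int.gcd_dvd_natAbs_left 2 c)
  have g5 : Int.gcd 5 c = 1 ∨ Int.gcd 5 c = 5 :=
    (Nat.dvd_prime Nat.prime_five).1 (by simpa using Int.gcd_dvd_natAbs_left 5 c)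
  have g10 : Int.gcd 10 c = Int.gcd 2 c * Int.gcd 5 c := by
    have := Nat.Coprime.gcd_mul c.natAbs (m := 2) (n := 5) (by norm_num)
    simp only [Int.gcd, Nat.gcd_comm _ c.natAbs]
    exact this
  have gne : Int.gcd 2 c ≠ 1 ∨ Int.gcd 5 c ≠ 1 := by
    rcases h' with h' | h'
    · left
      have := (Int.gcd_eq_left_iff_dvd (by norm_num)).2 h'
      omega
    · right
      have := (Int.gcd_eq_left_iff_dvd (by norm_num)).2 h'
      omega
  rw [g10, Int.gcd_one_left]
  rcases g2 with g2 | g2 <;> rcases g5 with g5 | g5 <;> rw [g2, g5] <;> push_cast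
  · simp [g2, g5] at gne
  all_goals nlinarith [sq_nonneg (|(A : ℝ)|)]

/-- The matrix of the Fricke involution of level `10`. -/
def fricke : Matrix (Fin 2) (Fin 2) ℤ := !![0, -1; 10, 0]

theorem det_fricke : fricke.det = 10 := by simp [fricke, Matrix.det_fin_two_of]

/-- The pole at the cusp 0 is exactly simple; a nonzero limit is what lets powers of `g` cancel
leading terms. -/
theorem tendsto_norm_g_fricke : ∃ K : ℝ, 0 < K ∧
    Tendsto (fun τ : ℍ => ‖g (moebius fricke τ) * Function.Periodic.qParam 1 τ‖)
      atImInfty (𝓝 K) := by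
  obtain ⟨K, hK, h⟩ := tendsto_norm_g_moebius (M := fricke) (by rw [det_fricke]; norm_num)
  refine ⟨K, hK, h.congr fun τ => ?_⟩
  have : cuspExponent fricke = -12 := by
    rw [cuspExponent, det_fricke]
    simp [fricke]
    norm_num
  rw [this, norm_mul, Function.Periodic.norm_qParam, coe_im]
  congr 2
  ring

theorem gTwo_isBoundedAtImInfty : IsBoundedAtImInfty fun τ : ℍ => gTwo τ := by
  have hd : atkinLehnerTwo.det = 2 := by simp [atkinLehnerTwo, Matrix.det_fin_two_of]
  have : cuspExponent atkinLehnerTwo = 12 := by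
    rw [cuspExponent, hd]
    simp [atkinLehnerTwo]
    norm_num
  have h := g_moebius_isBoundedAtImInfty (M := atkinLehnerTwo) (by rw [hd]; norm_num)
    (by rw [this]; norm_num)
  exact h.congr_left fun τ => g_moebius_atkinLehnerTwo τ.im_pos

open Asymptotics
open scoped Manifold

/-! ### `g` generates the modular functions with a single pole -/

theorem mdifferentiable_of_differentiableOn {F : ℂ → ℂ}
    (hF : DifferentiableOn ℂ F {z | 0 < z.im}) : MDiff (fun τ : ℍ => F τ) := by
  rw [UpperHalfPlane.mdifferentiable_iff]
  refine hF.congr fun z hz => ?_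
  simp [ofComplex_apply_of_im_pos hz]

theorem differentiableOn_moebius {M : Matrix (Fin 2) (Fin 2) ℤ} (hM : 0 < M.det) :
    DifferentiableOn ℂ (moebius M) {z | 0 < z.im} := by
  intro z hz
  have := moebius_denom_ne_zero hM hz
  unfold moebius
  fun_prop (disch := assumption)

theorem differentiableOn_comp_moebius {F : ℂ → ℂ} (hF : DifferentiableOn ℂ F {z | 0 < z.im})
    {M : Matrix (Fin 2) (Fin 2) ℤ} (hM : 0 < M.det) :
    DifferentiableOn ℂ (fun z => F (moebius M z)) {z | 0 < z.im} :=
  hF.comp (differentiableOn_moebius hM) fun _ hz => moebius_im_pos hM hz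

theorem differentiableOn_etaSq_mul {c : ℂ} (hc : ∀ z : ℂ, 0 < z.im → 0 < (c * z).im) :
    DifferentiableOn ℂ (fun z => etaSq (c * z)) {z | 0 < z.im} := by
  intro z hz
  have h := ModularForm.differentiableAt_eta_of_mem_upperHalfPlaneSet (hc z hz)
  have h2 : DifferentiableAt ℂ (fun z => ModularForm.eta (c * z)) z :=
    h.comp z (by fun_prop)
  exact (h2.pow 2).differentiableWithinAt

theorem differentiableOn_etaSq : DifferentiableOn ℂ etaSq {z | 0 < z.im} := by
  simpa using differentiableOn_etaSq_mul (c := 1) (by simp)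

theorem differentiableOn_g : DifferentiableOn ℂ g {z | 0 < z.im} := by
  have h : DifferentiableOn ℂ (fun z => etaSq (2 * z) * etaSq (5 * z) ^ 2 /
      (etaSq z ^ 2 * etaSq (10 * z))) {z | 0 < z.im} := by
    refine ((differentiableOn_etaSq_mul fun z => im_two_mul_pos).mul
      ((differentiableOn_etaSq_mul fun z => im_five_mul_pos).pow 2)).div
      ((differentiableOn_etaSq.pow 2).mul (differentiableOn_etaSq_mul fun z => im_ten_mul_pos))
      fun z hz => ?_
    exact mul_ne_zero (pow_ne_zero _ (etaSq_ne_zero hz)) (etaSq_ne_zero (im_ten_mul_pos hz))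
  exact h.congr fun z _ => g_eq z

theorem differentiableOn_gTwo : DifferentiableOn ℂ gTwo {z | 0 < z.im} :=
  (differentiableOn_comp_moebius differentiableOn_g (M := atkinLehnerTwo)
    (by simp [atkinLehnerTwo, Matrix.det_fin_two_of])).congr
    fun _ hz => (g_moebius_atkinLehnerTwo hz).symm

/-- Invariance under `Γ₀(10)`. -/
def IsGammaZeroInvariant (F : ℂ → ℂ) : Prop :=
  ∀ γ : SL(2, ℤ), (10 : ℤ) ∣ γ 1 0 → ∀ z : ℂ, 0 < z.im → F (moebius γ z) = F z

/-- Holomorphic functions on the upper half-plane that are bounded at all cusps but those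
equivalent to `0`, and have at most a pole at `0`. -/
def holoAlg : Subalgebra ℂ (ℂ → ℂ) where
  carrier := {F | DifferentiableOn ℂ F {z | 0 < z.im} ∧
    (∀ γ : SL(2, ℤ), (2 ∣ γ 1 0 ∨ 5 ∣ γ 1 0) →
      IsBoundedAtImInfty fun τ : ℍ => F (moebius γ τ)) ∧
    ∃ N : ℕ, (fun τ : ℍ => F (moebius fricke τ)) =O[atImInfty]
      fun τ : ℍ => Real.exp (N * τ.im)}
  mul_mem' := by
    rintro F G ⟨hF, hFb, N, hFN⟩ ⟨hG, hGb, N', hGN⟩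
    refine ⟨hF.mul hG, fun γ hγ => (hFb γ hγ).mul (hGb γ hγ), N + N', ?_⟩
    refine (hFN.mul hGN).congr_right fun τ => ?_
    rw [← Real.exp_add]
    push_cast
    ring_nf
  add_mem' := by
    rintro F G ⟨hF, hFb, N, hFN⟩ ⟨hG, hGb, N', hGN⟩
    refine ⟨hF.add hG, fun γ hγ => (hFb γ hγ).add (hGb γ hγ), N + N', ?_⟩
    have key : ∀ m m' : ℕ, m ≤ m' → (fun τ : ℍ => Real.exp (m * τ.im)) =O[atImInfty]
        fun τ : ℍ => Real.exp (m' * τ.im) := fun m m' h =>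
      IsBigO.of_bound 1 (Eventually.of_forall fun τ => by
        rw [Real.norm_eq_abs, Real.norm_eq_abs, Real.abs_exp, Real.abs_exp, one_mul]
        have := τ.im_pos
        gcongr)
    exact (hFN.trans (key _ _ (Nat.le_add_right _ _))).add
      (hGN.trans (key _ _ (Nat.le_add_left _ _)))
  algebraMap_mem' := by
    intro r
    refine ⟨differentiableOn_const _, fun γ _ => isBigO_const_const _ one_ne_zero _, 0, ?_⟩
    simp only [Nat.cast_zero, zero_mul, Real.exp_zero]
    exact isBigO_const_const _ one_ne_zero _

/-- Such a function is a modular form of weight zero for Γ₀(10), hence constant. -/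
theorem eq_const_of_bounded {F : ℂ → ℂ} (hd : DifferentiableOn ℂ F {z | 0 < z.im})
    (hinv : IsGammaZeroInvariant F)
    (hb : ∀ γ : SL(2, ℤ), IsBoundedAtImInfty fun τ : ℍ => F (moebius γ τ)) :
    ∃ c : ℂ, ∀ z : ℂ, 0 < z.im → F z = c := by
  have hslash : ∀ (γ : SL(2, ℤ)) (τ : ℍ),
      SlashAction.map (0 : ℤ) γ (fun τ : ℍ => F τ) τ = F (moebius γ τ) := by
    intro γ τ
    rw [ModularForm.SL_slash_apply, neg_zero, zpow_zero, mul_one, coe_specialLinearGroup_apply]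
    simp [moebius]
  let Γ : Subgroup (GL (Fin 2) ℝ) := (CongruenceSubgroup.Gamma0 10 : Subgroup SL(2, ℤ))
  have : Γ.IsArithmetic := by
    rw [Subgroup.isArithmetic_iff_finiteIndex]
    infer_instance
  let f : ModularForm Γ 0 :=
    { toFun := fun τ => F τ
      slash_action_eq' := by
        rintro _ ⟨γ, hγ, rfl⟩
        ext τ
        have h := hslash γ τ
        refine h.trans (hinv γ ?_ τ τ.im_pos)
        have := CongruenceSubgroup.Gamma0_mem.1 hγ
        exact (ZMod.intCast_zmod_eq_zero_iff_dvd _ 10).1 this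
      holo' := mdifferentiable_of_differentiableOn hd
      bdd_at_cusps' := by
        intro c hc
        rw [Subgroup.IsArithmetic.isCusp_iff_isCusp_SL2Z] at hc
        rw [OnePoint.isBoundedAt_iff_forall_SL2Z hc]
        intro γ _
        have := hb γ
        refine this.congr_left fun τ => (hslash γ τ).symm }
  obtain ⟨c, hc⟩ := ModularForm.eq_const_of_weight_zero f
  exact ⟨c, fun z hz => congrFun hc ⟨z, hz⟩⟩

/-! ### The cusps equivalent to 0 and expansions there -/

/-- A cusp with denominator prime to 10 is Γ₀(10)-equivalent to 0, so growth there is controlled by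
the Fricke matrix. -/
theorem exists_fricke_decomposition (γ : SL(2, ℤ)) (h2 : ¬ 2 ∣ γ 1 0) (h5 : ¬ 5 ∣ γ 1 0) :
    ∃ (γ' : SL(2, ℤ)) (j : ℤ), (10 : ℤ) ∣ γ' 1 0 ∧ ∀ z : ℂ, 0 < z.im →
      moebius γ z = moebius γ' (moebius fricke (moebius !![1, j; 0, 10] z)) := by
  have hc : IsCoprime (γ 1 0) 10 := by
    have h2' : IsCoprime (γ 1 0) 2 :=
      ((Int.prime_two.coprime_iff_not_dvd).2 h2).symm
    have h5' : IsCoprime (γ 1 0) 5 :=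
      (((Nat.prime_iff_prime_int.1 Nat.prime_five).coprime_iff_not_dvd).2 h5).symm
    simpa using h2'.mul_right h5'
  obtain ⟨x, y, hxy⟩ := hc
  -- The chosen j solves jc ≡ d mod 10 for the bottom row (c, d) of γ, which puts γT⁻ʲS⁻¹ in Γ₀(10).
  obtain ⟨j, hj⟩ : ∃ j, j = x * γ 1 1 := ⟨_, rfl⟩
  have hdet := SL_det_eq γ
  refine ⟨⟨!![j * γ 0 0 - γ 0 1, γ 0 0; j * γ 1 0 - γ 1 1, γ 1 0], ?_⟩, j, ?_, fun z hz => ?_⟩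
  · rw [Matrix.det_fin_two_of]; linarith
  · refine ⟨-y * γ 1 1, ?_⟩
    simp only [Matrix.of_apply, Matrix.cons_val', Matrix.cons_val_zero, Matrix.cons_val_one,
      Matrix.cons_val_fin_one, hj]
    linear_combination (γ 1 1) * hxy
  · have hw : moebius fricke (moebius !![1, j; 0, 10] z) = -1 / (z + j) := by
      simp [moebius, fricke]
      rw [mul_div_cancel₀ _ (by norm_num)]
    have hz0 : z + j ≠ 0 := by
      intro h
      have := congrArg Complex.im h
      simp at this
      exact hz.ne' this
    rw [hw]
    simp only [moebius, Matrix.of_apply, Matrix.cons_val', Matrix.cons_val_zero,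
      Matrix.cons_val_one, Matrix.cons_val_fin_one]
    rw [mul_div_assoc', mul_div_assoc', div_add' _ _ _ hz0, div_add' _ _ _ hz0,
      div_div_div_cancel_right₀ hz0]
    push_cast
    congr 1 <;> ring

theorem tendsto_moebius_atImInfty (j : ℤ) :
    ∃ φ : ℍ → ℍ, (∀ τ : ℍ, (φ τ : ℂ) = moebius !![1, j; 0, 10] τ) ∧
      Tendsto φ atImInfty atImInfty := by
  have hU : 0 < (!![1, j; 0, 10] : Matrix (Fin 2) (Fin 2) ℤ).det := by
    simp [Matrix.det_fin_two_of]
  refine ⟨fun τ => ⟨moebius !![1, j; 0, 10] τ, moebius_im_pos hU τ.im_pos⟩, fun τ => rfl, ?_⟩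
  rw [atImInfty, tendsto_comap_iff]
  have : UpperHalfPlane.im ∘ (fun τ : ℍ => (⟨moebius !![1, j; 0, 10] τ,
      moebius_im_pos hU τ.im_pos⟩ : ℍ)) = fun τ => (1 / 10 : ℝ) * τ.im := by
    funext τ
    change (moebius !![1, j; 0, 10] (τ : ℂ)).im = _
    rw [moebius_im, Matrix.det_fin_two_of]
    simp [Complex.normSq_ofNat]
    ring
  rw [this]
  exact tendsto_comap.const_mul_atTop (by positivity)

theorem isBoundedAtImInfty_moebius_of_fricke {F : ℂ → ℂ} (hinv : IsGammaZeroInvariant F)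
    (hb : ∀ γ : SL(2, ℤ), (2 ∣ γ 1 0 ∨ 5 ∣ γ 1 0) →
      IsBoundedAtImInfty fun τ : ℍ => F (moebius γ τ))
    (hf : IsBoundedAtImInfty fun τ : ℍ => F (moebius fricke τ)) (γ : SL(2, ℤ)) :
    IsBoundedAtImInfty fun τ : ℍ => F (moebius γ τ) := by
  by_cases h : 2 ∣ γ 1 0 ∨ 5 ∣ γ 1 0
  · exact hb γ h
  · push Not at h
    obtain ⟨γ', j, hγ', hdec⟩ := exists_fricke_decomposition γ h.1 h.2
    obtain ⟨φ, hφ, hφt⟩ := tendsto_moebius_atImInfty j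
    refine (hf.comp_tendsto hφt).congr_left fun τ => ?_
    simp only [Function.comp]
    rw [hdec τ τ.im_pos, ← hφ, hinv γ' hγ']
    exact moebius_im_pos (by rw [det_fricke]; norm_num) (φ τ).im_pos

theorem periodic_comp_ofComplex_of {H : ℂ → ℂ} (hp : ∀ z : ℂ, 0 < z.im → H (z + 1) = H z) :
    Function.Periodic ((fun τ : ℍ => H τ) ∘ ofComplex) ((1 : ℝ) : ℂ) := by
  intro z
  simp only [Function.comp, Complex.ofReal_one]
  by_cases hz : 0 < z.im
  · rw [ofComplex_apply_of_im_pos hz, ofComplex_apply_of_im_pos (by simpa using hz)]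
    exact hp z hz
  -- Off the upper half-plane `ofComplex` takes one constant default value.
  · rw [ofComplex_apply_of_im_nonpos (not_lt.1 hz),
      ofComplex_apply_of_im_nonpos (by simpa using not_lt.1 hz)]

/-- A bounded periodic function extends holomorphically over q = 0; the error term O(q) drives the
descent on the pole order. -/
theorem exists_tendsto_of_bounded {H : ℂ → ℂ} (hd : DifferentiableOn ℂ H {z | 0 < z.im})
    (hp : ∀ z : ℂ, 0 < z.im → H (z + 1) = H z)
    (hb : IsBoundedAtImInfty fun τ : ℍ => H τ) :
    ∃ c : ℂ, Tendsto (fun τ : ℍ => H τ) atImInfty (𝓝 c) ∧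
      (fun τ : ℍ => H τ - c) =O[atImInfty] fun τ : ℍ => Function.Periodic.qParam 1 τ := by
  have h := exp_decay_sub_atImInfty one_pos (periodic_comp_ofComplex_of hp)
    (mdifferentiable_of_differentiableOn hd) hb
  have h' : (fun τ : ℍ => H τ - valueAtInfty fun τ : ℍ => H τ) =O[atImInfty]
      fun τ : ℍ => Function.Periodic.qParam 1 τ := by
    rw [← isBigO_norm_right]
    refine h.congr_right fun τ => ?_
    rw [Function.Periodic.norm_qParam, coe_im]
  refine ⟨_, ?_, h'⟩
  have := h'.trans_tendsto (qParam_tendsto_atImInfty one_pos)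
  simpa using this.add_const (valueAtInfty fun τ : ℍ => H τ)

/-- The Fricke matrix conjugates T to (1 0; -10 1), which lies in Γ₀(10). -/
theorem comp_fricke_add_one {F : ℂ → ℂ} (hinv : IsGammaZeroInvariant F) {z : ℂ} (hz : 0 < z.im) :
    F (moebius fricke (z + 1)) = F (moebius fricke z) := by
  have hf : 0 < fricke.det := by rw [det_fricke]; norm_num
  have h1 : 0 < (!![1, 1; 0, 1] : Matrix (Fin 2) (Fin 2) ℤ).det := by
    simp [Matrix.det_fin_two_of]
  have hγ : (!![1, 0; -10, 1] : Matrix (Fin 2) (Fin 2) ℤ).det = 1 := by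
    simp [Matrix.det_fin_two_of]
  rw [← hinv ⟨!![1, 0; -10, 1], hγ⟩ (by simp) _ (moebius_im_pos hf hz), ← moebius_mul _ hf hz]
  · rw [show z + 1 = moebius !![1, 1; 0, 1] z by simp [moebius], ← moebius_mul hf h1 hz]
    congr 1
  · simp [hγ]

/-- Membership in `holoAlg` does not require invariance, so each single conjugate of `g` belongs to
it, and therefore so do their symmetric functions. -/
theorem g_mem_holoAlg_of {M : Matrix (Fin 2) (Fin 2) ℤ} (hM : 0 < M.det)
    (h10 : IsCoprime M.det 10) (hM10 : (10 : ℤ) ∣ M 1 0) :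
    (fun z => g (moebius M z)) ∈ holoAlg := by
  have hf : 0 < fricke.det := by rw [det_fricke]; norm_num
  refine ⟨differentiableOn_comp_moebius differentiableOn_g hM, fun γ hγ => ?_, ?_⟩
  · have hdet : (M * γ).det = M.det := by rw [Matrix.det_mul, γ.det_coe, mul_one]
    refine (g_moebius_isBoundedAtImInfty (M := M * γ) (hdet.symm ▸ hM)
      (cuspExponent_nonneg (hdet.symm ▸ hM) (hdet.symm ▸ h10) ?_)).congr_left fun τ => ?_
    · have : (M * γ) 1 0 = M 1 0 * γ 0 0 + M 1 1 * γ 1 0 := by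
        rw [Matrix.mul_apply, Fin.sum_univ_two]
      rw [this]
      refine hγ.imp (fun h => ?_) fun h => ?_
      · exact dvd_add (dvd_mul_of_dvd_left (dvd_trans (by norm_num) hM10) _)
          (dvd_mul_of_dvd_right h _)
      · exact dvd_add (dvd_mul_of_dvd_left (dvd_trans (by norm_num) hM10) _)
          (dvd_mul_of_dvd_right h _)
    · rw [moebius_mul hM (det_coe_pos γ) τ.im_pos]
  · have hdet : 0 < (M * fricke).det := by rw [Matrix.det_mul]; positivity
    obtain ⟨N, hN⟩ := exists_nat_ge (-(Real.pi / 6 * cuspExponent (M * fricke)))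
    refine ⟨N, ((g_moebius_isBigO hdet).trans ?_).congr_left fun τ => ?_⟩
    · refine IsBigO.of_bound 1 (Eventually.of_forall fun τ => ?_)
      rw [Real.norm_eq_abs, Real.norm_eq_abs, Real.abs_exp, Real.abs_exp, one_mul]
      have := τ.im_pos
      gcongr
    · rw [moebius_mul hM hf τ.im_pos]

theorem g_isGammaZeroInvariant : IsGammaZeroInvariant g := fun _ hγ _ hz => g_moebius hγ hz

theorem g_mem_holoAlg : g ∈ holoAlg := by
  simpa [moebius_one] using g_mem_holoAlg_of (M := 1) (by simp) (by simpa using isCoprime_one_left)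
    (by simp)

/-- Induction on the pole order at 0. If c and c' are the leading coefficients of F and `g` there,
subtracting (c / c'^(N+1)) g^(N+1) lowers the order; with no pole, F is constant. -/
theorem exists_eq_eval_g_of_order (N : ℕ) : ∀ {F : ℂ → ℂ}, F ∈ holoAlg → IsGammaZeroInvariant F →
    (IsBoundedAtImInfty fun τ : ℍ => F (moebius fricke τ) * Function.Periodic.qParam 1 τ ^ N) →
    ∃ P : ℂ[X], ∀ z : ℂ, 0 < z.im → F z = P.eval (g z) := by
  have hf : 0 < fricke.det := by rw [det_fricke]; norm_num
  have hqp : ∀ z : ℂ, Function.Periodic.qParam 1 (z + 1) = Function.Periodic.qParam 1 z := by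
    intro z
    simp only [Function.Periodic.qParam]
    rw [Complex.exp_eq_exp_iff_exists_int]
    exact ⟨1, by push_cast; ring⟩
  have hqd : Differentiable ℂ (Function.Periodic.qParam 1) :=
    Function.Periodic.differentiable_qParam
  induction N with
  | zero =>
    intro F hF hinv hb
    obtain ⟨c, hc⟩ := eq_const_of_bounded hF.1 hinv
      (isBoundedAtImInfty_moebius_of_fricke hinv hF.2.1 (by simpa using hb))
    exact ⟨C c, fun z hz => by rw [hc z hz, eval_C]⟩
  | succ N ih =>
    intro F hF hinv hb
    obtain ⟨c, hc, -⟩ := exists_tendsto_of_bounded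
      (H := fun z => F (moebius fricke z) * Function.Periodic.qParam 1 z ^ (N + 1))
      ((differentiableOn_comp_moebius hF.1 hf).mul (hqd.differentiableOn.pow _))
      (fun z hz => by rw [comp_fricke_add_one hinv hz, hqp]) hb
    obtain ⟨K, hK, hgK⟩ := tendsto_norm_g_fricke
    obtain ⟨c', hc', -⟩ := exists_tendsto_of_bounded
      (H := fun z => g (moebius fricke z) * Function.Periodic.qParam 1 z)
      ((differentiableOn_comp_moebius differentiableOn_g hf).mul hqd.differentiableOn)
      (fun z hz => by rw [comp_fricke_add_one g_isGammaZeroInvariant hz, hqp])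
      (isBigO_norm_left.1 (hgK.isBigO_one ℝ))
    have hc0 : c' ≠ 0 := by
      have : ‖c'‖ = K := tendsto_nhds_unique hc'.norm hgK
      exact norm_ne_zero_iff.1 (this ▸ hK.ne')
    have hF'mem : F - (c / c' ^ (N + 1)) • g ^ (N + 1) ∈ holoAlg :=
      sub_mem hF (Subalgebra.smul_mem _ (pow_mem g_mem_holoAlg _) _)
    have hF'inv : IsGammaZeroInvariant (F - (c / c' ^ (N + 1)) • g ^ (N + 1)) := by
      intro γ hγ z hz
      simp only [Pi.sub_apply, Pi.smul_apply, Pi.pow_apply, hinv γ hγ z hz, g_moebius hγ hz]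
    have hF'eq : ∀ τ : ℂ, (F - (c / c' ^ (N + 1)) • g ^ (N + 1)) (moebius fricke τ) *
        Function.Periodic.qParam 1 τ ^ (N + 1) =
        F (moebius fricke τ) * Function.Periodic.qParam 1 τ ^ (N + 1) -
        (c / c' ^ (N + 1)) * (g (moebius fricke τ) * Function.Periodic.qParam 1 τ) ^ (N + 1) := by
      intro τ
      simp only [Pi.sub_apply, Pi.smul_apply, Pi.pow_apply, smul_eq_mul]
      ring
    have hlim : Tendsto (fun τ : ℍ => (F - (c / c' ^ (N + 1)) • g ^ (N + 1)) (moebius fricke τ) *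
        Function.Periodic.qParam 1 τ ^ (N + 1)) atImInfty (𝓝 0) := by
      have := hc.sub ((hc'.pow (N + 1)).const_mul (c / c' ^ (N + 1)))
      rw [div_mul_cancel₀ _ (pow_ne_zero _ hc0), sub_self] at this
      exact this.congr fun τ => (hF'eq τ).symm
    obtain ⟨c'', hc'', hO⟩ := exists_tendsto_of_bounded
      (H := fun z => (F - (c / c' ^ (N + 1)) • g ^ (N + 1)) (moebius fricke z) *
        Function.Periodic.qParam 1 z ^ (N + 1))
      ((differentiableOn_comp_moebius hF'mem.1 hf).mul (hqd.differentiableOn.pow _))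
      (fun z hz => by rw [comp_fricke_add_one hF'inv hz, hqp]) (hlim.isBigO_one ℝ)
    obtain rfl : c'' = 0 := tendsto_nhds_unique hc'' hlim
    -- The product with q^(N+1) has limit 0, hence is O(q); dividing by q leaves a bounded function.
    have hbd : IsBoundedAtImInfty fun τ : ℍ => (F - (c / c' ^ (N + 1)) • g ^ (N + 1))
        (moebius fricke τ) * Function.Periodic.qParam 1 τ ^ N := by
      have h1 := hO.mul (isBigO_refl (fun τ : ℍ => (Function.Periodic.qParam 1 (τ : ℂ))⁻¹) atImInfty)
      refine (h1.congr (fun τ => ?_) fun τ => ?_).trans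
        (isBigO_const_const (1 : ℂ) (one_ne_zero (α := ℝ)) _)
      · have := Function.Periodic.qParam_ne_zero (h := 1) (τ : ℂ)
        rw [sub_zero, pow_succ (Function.Periodic.qParam 1 (τ : ℂ)), ← mul_assoc, mul_inv_cancel_right₀ this]
      · exact mul_inv_cancel₀ (Function.Periodic.qParam_ne_zero _)
    obtain ⟨P, hP⟩ := ih hF'mem hF'inv hbd
    refine ⟨P + C (c / c' ^ (N + 1)) * X ^ (N + 1), fun z hz => ?_⟩
    rw [eval_add, ← hP z hz]
    simp

/-- Since 2π > 1, growth exp(N Im τ) is dominated by |q|⁻ᴺ, so N bounds the pole order. -/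
theorem exists_eq_eval_g {F : ℂ → ℂ} (hF : F ∈ holoAlg) (hinv : IsGammaZeroInvariant F) :
    ∃ P : ℂ[X], ∀ z : ℂ, 0 < z.im → F z = P.eval (g z) := by
  obtain ⟨N, hN⟩ := hF.2.2
  refine exists_eq_eval_g_of_order N hF hinv ?_
  refine (hN.mul (isBigO_refl (fun τ : ℍ => Function.Periodic.qParam 1 (τ : ℂ) ^ N)
    atImInfty).norm_right).trans ?_
  refine IsBigO.of_bound 1 (Eventually.of_forall fun τ => ?_)
  rw [norm_mul, norm_norm, norm_pow, Function.Periodic.norm_qParam, Real.norm_eq_abs, Real.abs_exp,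
    ← Real.exp_nat_mul, ← Real.exp_add]
  simp only [Pi.one_apply, norm_one, mul_one]
  rw [Real.exp_le_one_iff, coe_im]
  have h1 := τ.im_pos
  have h3 := Real.pi_gt_three
  have : (N : ℝ) * τ.im + N * (-2 * Real.pi * τ.im / 1) = N * τ.im * (1 - 2 * Real.pi) := by ring
  rw [this]
  exact mul_nonpos_of_nonneg_of_nonpos (by positivity) (by linarith)

/-! ### Primitive matrices of determinant `n` and level `10` -/

/-- The upper triangular matrix `(a b; 0 n/a)`. -/
def upper (n : ℕ) (i : Σ _ : ℕ, ℕ) : Matrix (Fin 2) (Fin 2) ℤ :=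
  !![(i.1 : ℤ), (i.2 : ℤ); 0, ((n / i.1 : ℕ) : ℤ)]

/-- The index set of the product defining the modular polynomial of level `n`. -/
def idx (n : ℕ) : Finset (Σ _ : ℕ, ℕ) :=
  n.divisors.sigma fun a => (Finset.range (n / a)).filter fun b => (a.gcd b).gcd (n / a) = 1

theorem mem_idx {n : ℕ} {i : Σ _ : ℕ, ℕ} : i ∈ idx n ↔
    (i.1 ∣ n ∧ n ≠ 0) ∧ i.2 < n / i.1 ∧ (i.1.gcd i.2).gcd (n / i.1) = 1 := by
  simp [idx]

/-- Primitive integral matrices of determinant `n` whose lower left entry is divisible by `10`. -/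
structure IsPrim (n : ℕ) (M : Matrix (Fin 2) (Fin 2) ℤ) : Prop where
  det_eq : M.det = n
  ten_dvd : (10 : ℤ) ∣ M 1 0
  isUnit_of_dvd : ∀ k : ℤ, (∀ i j, k ∣ M i j) → IsUnit k

theorem dvd_mul_left_entries {k : ℤ} {M : Matrix (Fin 2) (Fin 2) ℤ} (h : ∀ i j, k ∣ M i j)
    (N : Matrix (Fin 2) (Fin 2) ℤ) (i j : Fin 2) : k ∣ (N * M) i j := by
  rw [Matrix.mul_apply]
  exact Finset.dvd_sum fun l _ => dvd_mul_of_dvd_right (h l j) _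

theorem dvd_mul_right_entries {k : ℤ} {M : Matrix (Fin 2) (Fin 2) ℤ} (h : ∀ i j, k ∣ M i j)
    (N : Matrix (Fin 2) (Fin 2) ℤ) (i j : Fin 2) : k ∣ (M * N) i j := by
  rw [Matrix.mul_apply]
  exact Finset.dvd_sum fun l _ => dvd_mul_of_dvd_left (h i l) _

theorem ten_dvd_mul {M N : Matrix (Fin 2) (Fin 2) ℤ} (hM : (10 : ℤ) ∣ M 1 0)
    (hN : (10 : ℤ) ∣ N 1 0) : (10 : ℤ) ∣ (M * N) 1 0 := by
  rw [Matrix.mul_apply, Fin.sum_univ_two]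
  exact dvd_add (dvd_mul_of_dvd_left hM _) (dvd_mul_of_dvd_right hN _)

theorem ten_dvd_inv {γ : SL(2, ℤ)} (hγ : (10 : ℤ) ∣ γ 1 0) : (10 : ℤ) ∣ γ⁻¹ 1 0 := by
  rw [Matrix.SpecialLinearGroup.SL2_inv_expl]
  simpa using hγ

theorem coe_inv_mul_cancel (γ : SL(2, ℤ)) (M : Matrix (Fin 2) (Fin 2) ℤ) :
    ((γ⁻¹ : SL(2, ℤ)) : Matrix (Fin 2) (Fin 2) ℤ) * ((γ : Matrix (Fin 2) (Fin 2) ℤ) * M) = M := by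
  rw [← Matrix.mul_assoc, ← Matrix.SpecialLinearGroup.coe_mul, inv_mul_cancel,
    Matrix.SpecialLinearGroup.coe_one, Matrix.one_mul]

theorem coe_mul_inv_cancel_right (γ : SL(2, ℤ)) (M : Matrix (Fin 2) (Fin 2) ℤ) :
    M * (γ : Matrix (Fin 2) (Fin 2) ℤ) * ((γ⁻¹ : SL(2, ℤ)) : Matrix (Fin 2) (Fin 2) ℤ) = M := by
  rw [Matrix.mul_assoc, ← Matrix.SpecialLinearGroup.coe_mul, mul_inv_cancel,
    Matrix.SpecialLinearGroup.coe_one, Matrix.mul_one]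

theorem IsPrim.mul_right {n : ℕ} {M : Matrix (Fin 2) (Fin 2) ℤ} (hM : IsPrim n M)
    {γ : SL(2, ℤ)} (hγ : (10 : ℤ) ∣ γ 1 0) : IsPrim n (M * γ) := by
  refine ⟨?_, ten_dvd_mul hM.ten_dvd hγ, fun k hk => hM.isUnit_of_dvd k ?_⟩
  · rw [Matrix.det_mul, γ.det_coe, mul_one, hM.det_eq]
  · have := dvd_mul_right_entries hk (γ⁻¹ : SL(2, ℤ))
    rwa [coe_mul_inv_cancel_right] at this

theorem IsPrim.det_pos {n : ℕ} (hn : 0 < n) {M : Matrix (Fin 2) (Fin 2) ℤ} (hM : IsPrim n M) :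
    0 < M.det := by rw [hM.det_eq]; exact_mod_cast hn

theorem det_upper {n : ℕ} {i : Σ _ : ℕ, ℕ} (hi : i ∈ idx n) : (upper n i).det = n := by
  rw [upper, Matrix.det_fin_two_of, mul_zero, sub_zero]
  exact_mod_cast Nat.mul_div_cancel' (mem_idx.1 hi).1.1

theorem isPrim_upper {n : ℕ} {i : Σ _ : ℕ, ℕ} (hi : i ∈ idx n) : IsPrim n (upper n i) := by
  refine ⟨det_upper hi, by simp [upper], fun k hk => ?_⟩
  have h1 : k.natAbs ∣ i.1 := by simpa [upper, Int.natCast_dvd_natCast, ← Int.dvd_natCast] using hk 0 0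
  have h2 : k.natAbs ∣ i.2 := by simpa [upper, Int.natCast_dvd_natCast, ← Int.dvd_natCast] using hk 0 1
  have h3 : k.natAbs ∣ n / i.1 := by
    have := hk 1 1
    rw [← Int.natAbs_dvd] at this
    exact Int.natCast_dvd_natCast.1 this
  have h4 := Nat.dvd_gcd (Nat.dvd_gcd h1 h2) h3
  rw [(mem_idx.1 hi).2.2, Nat.dvd_one] at h4
  exact Int.isUnit_iff_natAbs_eq.2 h4

/-- Hermite form with B reduced modulo D. As A divides n it is prime to 10, so 10 ∣ A·γ₁₀ forces γ
into Γ₀(10). -/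
theorem exists_upper {n : ℕ} (hn : n.Coprime 10) {M : Matrix (Fin 2) (Fin 2) ℤ}
    (hM : IsPrim n M) : ∃ γ : SL(2, ℤ), (10 : ℤ) ∣ γ 1 0 ∧ ∃ i ∈ idx n, M = γ * upper n i := by
  have hn0 : 0 < n := Nat.pos_of_ne_zero fun h => by simp [h] at hn
  obtain ⟨γ, A, B, D, hA, hD, hAD, -, hMγ⟩ := exists_hermite (hM.det_pos hn0)
  rw [hM.det_eq] at hAD
  have hcopA : IsCoprime (10 : ℤ) A := by
    have h : IsCoprime (A * D) 10 := by rw [hAD]; exact_mod_cast Nat.isCoprime_iff_coprime.2 hn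
    exact h.of_mul_left_left.symm
  have h10 : (10 : ℤ) ∣ γ 1 0 := by
    have := hM.ten_dvd
    rw [hMγ] at this
    simp only [Matrix.mul_apply, Fin.sum_univ_two, Matrix.of_apply, Matrix.cons_val',
      Matrix.cons_val_zero, Matrix.cons_val_one, Matrix.cons_val_fin_one, mul_zero,
      add_zero] at this
    exact hcopA.dvd_of_dvd_mul_right this
  lift A to ℕ using hA.le
  lift D to ℕ using hD.le
  have hAD' : A * D = n := by exact_mod_cast hAD
  have hA0 : 0 < A := by exact_mod_cast hA
  have hD0 : 0 < D := by exact_mod_cast hD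
  have hnA : n / A = D := by rw [← hAD', Nat.mul_div_cancel_left _ hA0]
  have hb0 := Int.emod_nonneg B hD.ne'
  have hb1 := Int.emod_lt_of_pos B hD
  obtain ⟨b, hb⟩ := Int.eq_ofNat_of_zero_le hb0
  have hbD : b < D := by rw [hb] at hb1; exact_mod_cast hb1
  have hB := Int.emod_add_mul_ediv B D
  rw [hb] at hB
  let τ : SL(2, ℤ) := ⟨!![1, B / D; 0, 1], by simp [Matrix.det_fin_two_of]⟩
  have hMτ : M = ((γ * τ : SL(2, ℤ)) : Matrix (Fin 2) (Fin 2) ℤ) * upper n ⟨A, b⟩ := by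
    rw [hMγ, Matrix.SpecialLinearGroup.coe_mul, Matrix.mul_assoc]
    congr 1
    ext i j
    fin_cases i <;> fin_cases j <;>
      simp [τ, upper, Matrix.mul_apply, Fin.sum_univ_two, hnA]
    linarith
  refine ⟨γ * τ, ten_dvd_mul h10 (by simp [τ]), ⟨A, b⟩, ?_, hMτ⟩
  rw [mem_idx]
  refine ⟨⟨Dvd.intro _ hAD', hn0.ne'⟩, by simpa [hnA] using hbD, ?_⟩
  have hu := hM.isUnit_of_dvd (((A.gcd b).gcd (n / A) : ℕ) : ℤ) (by
    rw [hMτ]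
    refine dvd_mul_left_entries (fun i j => ?_) _
    have e1 : (A.gcd b).gcd (n / A) ∣ A := (Nat.gcd_dvd_left _ _).trans (Nat.gcd_dvd_left _ _)
    have e2 : (A.gcd b).gcd (n / A) ∣ b := (Nat.gcd_dvd_left _ _).trans (Nat.gcd_dvd_right _ _)
    have e3 : (A.gcd b).gcd (n / A) ∣ n / A := Nat.gcd_dvd_right _ _
    fin_cases i <;> fin_cases j
    · exact Int.natCast_dvd_natCast.2 e1
    · exact Int.natCast_dvd_natCast.2 e2
    · exact dvd_zero _
    · exact Int.natCast_dvd_natCast.2 e3)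
  simpa [Int.isUnit_iff_natAbs_eq] using hu

theorem upper_injective {n : ℕ} {γ : SL(2, ℤ)} {i i' : Σ _ : ℕ, ℕ} (hi : i ∈ idx n)
    (hi' : i' ∈ idx n) (h : γ * upper n i = upper n i') : i = i' := by
  obtain ⟨a, b⟩ := i
  obtain ⟨a', b'⟩ := i'
  obtain ⟨⟨ha, hn⟩, hb, -⟩ := mem_idx.1 hi
  obtain ⟨⟨ha', -⟩, hb', -⟩ := mem_idx.1 hi'
  simp only at ha hb ha' hb'
  have ha0 : (0 : ℤ) < a := by exact_mod_cast Nat.pos_of_dvd_of_pos ha (Nat.pos_of_ne_zero hn)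
  have ha0' : (0 : ℤ) < a' := by exact_mod_cast Nat.pos_of_dvd_of_pos ha' (Nat.pos_of_ne_zero hn)
  have e00 := congrFun (congrFun h 0) 0
  have e01 := congrFun (congrFun h 0) 1
  have e10 := congrFun (congrFun h 1) 0
  have hdet := SL_det_eq γ
  simp only [upper, Matrix.mul_apply, Fin.sum_univ_two, Matrix.of_apply, Matrix.cons_val',
    Matrix.cons_val_zero, Matrix.cons_val_one, Matrix.cons_val_fin_one, mul_zero,
    add_zero] at e00 e01 e10
  have hc : γ 1 0 = 0 := by
    rcases mul_eq_zero.1 e10 with h | h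
    · exact h
    · exact absurd h ha0.ne'
  rw [hc, mul_zero, sub_zero] at hdet
  have h1 : γ 0 0 = 1 := by
    rcases Int.mul_eq_one_iff_eq_one_or_neg_one.1 hdet with h | h
    · exact h.1
    · rw [h.1] at e00; linarith
  rw [h1, one_mul] at e00 e01
  obtain rfl : a = a' := by exact_mod_cast e00
  have : b = b' := by
    have hd : ((n / a : ℕ) : ℤ) > 0 := by exact_mod_cast (Nat.zero_le b).trans_lt hb
    have hb2 : (b : ℤ) < (n / a : ℕ) := by exact_mod_cast hb
    have hb2' : (b' : ℤ) < (n / a : ℕ) := by exact_mod_cast hb'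
    have hk : γ 0 1 = 0 := by
      by_contra hk
      rcases lt_or_gt_of_ne hk with hk | hk
      · have : γ 0 1 * ((n / a : ℕ) : ℤ) ≤ -1 * ((n / a : ℕ) : ℤ) :=
          mul_le_mul_of_nonneg_right (by omega) hd.le
        omega
      · have : 1 * ((n / a : ℕ) : ℤ) ≤ γ 0 1 * ((n / a : ℕ) : ℤ) :=
          mul_le_mul_of_nonneg_right (by omega) hd.le
        omega
    rw [hk] at e01
    omega
  rw [this]

/-- A map preserving primitive matrices that is injective on cosets permutes the cosets. -/
theorem prod_idx_comp {n : ℕ} (hn : n.Coprime 10)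
    {T : Matrix (Fin 2) (Fin 2) ℤ → Matrix (Fin 2) (Fin 2) ℤ}
    (hT : ∀ M, IsPrim n M → IsPrim n (T M))
    (hinj : ∀ M M', IsPrim n M → IsPrim n M' → ∀ γ : SL(2, ℤ), (10 : ℤ) ∣ γ 1 0 →
      T M = γ * T M' → ∃ γ' : SL(2, ℤ), M = γ' * M')
    {R : Type*} [CommMonoid R] (φ : Matrix (Fin 2) (Fin 2) ℤ → R)
    (hφ : ∀ γ : SL(2, ℤ), (10 : ℤ) ∣ γ 1 0 → ∀ M, IsPrim n M → φ (γ * M) = φ M) :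
    ∏ i ∈ idx n, φ (T (upper n i)) = ∏ i ∈ idx n, φ (upper n i) := by
  choose! γ hγ ρ hρ hρ' using fun i (hi : i ∈ idx n) => exists_upper hn (hT _ (isPrim_upper hi))
  have hinj' : Set.InjOn ρ (idx n) := by
    intro i hi j hj hij
    have h : T (upper n i) = (γ i * (γ j)⁻¹ : SL(2, ℤ)) * T (upper n j) := by
      rw [Matrix.SpecialLinearGroup.coe_mul, Matrix.mul_assoc]
      conv_rhs => rw [hρ' j hj, coe_inv_mul_cancel]
      rw [hρ' i hi, hij]
    obtain ⟨γ', hγ'⟩ := hinj _ _ (isPrim_upper hi) (isPrim_upper hj) _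
      (ten_dvd_mul (hγ i hi) (ten_dvd_inv (hγ j hj))) h
    exact (upper_injective hj hi hγ'.symm).symm
  refine Finset.prod_nbij ρ hρ hinj' (Finset.surjOn_of_injOn_of_card_le ρ hρ hinj' le_rfl)
    fun i hi => ?_
  conv_lhs => rw [hρ' i hi]
  exact hφ _ (hγ i hi) _ (isPrim_upper (hρ i hi))

/-- Conjugation by the Atkin-Lehner matrix at `2`, on matrices of level `10`. -/
def conjTwo (M : Matrix (Fin 2) (Fin 2) ℤ) : Matrix (Fin 2) (Fin 2) ℤ :=
  !![6 * M 0 0 - M 1 0 + 30 * M 0 1 - 5 * M 1 1,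
      -- The integer division is exact at level 10, where `M 1 0` is even.
      3 * M 0 0 - M 1 0 / 2 + 18 * M 0 1 - 3 * M 1 1;
    -10 * M 0 0 + 2 * M 1 0 - 50 * M 0 1 + 10 * M 1 1,
      -5 * M 0 0 + M 1 0 - 30 * M 0 1 + 6 * M 1 1]

theorem atkinLehnerTwo_mul_conjTwo {M : Matrix (Fin 2) (Fin 2) ℤ} (h : (10 : ℤ) ∣ M 1 0) :
    atkinLehnerTwo * conjTwo M = M * atkinLehnerTwo := by
  obtain ⟨a, b, c', d, rfl⟩ : ∃ a b c d, M = !![a, b; c, d] := ⟨_, _, _, _, Matrix.eta_fin_two M⟩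
  obtain ⟨c, hc⟩ := h
  obtain rfl : c' = 10 * c := by simpa using hc
  have h2 : 10 * c / 2 = 5 * c := by omega
  ext i j
  fin_cases i <;> fin_cases j <;>
    simp [atkinLehnerTwo, conjTwo, Matrix.mul_apply, Fin.sum_univ_two, h2] <;> ring

theorem det_atkinLehnerTwo : atkinLehnerTwo.det = 2 := by
  simp [atkinLehnerTwo, Matrix.det_fin_two_of]

/-- The adjugate of the Atkin-Lehner matrix at `2`. -/
def atkinLehnerTwoAdj : Matrix (Fin 2) (Fin 2) ℤ := !![6, -1; -10, 2]

theorem mul_atkinLehnerTwo_mul_adj (M : Matrix (Fin 2) (Fin 2) ℤ) :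
    M * atkinLehnerTwo * atkinLehnerTwoAdj = (2 : ℤ) • M := by
  ext i j
  fin_cases j <;>
    simp [atkinLehnerTwo, atkinLehnerTwoAdj, Matrix.mul_apply, Fin.sum_univ_two] <;> ring

/-- A common divisor of the conjugate's entries divides n, so it is odd; it also divides 2M, hence
M. -/
theorem isPrim_conjTwo {n : ℕ} (hn : n.Coprime 10) {M : Matrix (Fin 2) (Fin 2) ℤ}
    (hM : IsPrim n M) : IsPrim n (conjTwo M) := by
  have hdet : (conjTwo M).det = n := by
    have := congrArg Matrix.det (atkinLehnerTwo_mul_conjTwo hM.ten_dvd)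
    rw [Matrix.det_mul, Matrix.det_mul, det_atkinLehnerTwo, hM.det_eq] at this
    linarith
  refine ⟨hdet, ?_, fun k hk => hM.isUnit_of_dvd k fun i j => ?_⟩
  · obtain ⟨c, hc⟩ := hM.ten_dvd
    refine ⟨-M 0 0 + 2 * c - 5 * M 0 1 + M 1 1, ?_⟩
    simp [conjTwo, hc]
    ring
  · have hkn : k ∣ n := by
      rw [← hdet, Matrix.det_fin_two]
      exact dvd_sub (dvd_mul_of_dvd_left (hk 0 0) _) (dvd_mul_of_dvd_left (hk 0 1) _)
    have hk2 : IsCoprime k 2 := by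
      have h : IsCoprime (n : ℤ) (2 * 5) := by exact_mod_cast Nat.isCoprime_iff_coprime.2 hn
      exact (h.of_mul_right_left).of_isCoprime_of_dvd_left hkn
    have h2 := dvd_mul_right_entries (dvd_mul_left_entries hk atkinLehnerTwo) atkinLehnerTwoAdj i j
    rw [atkinLehnerTwo_mul_conjTwo hM.ten_dvd, mul_atkinLehnerTwo_mul_adj, Matrix.smul_apply,
      smul_eq_mul] at h2
    exact hk2.dvd_of_dvd_mul_left h2

theorem exists_conj_atkinLehnerTwo {γ : SL(2, ℤ)} (hγ : (10 : ℤ) ∣ γ 1 0) :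
    ∃ γ' : SL(2, ℤ), (10 : ℤ) ∣ γ' 1 0 ∧
      (γ' : Matrix (Fin 2) (Fin 2) ℤ) * atkinLehnerTwo = atkinLehnerTwo * γ := by
  obtain ⟨c, hc⟩ := hγ
  have hdet := SL_det_eq γ
  rw [hc] at hdet
  refine ⟨⟨!![6 * γ 0 0 + 30 * c - 10 * γ 0 1 - 5 * γ 1 1,
      -γ 0 0 - 5 * c + 2 * γ 0 1 + γ 1 1;
      30 * γ 0 0 + 180 * c - 50 * γ 0 1 - 30 * γ 1 1,
      -5 * γ 0 0 - 30 * c + 10 * γ 0 1 + 6 * γ 1 1], ?_⟩, ?_, ?_⟩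
  · rw [Matrix.det_fin_two_of]; linear_combination hdet
  · exact ⟨3 * γ 0 0 + 18 * c - 5 * γ 0 1 - 3 * γ 1 1, by simp; ring⟩
  · ext i j
    fin_cases i <;> fin_cases j <;>
      simp [atkinLehnerTwo, Matrix.mul_apply, Fin.sum_univ_two, hc] <;> ring

theorem gTwo_moebius {γ : SL(2, ℤ)} (hγ : (10 : ℤ) ∣ γ 1 0) {z : ℂ} (hz : 0 < z.im) :
    gTwo (moebius γ z) = gTwo z := by
  have hW : 0 < atkinLehnerTwo.det := by rw [det_atkinLehnerTwo]; norm_num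
  obtain ⟨γ', hγ', h⟩ := exists_conj_atkinLehnerTwo hγ
  rw [← g_moebius_atkinLehnerTwo (moebius_im_pos (det_coe_pos γ) hz),
    ← moebius_mul hW (det_coe_pos γ) hz, ← h, moebius_mul (det_coe_pos γ') hW hz,
    g_moebius hγ' (moebius_im_pos hW hz), g_moebius_atkinLehnerTwo hz]

/-- The product `∏ (X - f(α τ))` over the upper triangular representatives `α`. -/
noncomputable def prodPoly (f : ℂ → ℂ) (n : ℕ) (z : ℂ) : ℂ[X] :=
  ∏ i ∈ idx n, (X - C (f (moebius (upper n i) z)))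

theorem pos_of_coprime_ten {n : ℕ} (hn : n.Coprime 10) : 0 < n :=
  Nat.pos_of_ne_zero fun h => by simp [h] at hn

theorem prodPoly_moebius {f : ℂ → ℂ} (hf : IsGammaZeroInvariant f) {n : ℕ} (hn : n.Coprime 10)
    {γ : SL(2, ℤ)} (hγ : (10 : ℤ) ∣ γ 1 0) {z : ℂ} (hz : 0 < z.im) :
    prodPoly f n (moebius γ z) = prodPoly f n z := by
  have hn0 := pos_of_coprime_ten hn
  refine Eq.trans (Finset.prod_congr rfl fun i hi => ?_) (prod_idx_comp hn (T := fun M => M * (γ : Matrix (Fin 2) (Fin 2) ℤ))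
    (fun M hM => hM.mul_right hγ) (fun M M' hM hM' γ' hγ' h => ⟨γ', ?_⟩)
    (fun M => X - C (f (moebius M z))) fun γ' hγ' M hM => ?_)
  · rw [moebius_mul ((isPrim_upper hi).det_pos hn0) (det_coe_pos γ) hz]
  · have : M * γ * ((γ⁻¹ : SL(2, ℤ)) : Matrix (Fin 2) (Fin 2) ℤ) =
        γ' * (M' * γ) * ((γ⁻¹ : SL(2, ℤ)) : Matrix (Fin 2) (Fin 2) ℤ) :=
      congrArg (· * ((γ⁻¹ : SL(2, ℤ)) : Matrix (Fin 2) (Fin 2) ℤ)) h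
    rwa [← Matrix.mul_assoc, coe_mul_inv_cancel_right, coe_mul_inv_cancel_right] at this
  · rw [moebius_mul (det_coe_pos γ') (hM.det_pos hn0) hz,
      hf γ' hγ' _ (moebius_im_pos (hM.det_pos hn0) hz)]

/-- With MW = WM' one gets g∘M∘W = gTwo∘M', and M ↦ M' permutes the cosets. -/
theorem prodPoly_g_atkinLehnerTwo {n : ℕ} (hn : n.Coprime 10) {z : ℂ} (hz : 0 < z.im) :
    prodPoly g n (moebius atkinLehnerTwo z) = prodPoly gTwo n z := by
  have hn0 := pos_of_coprime_ten hn
  have hW : 0 < atkinLehnerTwo.det := by rw [det_atkinLehnerTwo]; norm_num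
  refine Eq.trans (Finset.prod_congr rfl fun i hi => ?_) (prod_idx_comp hn (T := conjTwo)
    (fun M hM => isPrim_conjTwo hn hM) (fun M M' hM hM' γ hγ h => ?_)
    (fun M => X - C (gTwo (moebius M z))) fun γ' hγ' M hM => ?_)
  · have hp := (isPrim_upper hi).det_pos hn0
    have hp' := (isPrim_conjTwo hn (isPrim_upper hi)).det_pos hn0
    rw [← moebius_mul hp hW hz, ← atkinLehnerTwo_mul_conjTwo (isPrim_upper hi).ten_dvd,
      moebius_mul hW hp' hz, g_moebius_atkinLehnerTwo (moebius_im_pos hp' hz)]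
  · obtain ⟨γ', -, h'⟩ := exists_conj_atkinLehnerTwo hγ
    refine ⟨γ', ?_⟩
    have e : M * atkinLehnerTwo = γ' * M' * atkinLehnerTwo := by
      rw [← atkinLehnerTwo_mul_conjTwo hM.ten_dvd, h, ← Matrix.mul_assoc, ← h', Matrix.mul_assoc,
        atkinLehnerTwo_mul_conjTwo hM'.ten_dvd, Matrix.mul_assoc]
    have e2 := congrArg (· * atkinLehnerTwoAdj) e
    simp only [mul_atkinLehnerTwo_mul_adj] at e2
    exact smul_right_injective _ (two_ne_zero (α := ℤ)) e2
  · rw [moebius_mul (det_coe_pos γ') (hM.det_pos hn0) hz,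
      gTwo_moebius hγ' (moebius_im_pos (hM.det_pos hn0) hz)]

/-! ### Transitivity on the cosets -/

/-- Modulo d, the values am - b fill the class of -b modulo e = gcd(a, d). As b is prime to e, that
class lifts to a unit modulo d. -/
theorem exists_isCoprime_mul_sub {a b d : ℕ} (hd : 0 < d) (h : (a.gcd b).gcd d = 1) :
    ∃ m : ℤ, IsCoprime (d : ℤ) (a * m - b) := by
  obtain ⟨e, he⟩ : ∃ e, e = a.gcd d := ⟨_, rfl⟩
  have hed : e ∣ d := he ▸ Nat.gcd_dvd_right _ _
  have : NeZero d := ⟨hd.ne'⟩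
  have hbe : b.Coprime e := by
    rw [Nat.Coprime, he, ← Nat.gcd_assoc, Nat.gcd_comm b a, h]
  obtain ⟨u, hu⟩ := ZMod.unitsMap_surjective hed (-ZMod.unitOfCoprime b hbe)
  obtain ⟨x, hx⟩ : ∃ x, x = (u : ZMod d).val := ⟨_, rfl⟩
  have hcop : IsCoprime (d : ℤ) x := by
    rw [Nat.isCoprime_iff_coprime, hx]
    exact (ZMod.val_coe_unit_coprime u).symm
  have hxe : (x : ZMod e) = -b := by
    have := congrArg Units.val hu
    rw [ZMod.unitsMap_val, ← ZMod.natCast_zmod_val (u : ZMod d), ← hx,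
      ZMod.cast_natCast hed] at this
    simpa using this
  obtain ⟨k, hk⟩ : (e : ℤ) ∣ (x : ℤ) + b := by
    rw [← ZMod.intCast_zmod_eq_zero_iff_dvd]
    push_cast
    rw [hxe, neg_add_cancel]
  have hbez := Nat.gcd_eq_gcd_ab a d
  rw [← he] at hbez
  refine ⟨a.gcdA d * k, ?_⟩
  have : (a : ℤ) * (a.gcdA d * k) - b = x + d * (-(a.gcdB d) * k) := by
    linear_combination -hk - k * hbez
  rw [this]
  exact (IsCoprime.add_mul_left_right_iff).2 hcop

theorem first_mem_idx {n : ℕ} (hn : 0 < n) : ⟨n, 0⟩ ∈ idx n := by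
  rw [mem_idx]
  simp [hn.ne', Nat.div_self hn]

/-- `Γ₀(10)` acts transitively on the cosets of primitive matrices of determinant `n`. -/
theorem exists_upper_eq_mul {n : ℕ} (hn : n.Coprime 10) {i : Σ _ : ℕ, ℕ} (hi : i ∈ idx n) :
    ∃ γ γ' : SL(2, ℤ), (10 : ℤ) ∣ γ 1 0 ∧ (10 : ℤ) ∣ γ' 1 0 ∧
      upper n i = γ * (upper n ⟨n, 0⟩ * γ') := by
  have hn0 := pos_of_coprime_ten hn
  obtain ⟨a, b⟩ := i
  obtain ⟨⟨ha, -⟩, hb, hgcd⟩ := mem_idx.1 hi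
  simp only at ha hb hgcd
  obtain ⟨d, hd⟩ : ∃ d, d = n / a := ⟨_, rfl⟩
  have hup : upper n ⟨a, b⟩ = !![(a : ℤ), (b : ℤ); 0, (d : ℤ)] := by rw [upper, hd]
  have had : (a : ℤ) * d = n := by rw [hd]; exact_mod_cast Nat.mul_div_cancel' ha
  rw [← hd] at hb hgcd
  obtain ⟨m, hm⟩ := exists_isCoprime_mul_sub (Nat.zero_lt_of_lt hb) hgcd
  have hd10 : IsCoprime (d : ℤ) 10 := by
    have h : IsCoprime ((a : ℤ) * d) 10 := by
      rw [had]; exact_mod_cast Nat.isCoprime_iff_coprime.2 hn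
    exact h.of_mul_left_right
  obtain ⟨w, z, hwz⟩ := hd10.mul_right hm
  -- Arranged so that γ₁(a b; 0 d) = (n 0; 0 1)γ₂; the relation wd + 10z(am - b) = 1 makes both
  -- determinants 1.
  let γ₁ : SL(2, ℤ) := ⟨!![(d : ℤ), a * m - b; 10 * -z, w], by
    rw [Matrix.det_fin_two_of]; linear_combination hwz⟩
  let γ₂ : SL(2, ℤ) := ⟨!![1, m; 10 * (-z * a), -10 * z * b + w * d], by
    rw [Matrix.det_fin_two_of]; linear_combination hwz⟩
  refine ⟨γ₁⁻¹, γ₂, ten_dvd_inv (by simp [γ₁]), by simp [γ₂], ?_⟩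
  rw [← coe_inv_mul_cancel γ₁ (upper n ⟨a, b⟩)]
  congr 1
  rw [hup, upper]
  ext i j
  fin_cases i <;> fin_cases j <;>
    simp [γ₁, γ₂, Matrix.mul_apply, Fin.sum_univ_two, ← had, Nat.div_self hn0] <;> ring

/-! ### Power series expansions in `exp(2πiτ/w)` -/

theorem coeff_prod_X_sub_C_mem {A : Type*} [CommRing A] (S : Subring A) {ι : Type*}
    (s : Finset ι) (f : ι → A) (hf : ∀ i ∈ s, f i ∈ S) (k : ℕ) :
    (∏ i ∈ s, (X - C (f i))).coeff k ∈ S := by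
  have h : ∏ i ∈ s, (X - C (f i)) ∈ Polynomial.lifts S.subtype := by
    refine prod_mem fun i hi => ?_
    rw [sub_eq_add_neg, ← C_neg]
    exact add_mem (X_mem_lifts _) (C'_mem_lifts ⟨⟨-f i, neg_mem (hf i hi)⟩, rfl⟩)
  obtain ⟨x, hx⟩ := (lifts_iff_coeff_lifts _).1 h k
  rw [← hx]
  exact x.2

/-- `F(exp(2πiτ/w))` converges to `f τ` on the upper half-plane. -/
def HasExp (w : ℝ) (F : PowerSeries ℂ) (f : ℂ → ℂ) : Prop :=
  ∀ τ : ℍ, HasSum (fun m => F.coeff m * Function.Periodic.qParam w τ ^ m) (f τ)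

theorem hasSum_of_eq {f f' : ℕ → ℂ} {c : ℂ} (h : HasSum f c) (e : ∀ m, f' m = f m) :
    HasSum f' c := (funext e : f' = f) ▸ h

theorem hasSum_mul_coeff {F G : PowerSeries ℂ} {q x y : ℂ}
    (hF : HasSum (fun m => F.coeff m * q ^ m) x) (hG : HasSum (fun m => G.coeff m * q ^ m) y) :
    HasSum (fun m => (F * G).coeff m * q ^ m) (x * y) := by
  have hF' := hF.summable.norm
  have hG' := hG.summable.norm
  have h1 := (summable_norm_sum_mul_antidiagonal_of_summable_norm hF' hG').of_norm.hasSum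
  rw [← tsum_mul_tsum_eq_tsum_sum_antidiagonal_of_summable_norm hF' hG', hF.tsum_eq,
    hG.tsum_eq] at h1
  refine hasSum_of_eq h1 fun m => ?_
  rw [PowerSeries.coeff_mul, Finset.sum_mul]
  refine Finset.sum_congr rfl fun p hp => ?_
  rw [← Finset.HasAntidiagonal.mem_antidiagonal.1 hp, pow_add]
  ring

theorem hasSum_C_coeff (c q : ℂ) :
    HasSum (fun m => (PowerSeries.C c).coeff m * q ^ m) c := by
  convert hasSum_single (f := fun m => (PowerSeries.C c).coeff m * q ^ m) 0 fun m hm => ?_ using 1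
  · simp
  · simp [PowerSeries.coeff_C, hm]

/-- Pairs of a power series and the function to which it converges. -/
def expSubring (w : ℝ) : Subring (PowerSeries ℂ × (ℂ → ℂ)) where
  carrier := {p | HasExp w p.1 p.2}
  mul_mem' hF hG τ := hasSum_mul_coeff (hF τ) (hG τ)
  add_mem' hF hG τ := by simpa [add_mul] using (hF τ).add (hG τ)
  one_mem' τ := by simpa using hasSum_C_coeff 1 (Function.Periodic.qParam w τ)
  zero_mem' τ := by simp
  neg_mem' hF τ := by simpa using (hF τ).neg

theorem HasExp.mul {w : ℝ} {F G : PowerSeries ℂ} {f f' : ℂ → ℂ} (hF : HasExp w F f)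
    (hG : HasExp w G f') : HasExp w (F * G) (f * f') := fun τ => hasSum_mul_coeff (hF τ) (hG τ)

theorem HasExp.pow {w : ℝ} {F : PowerSeries ℂ} {f : ℂ → ℂ} (hF : HasExp w F f) (k : ℕ) :
    HasExp w (F ^ k) (f ^ k) :=
  (expSubring w).pow_mem (x := (F, f)) hF k

theorem HasExp.sub {w : ℝ} {F G : PowerSeries ℂ} {f f' : ℂ → ℂ} (hF : HasExp w F f)
    (hG : HasExp w G f') : HasExp w (F - G) (f - f') :=
  (expSubring w).sub_mem (x := (F, f)) (y := (G, f')) hF hG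

theorem HasExp.add {w : ℝ} {F G : PowerSeries ℂ} {f f' : ℂ → ℂ} (hF : HasExp w F f)
    (hG : HasExp w G f') : HasExp w (F + G) (f + f') :=
  (expSubring w).add_mem (x := (F, f)) (y := (G, f')) hF hG

theorem hasExp_C (w : ℝ) (c : ℂ) : HasExp w (PowerSeries.C c) fun _ => c := fun _ =>
  hasSum_C_coeff c _

theorem HasExp.congr {w : ℝ} {F : PowerSeries ℂ} {f f' : ℂ → ℂ} (hF : HasExp w F f)
    (h : ∀ z : ℂ, 0 < z.im → f z = f' z) : HasExp w F f' := fun τ => h τ τ.im_pos ▸ hF τ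

theorem HasExp.eval {w : ℝ} {F : PowerSeries ℂ} {f : ℂ → ℂ} (hF : HasExp w F f) (P : ℂ[X]) :
    HasExp w (P.eval₂ PowerSeries.C F) fun z => P.eval (f z) := by
  induction P using Polynomial.induction_on' with
  | add p q hp hq =>
    simp only [eval₂_add, eval_add]
    exact hp.add hq
  | monomial k c =>
    simp only [eval₂_monomial, eval_monomial]
    exact (hasExp_C w c).mul (hF.pow k)

theorem HasExp.eq_zero {w : ℝ} (hw : 0 < w) {F : PowerSeries ℂ} {f : ℂ → ℂ} (hF : HasExp w F f)
    (h : ∀ z : ℂ, 0 < z.im → f z = 0) : F = 0 := by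
  have h0 : cuspFunction w (0 : ModularForm (CongruenceSubgroup.Gamma0 10) 0) = fun _ => 0 := by
    funext q
    by_cases hq : q = 0
    · subst hq
      rw [cuspFunction, Function.Periodic.cuspFunction_zero_eq_limUnder_nhds_ne]
      refine Tendsto.limUnder_eq (tendsto_const_nhds.congr' ?_)
      filter_upwards [self_mem_nhdsWithin] with q hq
      rw [Function.Periodic.cuspFunction_eq_of_nonzero _ _ hq]
      rfl
    · rw [cuspFunction, Function.Periodic.cuspFunction_eq_of_nonzero _ _ hq]
      rfl
  -- F and the zero series both expand the zero modular form, whose weight and level play no role.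
  have key := fun c : ℕ → ℂ => UpperHalfPlane.qExpansion_coeff_unique (c := c)
    (0 : ModularForm (CongruenceSubgroup.Gamma0 10) 0) hw (h0 ▸ analyticAt_const)
  ext m
  rw [key (fun m => F.coeff m) (fun τ => by
      have := hF τ
      rw [h τ τ.im_pos] at this
      simpa using this) m,
    key (fun _ => 0) (fun τ => by simp) m |>.symm]
  simp

theorem HasExp.unique {w : ℝ} (hw : 0 < w) {F G : PowerSeries ℂ} {f f' : ℂ → ℂ}
    (hF : HasExp w F f) (hG : HasExp w G f') (h : ∀ z : ℂ, 0 < z.im → f z = f' z) : F = G :=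
  sub_eq_zero.1 ((hF.sub hG).eq_zero hw fun z hz => by simp [h z hz])

theorem hasSum_expand {F : PowerSeries ℂ} {N : ℕ} (hN : N ≠ 0) {t y : ℂ}
    (h : HasSum (fun m => F.coeff m * (t ^ N) ^ m) y) :
    HasSum (fun m => (F.expand N hN).coeff m * t ^ m) y := by
  have hinj : Function.Injective fun m : ℕ => N * m := fun a b hab =>
    Nat.eq_of_mul_eq_mul_left (Nat.pos_of_ne_zero hN) hab
  rw [← hinj.hasSum_iff]
  · convert h using 2 with m
    simp only [Function.comp, PowerSeries.coeff_expand_mul, pow_mul]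
  · intro m hm
    rw [PowerSeries.coeff_expand_of_not_dvd, zero_mul]
    rintro ⟨k, rfl⟩
    exact hm ⟨k, rfl⟩

/-! ### Integrality of the `q`-expansion of the Euler product -/

theorem tendstoLocallyUniformlyOn_iteratedDeriv {ι : Type*} {p : Filter ι} {F : ι → ℂ → ℂ}
    {f : ℂ → ℂ} {U : Set ℂ} (hU : IsOpen U) (hF : ∀ i, DifferentiableOn ℂ (F i) U)
    (h : TendstoLocallyUniformlyOn F f p U) (k : ℕ) :
    (∀ i, DifferentiableOn ℂ (iteratedDeriv k (F i)) U) ∧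
      TendstoLocallyUniformlyOn (fun i => iteratedDeriv k (F i)) (iteratedDeriv k f) p U := by
  induction k with
  | zero => simpa using ⟨hF, h⟩
  | succ k ih =>
    simp only [iteratedDeriv_succ]
    exact ⟨fun i => (ih.1 i).deriv hU, ih.2.deriv (Eventually.of_forall ih.1) hU⟩

theorem iteratedDeriv_eval_zero (P : ℂ[X]) (k : ℕ) :
    iteratedDeriv k (fun q => P.eval q) 0 = k.factorial * P.coeff k := by
  have h : ∀ (k : ℕ) (P : ℂ[X]), iteratedDeriv k (fun q => P.eval q) =
      fun q => (derivative^[k] P).eval q := by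
    intro k
    induction k with
    | zero => simp
    | succ k ih =>
      intro P
      rw [iteratedDeriv_succ', Function.iterate_succ_apply, ← ih]
      congr 1
      funext q
      exact P.deriv
  rw [h]
  change eval 0 _ = _
  rw [← coeff_zero_eq_eval_zero, coeff_iterate_derivative, zero_add, Nat.descFactorial_self]
  simp

/-- The Taylor coefficients are limits of those of the partial products, which are integers, and ℤ
is closed in ℂ. -/
theorem exists_eulerSeries : ∃ F : PowerSeries ℤ, PowerSeries.constantCoeff F = 1 ∧
    ∀ q : ℂ, ‖q‖ < 1 → HasSum (fun m => (F.map (Int.castRingHom ℂ)).coeff m * q ^ m)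
      (∏' n : ℕ, (1 - q ^ (n + 1))) := by
  have hprod := ModularForm.multipliableLocallyUniformlyOn_one_sub_pow.hasProdLocallyUniformlyOn
  have hball : (0 : ℂ) ∈ Metric.ball (0 : ℂ) 1 := by simp
  have hfin : ∀ s : Finset ℕ, (fun q : ℂ => ∏ i ∈ s, (1 - q ^ (i + 1))) = fun q : ℂ =>
      ((∏ i ∈ s, (1 - X ^ (i + 1)) : ℤ[X]).map (Int.castRingHom ℂ)).eval q := by
    intro s
    funext q
    simp [Polynomial.map_prod, eval_prod]
  have hint : ∀ k : ℕ, ∃ c : ℤ, ((k.factorial : ℂ))⁻¹ *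
      iteratedDeriv k (fun q : ℂ => ∏' n : ℕ, (1 - q ^ (n + 1))) 0 = c := by
    intro k
    have ht := (tendstoLocallyUniformlyOn_iteratedDeriv Metric.isOpen_ball (fun s => by
      rw [hfin]; exact Polynomial.differentiableOn _) hprod k).2.tendsto_at hball
    have hcl : IsClosed (Set.range ((↑) : ℤ → ℂ)) :=
      isOpen_compl_iff.1 Complex.isOpen_compl_range_intCast
    obtain ⟨c, hc⟩ := hcl.mem_of_tendsto (ht.const_mul ((k.factorial : ℂ))⁻¹)
      (Eventually.of_forall fun s => by
        rw [hfin, iteratedDeriv_eval_zero, inv_mul_cancel_left₀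
          (by exact_mod_cast k.factorial_ne_zero), coeff_map]
        exact ⟨_, rfl⟩)
    exact ⟨c, hc.symm⟩
  choose c hc using hint
  refine ⟨PowerSeries.mk c, ?_, fun q hq => ?_⟩
  · have := hc 0
    simp at this
    rw [← PowerSeries.coeff_zero_eq_constantCoeff_apply, PowerSeries.coeff_mk]
    exact_mod_cast this.symm
  · have := Complex.hasSum_taylorSeries_on_ball ModularForm.differentiableOn_tprod_one_sub_pow
      (z := q) (by simpa using hq)
    refine hasSum_of_eq this fun m => ?_
    rw [PowerSeries.coeff_map, PowerSeries.coeff_mk, Int.coe_castRingHom]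
    beta_reduce
    rw [← hc m, sub_zero,
      smul_eq_mul, smul_eq_mul]
    ring

theorem etaSq_eq (z : ℂ) : etaSq z = Complex.exp (Real.pi * Complex.I * z / 6) *
    (∏' n : ℕ, (1 - Function.Periodic.qParam 1 z ^ (n + 1))) ^ 2 := by
  rw [etaSq, ModularForm.eta, mul_pow]
  congr 1
  rw [Function.Periodic.qParam, ← Complex.exp_nat_mul]
  congr 1
  push_cast
  ring

theorem gTwo_add_one {z : ℂ} (hz : 0 < z.im) : gTwo (z + 1) = gTwo z := by
  have := gTwo_moebius (γ := ModularGroup.T) (by simp [ModularGroup.T]) hz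
  rwa [moebius_T] at this

/-- The `q`-expansion of `gTwo` has integral coefficients and starts with `q`. -/
theorem exists_gTwo_expansion : ∃ V : PowerSeries ℤ, PowerSeries.coeff 0 V = 0 ∧
    PowerSeries.coeff 1 V = 1 ∧ HasExp 1 (V.map (Int.castRingHom ℂ)) gTwo := by
  obtain ⟨F, hF0, hF⟩ := exists_eulerSeries
  have hV : HasExp 1 (qExpansion 1 fun τ : ℍ => gTwo τ) gTwo := fun τ =>
    hasSum_qExpansion one_pos (periodic_comp_ofComplex_of fun z hz => gTwo_add_one hz)
      (mdifferentiable_of_differentiableOn differentiableOn_gTwo) gTwo_isBoundedAtImInfty τ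
  set W := qExpansion 1 fun τ : ℍ => gTwo τ with hW
  let φ : ℂ → ℂ := fun z => ∏' n : ℕ, (1 - Function.Periodic.qParam 1 z ^ (n + 1))
  have hexp : ∀ (δ : ℕ) (hδ : δ ≠ 0), HasExp 1
      ((F.expand δ hδ).map (Int.castRingHom ℂ)) fun z => φ (δ * z) := by
    intro δ hδ τ
    rw [PowerSeries.map_expand]
    refine hasSum_expand hδ ?_
    have hq : Function.Periodic.qParam 1 τ ^ δ = Function.Periodic.qParam 1 (δ * τ) := by
      rw [Function.Periodic.qParam, Function.Periodic.qParam, ← Complex.exp_nat_mul]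
      congr 1
      ring
    rw [hq]
    refine hF _ (Function.Periodic.norm_qParam_lt_one one_pos ?_)
    exact im_natCast_mul_pos τ.im_pos (Nat.pos_of_ne_zero hδ)
  have hX : HasExp 1 PowerSeries.X (Function.Periodic.qParam 1) := by
    intro τ
    convert hasSum_single (f := fun m => (PowerSeries.X : PowerSeries ℂ).coeff m *
      Function.Periodic.qParam 1 τ ^ m) 1 fun m hm => ?_ using 1
    · simp
    · simp [PowerSeries.coeff_X, hm]
  -- The eta quotient reads gTwo · D = q · N, the exponent of q being (2 + 40 - 8 - 10)/24 = 1. D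
  -- has constant term 1, so it is invertible over ℤ.
  let D : PowerSeries ℤ := F.expand 2 (by norm_num) ^ 4 * F.expand 5 (by norm_num) ^ 2
  let N : PowerSeries ℤ := F.expand 1 one_ne_zero ^ 2 * F.expand 10 (by norm_num) ^ 4
  have hD : HasExp 1 (D.map (Int.castRingHom ℂ))
      ((fun z => φ ((2 : ℕ) * z)) ^ 4 * (fun z => φ ((5 : ℕ) * z)) ^ 2) := by
    simp only [D, map_mul, map_pow]
    exact ((hexp 2 _).pow 4).mul ((hexp 5 _).pow 2)
  have hN : HasExp 1 (N.map (Int.castRingHom ℂ))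
      ((fun z => φ ((1 : ℕ) * z)) ^ 2 * (fun z => φ ((10 : ℕ) * z)) ^ 4) := by
    simp only [N, map_mul, map_pow]
    exact ((hexp 1 _).pow 2).mul ((hexp 10 _).pow 4)
  have hφ : ∀ z : ℂ, 0 < z.im → φ z ≠ 0 := fun z hz => ModularForm.eta_tprod_ne_zero hz
  have hWD : W * D.map (Int.castRingHom ℂ) = PowerSeries.X * N.map (Int.castRingHom ℂ) := by
    refine (hV.mul hD).unique one_pos (hX.mul hN) fun z hz => ?_
    simp only [Pi.mul_apply, Pi.pow_apply, gTwo, etaSq_eq]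
    have n2 := hφ _ (im_two_mul_pos hz)
    have n5 := hφ _ (im_five_mul_pos hz)
    simp only [φ] at n2 n5 ⊢
    have hexp : Complex.exp (Real.pi * Complex.I * z / 6) *
        Complex.exp (Real.pi * Complex.I * (10 * z) / 6) ^ 2 = Function.Periodic.qParam 1 z *
        (Complex.exp (Real.pi * Complex.I * (2 * z) / 6) ^ 2 *
        Complex.exp (Real.pi * Complex.I * (5 * z) / 6)) := by
      rw [Function.Periodic.qParam]
      simp only [← Complex.exp_nat_mul, ← Complex.exp_add]
      congr 1
      push_cast
      ring
    have k2 := Complex.exp_ne_zero (Real.pi * Complex.I * (2 * z) / 6)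
    have k5 := Complex.exp_ne_zero (Real.pi * Complex.I * (5 * z) / 6)
    push_cast
    rw [one_mul, div_mul_eq_mul_div, div_eq_iff (by positivity)]
    generalize (∏' n : ℕ, (1 - Function.Periodic.qParam 1 z ^ (n + 1))) = A at *
    generalize (∏' n : ℕ, (1 - Function.Periodic.qParam 1 (2 * z) ^ (n + 1))) = B at *
    generalize (∏' n : ℕ, (1 - Function.Periodic.qParam 1 (5 * z) ^ (n + 1))) = B' at *
    generalize (∏' n : ℕ, (1 - Function.Periodic.qParam 1 (10 * z) ^ (n + 1))) = B'' at *
    linear_combination (A ^ 2 * B'' ^ 4 * B ^ 4 * B' ^ 2) * hexp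
  have hD1 : PowerSeries.constantCoeff D = 1 := by simp [D, hF0]
  have hN1 : PowerSeries.constantCoeff N = 1 := by simp [N, hF0]
  obtain ⟨D', hD'⟩ : ∃ D', D * D' = 1 :=
    (PowerSeries.isUnit_iff_constantCoeff.2 (hD1 ▸ isUnit_one)).exists_right_inv
  have hD'1 : PowerSeries.constantCoeff D' = 1 := by
    have := congrArg PowerSeries.constantCoeff hD'
    simpa [hD1] using this
  have hWV : W = (PowerSeries.X * (N * D')).map (Int.castRingHom ℂ) := by
    have h1 : D.map (Int.castRingHom ℂ) * D'.map (Int.castRingHom ℂ) = 1 := by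
      rw [← map_mul, hD', map_one]
    calc W = W * D.map (Int.castRingHom ℂ) * D'.map (Int.castRingHom ℂ) := by
          rw [mul_assoc, h1, mul_one]
      _ = _ := by rw [hWD]; simp [mul_assoc]
  refine ⟨PowerSeries.X * (N * D'), by simp, ?_, hWV ▸ hV⟩
  rw [PowerSeries.coeff_succ_X_mul, PowerSeries.coeff_zero_eq_constantCoeff_apply, map_mul, hN1,
    hD'1, one_mul]

/-! ### The coefficients of the modular polynomial -/

theorem map_prodPoly {A B : Type*} [CommRing A] [CommRing B] (φ : A →+* B) {ι : Type*}
    (s : Finset ι) (f : ι → A) :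
    (∏ i ∈ s, (X - C (f i))).map φ = ∏ i ∈ s, (X - C (φ (f i))) := by
  simp [Polynomial.map_prod]

theorem exists_prodPoly_coeff_eq {n : ℕ} (hn : n.Coprime 10) :
    ∃ P : ℕ → ℂ[X], ∀ k : ℕ, ∀ z : ℂ, 0 < z.im →
      (prodPoly g n z).coeff k = (P k).eval (g z) ∧
      (prodPoly gTwo n z).coeff k = (P k).eval (gTwo z) := by
  have hn0 := pos_of_coprime_ten hn
  have hW : 0 < atkinLehnerTwo.det := by rw [det_atkinLehnerTwo]; norm_num
  have h : ∀ k : ℕ, ∃ P : ℂ[X], ∀ z : ℂ, 0 < z.im → (prodPoly g n z).coeff k = P.eval (g z) := by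
    intro k
    refine exists_eq_eval_g (F := fun z => (prodPoly g n z).coeff k) ?_ fun γ hγ z hz => by
      simp only [prodPoly_moebius g_isGammaZeroInvariant hn hγ hz]
    have := coeff_prod_X_sub_C_mem holoAlg.toSubring (idx n)
      (fun i z => g (moebius (upper n i) z)) (fun i hi => by
        have hdet := det_upper hi
        exact g_mem_holoAlg_of (hdet ▸ by exact_mod_cast hn0)
          (hdet ▸ by exact_mod_cast Nat.isCoprime_iff_coprime.2 hn) (by simp [upper])) k
    have e : (fun z => (prodPoly g n z).coeff k) =
        (∏ i ∈ idx n, (X - C fun z => g (moebius (upper n i) z))).coeff k := ?_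
    · exact e ▸ this
    funext z
    have e2 : ((∏ i ∈ idx n, (X - C fun z => g (moebius (upper n i) z))).map
        (Pi.evalRingHom (fun _ : ℂ => ℂ) z)).coeff k = (prodPoly g n z).coeff k := by
      rw [map_prodPoly]
      rfl
    rw [coeff_map] at e2
    exact e2.symm
  choose P hP using h
  refine ⟨P, fun k z hz => ⟨hP k z hz, ?_⟩⟩
  rw [← prodPoly_g_atkinLehnerTwo hn hz, hP k _ (moebius_im_pos hW hz),
    g_moebius_atkinLehnerTwo hz]

/-! ### Formal twists -/

/-- The series `V(ζ^{ab} t^{a²})`. -/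
noncomputable def twist {R : Type*} [CommRing R] (V : PowerSeries ℤ) (ζ : R) (i : Σ _ : ℕ, ℕ) :
    PowerSeries R :=
  PowerSeries.mk fun m => if i.1 ^ 2 ∣ m then
    ((V.coeff (m / i.1 ^ 2) : ℤ) : R) * (ζ ^ (i.1 * i.2)) ^ (m / i.1 ^ 2) else 0

theorem map_twist {R S : Type*} [CommRing R] [CommRing S] (φ : R →+* S) (V : PowerSeries ℤ) (ζ : R)
    (i : Σ _ : ℕ, ℕ) : PowerSeries.map φ (twist V ζ i) = twist V (φ ζ) i := by
  ext m
  simp only [twist, PowerSeries.coeff_map, PowerSeries.coeff_mk]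
  split_ifs <;> simp

theorem twist_eq_expand {R : Type*} [CommRing R] (V : PowerSeries ℤ) (ζ : R) {i : Σ _ : ℕ, ℕ}
    (hi : i.1 ^ 2 ≠ 0) : twist V ζ i =
      (PowerSeries.rescale (ζ ^ (i.1 * i.2)) (V.map (Int.castRingHom R))).expand (i.1 ^ 2) hi := by
  ext m
  rw [twist, PowerSeries.coeff_mk]
  split_ifs with h
  · obtain ⟨k, rfl⟩ := h
    rw [PowerSeries.coeff_expand_mul, Nat.mul_div_cancel_left _ (Nat.pos_of_ne_zero hi),
      PowerSeries.coeff_rescale, PowerSeries.coeff_map, mul_comm]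
    rfl
  · rw [PowerSeries.coeff_expand_of_not_dvd _ _ _ h]

/-- The formal analogue of `prodPoly`. -/
noncomputable def prodSeries {R : Type*} [CommRing R] (V : PowerSeries ℤ) (ζ : R) (n : ℕ) :
    (PowerSeries R)[X] :=
  ∏ i ∈ idx n, (X - C (twist V ζ i))

/-- Naturality allows one product with an indeterminate ζ to be specialised both to a root of unity
and to 1. -/
theorem map_prodSeries {R S : Type*} [CommRing R] [CommRing S] (φ : R →+* S) (V : PowerSeries ℤ)
    (ζ : R) (n : ℕ) : (prodSeries V ζ n).map (PowerSeries.map φ) = prodSeries V (φ ζ) n := by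
  simp only [prodSeries, map_prodPoly, map_twist]

theorem fst_ne_zero_of_mem_idx {n : ℕ} {i : Σ _ : ℕ, ℕ} (hi : i ∈ idx n) : i.1 ≠ 0 := fun h => by
  obtain ⟨h1, h2⟩ := (mem_idx.1 hi).1
  rw [h, zero_dvd_iff] at h1
  exact h2 h1

/-- With d = n/a, (aτ + b)/d = (a²τ + ab)/n, so q becomes ζ^{ab} t^{a²} with t = exp(2πiτ/n). -/
theorem hasExp_twist {V : PowerSeries ℤ} (hV : HasExp 1 (V.map (Int.castRingHom ℂ)) gTwo) {n : ℕ}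
    {i : Σ _ : ℕ, ℕ} (hi : i ∈ idx n) :
    HasExp n (twist V (Complex.exp (2 * Real.pi * Complex.I / n)) i)
      fun z => gTwo (moebius (upper n i) z) := by
  intro τ
  have ha := fst_ne_zero_of_mem_idx hi
  obtain ⟨⟨⟨d, hd⟩, hn⟩, -⟩ := mem_idx.1 hi
  have hd0 : d ≠ 0 := fun h => hn (by rw [hd, h, mul_zero])
  have hnd : n / i.1 = d := by rw [hd, Nat.mul_div_cancel_left _ (Nat.pos_of_ne_zero ha)]
  rw [twist_eq_expand _ _ (pow_ne_zero 2 ha)]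
  refine hasSum_expand (pow_ne_zero 2 ha) ?_
  have hpos : 0 < (upper n i).det := by
    rw [det_upper hi]; exact_mod_cast Nat.pos_of_ne_zero hn
  have h := hV ⟨moebius (upper n i) τ, moebius_im_pos hpos τ.im_pos⟩
  refine hasSum_of_eq h fun m => ?_
  rw [PowerSeries.coeff_rescale, mul_comm _ (PowerSeries.coeff m _), mul_assoc, ← mul_pow]
  congr 2
  rw [Function.Periodic.qParam, Function.Periodic.qParam, ← Complex.exp_nat_mul,
    ← Complex.exp_nat_mul, ← Complex.exp_add]
  congr 1
  have ha' : (i.1 : ℂ) ≠ 0 := by exact_mod_cast ha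
  have hd' : (d : ℂ) ≠ 0 := by exact_mod_cast hd0
  have hn' : (n : ℂ) = i.1 * d := by exact_mod_cast hd
  simp only [moebius, upper, hnd, Matrix.of_apply, Matrix.cons_val', Matrix.cons_val_zero,
    Matrix.cons_val_one, Matrix.cons_val_fin_one, hn']
  push_cast
  rw [hn']
  field_simp
  simp
  field_simp
  ring

theorem hasExp_expand {V : PowerSeries ℂ} {f : ℂ → ℂ} (hV : HasExp 1 V f) {n : ℕ} (hn : n ≠ 0) :
    HasExp n (V.expand n hn) f := by
  intro τ
  refine hasSum_expand hn ?_
  refine hasSum_of_eq (hV τ) fun m => ?_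
  congr 2
  rw [Function.Periodic.qParam, Function.Periodic.qParam, ← Complex.exp_nat_mul]
  congr 1
  have hn' : (n : ℂ) ≠ 0 := by exact_mod_cast hn
  push_cast
  field_simp

theorem hasExp_prodSeries {V : PowerSeries ℤ} (hV : HasExp 1 (V.map (Int.castRingHom ℂ)) gTwo)
    (n k : ℕ) :
    HasExp n ((prodSeries V (Complex.exp (2 * Real.pi * Complex.I / n)) n).coeff k)
      fun z => (prodPoly gTwo n z).coeff k := by
  have := coeff_prod_X_sub_C_mem (expSubring n) (idx n) (fun i =>
    (twist V (Complex.exp (2 * Real.pi * Complex.I / n)) i, fun z => gTwo (moebius (upper n i) z)))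
    (fun i hi => hasExp_twist hV hi) k
  set p := ∏ i ∈ idx n, (X - C (twist V (Complex.exp (2 * Real.pi * Complex.I / n)) i,
    fun z => gTwo (moebius (upper n i) z))) with hp
  have h1 : (p.coeff k).1 =
      (prodSeries V (Complex.exp (2 * Real.pi * Complex.I / n)) n).coeff k := by
    rw [← RingHom.coe_fst, ← coeff_map, hp, map_prodPoly]
    rfl
  have h2 : (p.coeff k).2 = fun z => (prodPoly gTwo n z).coeff k := by
    funext z
    have : (p.coeff k).2 z = ((Pi.evalRingHom (fun _ : ℂ => ℂ) z).comp (RingHom.snd _ _))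
      (p.coeff k) := rfl
    rw [this, ← coeff_map, hp, map_prodPoly]
    rfl
  rw [← h1, ← h2]
  exact this

theorem prodSeries_coeff_eq {V : PowerSeries ℤ}
    (hV : HasExp 1 (V.map (Int.castRingHom ℂ)) gTwo) {n : ℕ} (hn : n ≠ 0) {k : ℕ} {P : ℂ[X]}
    (hP : ∀ z : ℂ, 0 < z.im → (prodPoly gTwo n z).coeff k = P.eval (gTwo z)) :
    (prodSeries V (Complex.exp (2 * Real.pi * Complex.I / n)) n).coeff k =
      (P.eval₂ PowerSeries.C (V.map (Int.castRingHom ℂ))).expand n hn := by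
  refine (hasExp_prodSeries hV n k).unique (by exact_mod_cast Nat.pos_of_ne_zero hn)
    (hasExp_expand (hV.eval P) hn) hP

/-! ### Substitution of a series with leading term `q` into polynomials -/

theorem coeff_pow_eq_ite {R : Type*} [CommRing R] {V : PowerSeries R} (h0 : V.coeff 0 = 0)
    (h1 : V.coeff 1 = 1) {i j : ℕ} (hij : j ≤ i) : (V ^ i).coeff j = if i = j then 1 else 0 := by
  obtain ⟨U, rfl⟩ := PowerSeries.X_dvd_iff.2 (by simpa using h0 : PowerSeries.constantCoeff V = 0)
  rw [mul_pow, PowerSeries.coeff_X_pow_mul']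
  rcases hij.lt_or_eq with h | rfl
  · rw [if_neg (by omega), if_neg (by omega)]
  · rw [PowerSeries.coeff_succ_X_mul] at h1
    simp at h1
    simp [h1]

/-- As Vⁱ = qⁱ + ⋯, substituting V is unitriangular on coefficients. Integrality and vanishing of
P(V) therefore descend to P. -/
theorem coeff_eval₂_C {R : Type*} [CommRing R] {V : PowerSeries R} (h0 : V.coeff 0 = 0)
    (h1 : V.coeff 1 = 1) (P : R[X]) (j : ℕ) : (P.eval₂ PowerSeries.C V).coeff j =
      P.coeff j + ∑ i ∈ Finset.range j, P.coeff i * (V ^ i).coeff j := by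
  have hN : P.natDegree < j + 1 + P.natDegree := by omega
  rw [eval₂_eq_sum_range' _ hN, map_sum, Finset.sum_range_add, Finset.sum_range_succ, add_comm]
  have h2 : ∑ x ∈ Finset.range P.natDegree, (PowerSeries.coeff j)
      (PowerSeries.C (P.coeff (j + 1 + x)) * V ^ (j + 1 + x)) = 0 := by
    refine Finset.sum_eq_zero fun x _ => ?_
    rw [PowerSeries.coeff_C_mul, coeff_pow_eq_ite h0 h1 (by omega), if_neg (by omega), mul_zero]
  rw [h2, zero_add, add_comm]
  simp only [PowerSeries.coeff_C_mul]
  rw [coeff_pow_eq_ite h0 h1 le_rfl, if_pos rfl, mul_one]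

theorem coeff_mem_of_eval₂_C {R : Type*} [CommRing R] (S : Subring R) {V : PowerSeries R}
    (h0 : V.coeff 0 = 0) (h1 : V.coeff 1 = 1) (hV : ∀ j, V.coeff j ∈ S) {P : R[X]}
    (hP : ∀ j, (P.eval₂ PowerSeries.C V).coeff j ∈ S) (j : ℕ) : P.coeff j ∈ S := by
  have hpow : ∀ i j, (V ^ i).coeff j ∈ S := by
    have : V ∈ (PowerSeries.map S.subtype).range :=
      ⟨PowerSeries.mk fun j => ⟨V.coeff j, hV j⟩, by ext; simp⟩
    intro i j
    obtain ⟨U, hU⟩ := pow_mem this i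
    rw [← hU, PowerSeries.coeff_map]
    exact (U.coeff j).2
  induction j using Nat.strong_induction_on with
  | _ j ih =>
    have := hP j
    rw [coeff_eval₂_C h0 h1] at this
    exact (S.toAddSubgroup.add_mem_cancel_right (S.sum_mem fun i hi =>
      S.mul_mem (ih i (Finset.mem_range.1 hi)) (hpow i j))).1 this

theorem eq_zero_of_eval₂_C {R : Type*} [CommRing R] {V : PowerSeries R}
    (h0 : V.coeff 0 = 0) (h1 : V.coeff 1 = 1) {P : R[X]}
    (hP : P.eval₂ PowerSeries.C V = 0) : P = 0 := by
  ext j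
  induction j using Nat.strong_induction_on with
  | _ j ih =>
    have := coeff_eval₂_C h0 h1 P j
    rw [hP, Finset.sum_eq_zero fun i hi => by rw [ih i (Finset.mem_range.1 hi)]; simp] at this
    simpa using this.symm

/-! ### Galois invariance -/

/-- The action of multiplication by `s` on the second index. -/
def idxMul (n s : ℕ) (i : Σ _ : ℕ, ℕ) : Σ _ : ℕ, ℕ := ⟨i.1, s * i.2 % (n / i.1)⟩

theorem idxMul_mem {n s : ℕ} (hs : s.Coprime n) {i : Σ _ : ℕ, ℕ} (hi : i ∈ idx n) :
    idxMul n s i ∈ idx n := by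
  obtain ⟨⟨h1, h2⟩, h3, h4⟩ := mem_idx.1 hi
  refine mem_idx.2 ⟨⟨h1, h2⟩, Nat.mod_lt _ (by omega), ?_⟩
  simp only [idxMul]
  set k := (i.1.gcd (s * i.2 % (n / i.1))).gcd (n / i.1) with hk
  have k1 : k ∣ i.1 := (Nat.gcd_dvd_left _ _).trans (Nat.gcd_dvd_left _ _)
  have k2 : k ∣ n / i.1 := Nat.gcd_dvd_right _ _
  have k3 : k ∣ s * i.2 := (Nat.dvd_mod_iff k2).1
    ((Nat.gcd_dvd_left _ _).trans (Nat.gcd_dvd_right _ _))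
  have k4 : k ∣ i.2 := (Nat.Coprime.coprime_dvd_right (k1.trans h1) hs).symm.dvd_of_dvd_mul_left k3
  have := Nat.dvd_gcd (Nat.dvd_gcd k1 k4) k2
  rw [h4] at this
  exact Nat.dvd_one.1 this

theorem idxMul_idxMul {n s s' : ℕ} (h : s * s' ≡ 1 [MOD n]) {i : Σ _ : ℕ, ℕ} (hi : i ∈ idx n) :
    idxMul n s (idxMul n s' i) = i := by
  obtain ⟨⟨h1, h2⟩, h3, -⟩ := mem_idx.1 hi
  have : s * (s' * i.2 % (n / i.1)) ≡ i.2 [MOD n / i.1] := by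
    have e1 : s * (s' * i.2 % (n / i.1)) ≡ s * (s' * i.2) [MOD n / i.1] :=
      (Nat.mod_modEq _ _).mul_left s
    have e2 : s * s' * i.2 ≡ 1 * i.2 [MOD n / i.1] :=
      (h.of_dvd (Nat.div_dvd_of_dvd h1)).mul_right _
    rw [one_mul, mul_assoc] at e2
    exact e1.trans e2
  rw [Nat.ModEq, Nat.mod_eq_of_lt h3] at this
  simp [idxMul, this]

/-- Replacing ζ by ζˢ replaces b by sb modulo n/a, which permutes the index set; ζ^{ab} depends only
on b modulo n/a. -/
theorem prodSeries_pow {R : Type*} [CommRing R] (V : PowerSeries ℤ) {n s : ℕ} (hn : n ≠ 0)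
    (hs : s.Coprime n) {ζ : R} (hζ : ζ ^ n = 1) : prodSeries V (ζ ^ s) n = prodSeries V ζ n := by
  obtain ⟨s', -, hs'⟩ := Nat.exists_mul_mod_eq_of_coprime 1 hs hn
  have hs1 : s * s' ≡ 1 [MOD n] := hs'
  have hs2 : s' * s ≡ 1 [MOD n] := by rwa [mul_comm]
  have hcop : s'.Coprime n :=
    Nat.Coprime.coprime_dvd_left (dvd_mul_right s' s) (by
      rw [Nat.coprime_iff_gcd_eq_one, hs2.gcd_eq, Nat.gcd_one_left])
  refine Finset.prod_nbij' (idxMul n s) (idxMul n s') (fun i hi => idxMul_mem hs hi)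
    (fun i hi => idxMul_mem hcop hi) (fun i hi => idxMul_idxMul hs2 hi)
    (fun i hi => idxMul_idxMul hs1 hi) fun i hi => ?_
  obtain ⟨⟨⟨d, hd⟩, h2⟩, -⟩ := mem_idx.1 hi
  have hnd : n / i.1 = d := by
    rw [hd, Nat.mul_div_cancel_left _ (Nat.pos_of_ne_zero (fst_ne_zero_of_mem_idx hi))]
  have hpow : (ζ ^ s) ^ (i.1 * i.2) = ζ ^ (i.1 * (s * i.2 % d)) := by
    have : i.1 * (s * i.2) = n * (s * i.2 / d) + i.1 * (s * i.2 % d) := by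
      conv_lhs => rw [← Nat.div_add_mod (s * i.2) d]
      rw [hd]; ring
    rw [← pow_mul, show s * (i.1 * i.2) = i.1 * (s * i.2) by ring, this, pow_add, pow_mul, hζ,
      one_pow, one_mul]
  congr 2
  ext m
  simp only [twist, idxMul, hnd, hpow]

/-- Each coefficient is Galois-fixed, hence rational, and lies in ℤ[ξ], hence is integral; so it is
an integer. -/
theorem exists_int_coeff_prodSeries_of_isCyclotomicExtension (V : PowerSeries ℤ) {n : ℕ} [NeZero n]
    {K : Type*} [Field K] [CharZero K] [Algebra ℚ K] [IsCyclotomicExtension {n} ℚ K] {ξ : K}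
    (hK : IsPrimitiveRoot ξ n) (k m : ℕ) :
    ∃ c : ℤ, ((prodSeries V ξ n).coeff k).coeff m = c := by
  have hgal : IsGalois ℚ K := IsCyclotomicExtension.isGalois {n} ℚ K
  have hfin : FiniteDimensional ℚ K := IsCyclotomicExtension.finiteDimensional {n} ℚ K
  let x : K := ((prodSeries V ξ n).coeff k).coeff m
  have hfix : ∀ σ : K ≃ₐ[ℚ] K, σ x = x := by
    intro σ
    obtain ⟨s, -, hs, hsξ⟩ := hK.isPrimitiveRoot_iff.1 (hK.map_of_injective σ.injective)
    have h := map_prodSeries (σ : K →+* K) V ξ n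
    rw [RingHom.coe_coe, ← hsξ, prodSeries_pow V (NeZero.ne n) hs hK.pow_eq_one] at h
    conv_rhs => rw [show x = ((prodSeries V ξ n).coeff k).coeff m from rfl, ← h, coeff_map,
      PowerSeries.coeff_map]
    rfl
  have hbot := (IsGalois.mem_bot_iff_fixed x).2 hfix
  obtain ⟨r, hr⟩ := IntermediateField.mem_bot.1 hbot
  have hxint : IsIntegral ℤ x := by
    have : x = aeval ξ (((prodSeries V (X : ℤ[X]) n).coeff k).coeff m) := by
      have h := map_prodSeries (aeval ξ : ℤ[X] →ₐ[ℤ] K).toRingHom V (X : ℤ[X]) n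
      simp only [AlgHom.toRingHom_eq_coe, RingHom.coe_coe, aeval_X] at h
      rw [show x = ((prodSeries V ξ n).coeff k).coeff m from rfl, ← h, coeff_map,
        PowerSeries.coeff_map]
      rfl
    rw [this]
    exact adjoin_le_integralClosure (hK.isIntegral (NeZero.pos n))
      (aeval_mem_adjoin_singleton ℤ ξ)
  have hrint : IsIntegral ℤ r := by
    rw [← hr] at hxint
    exact (isIntegral_algebraMap_iff (algebraMap ℚ K).injective).1 hxint
  obtain ⟨c, hc⟩ := IsIntegrallyClosed.isIntegral_iff.1 hrint
  refine ⟨c, ?_⟩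
  change x = c
  rw [← hr, ← hc]
  simp

theorem exists_isCyclotomicExtension (F : Type) [Field F] [CharZero F] (n : ℕ) [NeZero n] :
    ∃ (K : Type) (_ : Field K) (_ : CharZero K) (_ : Algebra F K), IsCyclotomicExtension {n} F K :=
  ⟨CyclotomicField n F, inferInstance, inferInstance, inferInstance, inferInstance⟩

theorem exists_int_coeff_prodSeries (V : PowerSeries ℤ) {n : ℕ} (hn : n ≠ 0) {ζ : ℂ}
    (hζ : IsPrimitiveRoot ζ n) (k m : ℕ) :
    ∃ c : ℤ, ((prodSeries V ζ n).coeff k).coeff m = c := by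
  have : NeZero n := ⟨hn⟩
  obtain ⟨K, _, _, _, _⟩ := exists_isCyclotomicExtension ℚ n
  have hK := IsCyclotomicExtension.zeta_spec n ℚ K
  set ξ := IsCyclotomicExtension.zeta n ℚ K
  obtain ⟨c, hc⟩ := exists_int_coeff_prodSeries_of_isCyclotomicExtension V hK k m
  have := IsCyclotomicExtension.finiteDimensional {n} ℚ K
  refine ⟨c, ?_⟩
  let ι : K →ₐ[ℚ] ℂ := IsAlgClosed.lift
  obtain ⟨s, -, hs, hsξ⟩ := (hK.map_of_injective ι.injective).isPrimitiveRoot_iff.1 hζ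
  rw [← hsξ, prodSeries_pow V (NeZero.ne n) hs (by rw [← map_pow, hK.pow_eq_one, map_one])]
  have h := map_prodSeries (ι : K →+* ℂ) V ξ n
  rw [RingHom.coe_coe] at h
  change ((prodSeries V (ι ξ) n).coeff k).coeff m = c
  rw [← h, coeff_map, PowerSeries.coeff_map, hc]
  simp

/-! ### The modular polynomial over `ℤ` -/

/-- Evaluation of integral polynomials at an element of a commutative ring. -/
noncomputable def evalAt {A : Type*} [CommRing A] (w : A) : ℤ[X] →+* A :=
  eval₂RingHom (Int.castRingHom A) w

theorem evalAt_apply {A : Type*} [CommRing A] (w : A) (p : ℤ[X]) :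
    evalAt w p = (p.map (Int.castRingHom A)).eval w := by
  rw [evalAt, coe_eval₂RingHom, eval_map]

theorem map_evalAt {A B : Type*} [CommRing A] [CommRing B] (φ : A →+* B) (w : A) (p : ℤ[X]) :
    φ (evalAt w p) = evalAt (φ w) p := by
  rw [evalAt, evalAt, coe_eval₂RingHom, hom_eval₂, coe_eval₂RingHom]
  congr 1
  exact RingHom.ext_int _ _

theorem evalAt_powerSeries {R : Type*} [CommRing R] (U : PowerSeries R) (p : ℤ[X]) :
    evalAt U p = (p.map (Int.castRingHom R)).eval₂ PowerSeries.C U := by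
  rw [evalAt, coe_eval₂RingHom, eval₂_map]
  congr 1
  exact RingHom.ext_int _ _

theorem prodPoly_monic (f : ℂ → ℂ) (n : ℕ) (z : ℂ) : (prodPoly f n z).Monic :=
  monic_prod_of_monic _ _ fun _ _ => monic_X_sub_C _

theorem natDegree_prodPoly (f : ℂ → ℂ) (n : ℕ) (z : ℂ) :
    (prodPoly f n z).natDegree = (idx n).card := by
  rw [prodPoly, natDegree_prod_of_monic _ _ fun _ _ => monic_X_sub_C _]
  simp

/-- `Ψ`, a polynomial in the outer variable, becomes the product of the factors
`X - g(α τ)` on evaluating the inner variable at `g τ`. -/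
structure IsLevelPoly (n : ℕ) (Ψ : ℤ[X][Y]) : Prop where
  monic : Ψ.Monic
  natDegree_eq : Ψ.natDegree = (idx n).card
  map_g : ∀ z : ℂ, 0 < z.im → Ψ.map (evalAt (g z)) = prodPoly g n z
  map_gTwo : ∀ z : ℂ, 0 < z.im → Ψ.map (evalAt (gTwo z)) = prodPoly gTwo n z

theorem exists_isLevelPoly {n : ℕ} (hn : n.Coprime 10) : ∃ Ψ, IsLevelPoly n Ψ := by
  have hn0 := (pos_of_coprime_ten hn).ne'
  obtain ⟨V, hV0, hV1, hV⟩ := exists_gTwo_expansion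
  obtain ⟨P, hP⟩ := exists_prodPoly_coeff_eq hn
  have hint : ∀ k, ∃ p : ℤ[X], p.map (Int.castRingHom ℂ) = P k := by
    intro k
    have hk := prodSeries_coeff_eq hV hn0 fun z hz => (hP k z hz).2
    have hmem := coeff_mem_of_eval₂_C (Int.castRingHom ℂ).range
      (V := V.map (Int.castRingHom ℂ)) (P := P k) (by simp [PowerSeries.coeff_map, hV0])
      (by simp [PowerSeries.coeff_map, hV1]) (fun j => ⟨V.coeff j, by simp⟩) fun j => by
        obtain ⟨c, hc⟩ := exists_int_coeff_prodSeries V hn0 (Complex.isPrimitiveRoot_exp n hn0)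
          k (n * j)
        rw [hk, PowerSeries.coeff_expand_mul] at hc
        exact ⟨c, hc.symm⟩
    have : P k ∈ Polynomial.lifts (Int.castRingHom ℂ) := (lifts_iff_coeff_lifts _).2 hmem
    exact (mem_lifts _).1 this
  choose p hp using hint
  set N := (idx n).card
  -- The top term is put in by hand to make monicity and degree immediate; `p k` for k ≥ N is not
  -- used.
  let Ψ : ℤ[X][Y] := X ^ N + ∑ k ∈ Finset.range N, monomial k (p k)
  have hdeg : (∑ k ∈ Finset.range N, monomial k (p k) : ℤ[X][Y]).degree < N := by
    refine (degree_sum_le _ _).trans_lt ((Finset.sup_lt_iff (WithBot.bot_lt_coe N)).2 fun k hk => ?_)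
    exact (degree_monomial_le _ _).trans_lt (WithBot.coe_lt_coe.2 (Finset.mem_range.1 hk))
  have hcoeff : ∀ k < N, Ψ.coeff k = p k := by
    intro k hk
    simp only [Ψ, coeff_add, finsetSum_coeff, coeff_monomial, coeff_X_pow]
    rw [if_neg hk.ne, zero_add, Finset.sum_ite_eq' , if_pos (Finset.mem_range.2 hk)]
  have hmon : Ψ.Monic := monic_X_pow_add hdeg
  have hnat : Ψ.natDegree = N := by
    rw [natDegree_eq_of_degree_eq_some]
    rw [degree_add_eq_left_of_degree_lt] <;> simp [hdeg]
  have key : ∀ (f : ℂ → ℂ) (z : ℂ), (∀ k, (prodPoly f n z).coeff k = (P k).eval (f z)) →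
      Ψ.map (evalAt (f z)) = prodPoly f n z := by
    intro f z h
    have hm := hmon.map (evalAt (f z))
    have hd : (Ψ.map (evalAt (f z))).natDegree = N := by rw [hmon.natDegree_map, hnat]
    ext k
    rcases lt_trichotomy k N with hk | hk | hk
    · rw [coeff_map, hcoeff k hk, h, evalAt_apply, hp]
    · have h1 := hm.coeff_natDegree
      have h2 := (prodPoly_monic f n z).coeff_natDegree
      rw [hd] at h1
      rw [natDegree_prodPoly] at h2
      rw [hk, h1, h2]
    · rw [coeff_eq_zero_of_natDegree_lt (by rw [hd]; exact hk),
        coeff_eq_zero_of_natDegree_lt (by rw [natDegree_prodPoly]; exact hk)]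
  exact ⟨Ψ, hmon, hnat, fun z hz => key g z fun k => (hP k z hz).1,
    fun z hz => key gTwo z fun k => (hP k z hz).2⟩

theorem IsLevelPoly.map_expand {n : ℕ} (hn : n ≠ 0) {Ψ : ℤ[X][Y]} (h : IsLevelPoly n Ψ)
    {V : PowerSeries ℤ} (hV : HasExp 1 (V.map (Int.castRingHom ℂ)) gTwo) :
    Ψ.map (evalAt ((V.map (Int.castRingHom ℂ)).expand n hn)) =
      prodSeries V (Complex.exp (2 * Real.pi * Complex.I / n)) n := by
  ext1 k
  rw [prodSeries_coeff_eq hV hn (P := (Ψ.coeff k).map (Int.castRingHom ℂ)) fun z hz => by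
    rw [← h.map_gTwo z hz, coeff_map, evalAt_apply], coeff_map, ← evalAt_powerSeries]
  exact (map_evalAt (PowerSeries.expand (R := ℂ) n hn).toRingHom _ _).symm

/-! ### Kronecker's congruence -/

theorem map_evalAt_expand {R : Type*} [CommRing R] (V : PowerSeries ℤ) {n : ℕ} (hn : n ≠ 0)
    (Ψ : ℤ[X][Y]) : (Ψ.map (evalAt (V.expand n hn))).map (PowerSeries.map (Int.castRingHom R)) =
      Ψ.map (evalAt ((V.map (Int.castRingHom R)).expand n hn)) := by
  ext1 k
  rw [coeff_map, coeff_map, coeff_map, map_evalAt, PowerSeries.map_expand]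

/-- This is congruence modulo 1 - ζ: the cyclotomic polynomial divides c - N, and its value at 1 is
p. -/
theorem dvd_eval_one_sub_of_aeval_eq {p : ℕ} (hp : p.Prime) {ζ : ℂ} (hζ : IsPrimitiveRoot ζ p)
    {c : ℤ[X]} {N : ℤ} (h : aeval ζ c = N) : (p : ℤ) ∣ c.eval 1 - N := by
  have : Fact p.Prime := ⟨hp⟩
  have h1 : cyclotomic p ℤ ∣ c - C N := by
    rw [cyclotomic_eq_minpoly hζ hp.pos]
    exact minpoly.isIntegrallyClosed_dvd (hζ.isIntegral hp.pos) (by simp [h])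
  obtain ⟨d, hd⟩ := h1
  have := congrArg (eval 1) hd
  rw [eval_sub, eval_C, eval_mul, eval_one_cyclotomic_prime] at this
  exact ⟨_, this⟩

theorem IsLevelPoly.map_expand_zmod {p : ℕ} (hp : p.Prime) {Ψ : ℤ[X][Y]} (h : IsLevelPoly p Ψ)
    {V : PowerSeries ℤ} (hV : HasExp 1 (V.map (Int.castRingHom ℂ)) gTwo) :
    Ψ.map (evalAt ((V.map (Int.castRingHom (ZMod p))).expand p hp.ne_zero)) =
      prodSeries V (1 : ZMod p) p := by
  have hζ := Complex.isPrimitiveRoot_exp p hp.ne_zero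
  have hC := h.map_expand hp.ne_zero hV
  set ζ := Complex.exp (2 * Real.pi * Complex.I / p)
  rw [← map_evalAt_expand] at hC ⊢
  have e1 : prodSeries V (1 : ZMod p) p =
      (prodSeries V (1 : ℤ) p).map (PowerSeries.map (Int.castRingHom (ZMod p))) := by
    rw [map_prodSeries, map_one]
  have e2 : prodSeries V (1 : ℤ) p =
      (prodSeries V (X : ℤ[X]) p).map (PowerSeries.map (evalRingHom 1)) := by
    rw [map_prodSeries]; simp
  have e3 : prodSeries V ζ p =
      (prodSeries V (X : ℤ[X]) p).map (PowerSeries.map (evalAt ζ)) := by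
    rw [map_prodSeries]; simp [evalAt]
  rw [e1]
  generalize Ψ.map (evalAt (V.expand p hp.ne_zero)) = Q at *
  ext k m
  rw [coeff_map, coeff_map, PowerSeries.coeff_map, PowerSeries.coeff_map, e2, coeff_map,
    PowerSeries.coeff_map]
  have hkm := congrArg (fun F => PowerSeries.coeff m (Polynomial.coeff F k)) hC
  simp only [e3] at hkm
  rw [coeff_map, coeff_map, PowerSeries.coeff_map, PowerSeries.coeff_map] at hkm
  have hd := dvd_eval_one_sub_of_aeval_eq hp hζ (c := ((prodSeries V (X : ℤ[X]) p).coeff k).coeff m)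
    (N := (Q.coeff k).coeff m) hkm.symm
  exact (ZMod.intCast_eq_intCast_iff_dvd_sub _ _ _).2 hd

theorem pow_char_eq_expand {p : ℕ} [Fact p.Prime] (hp : p ≠ 0) (U : PowerSeries (ZMod p)) :
    U ^ p = U.expand p hp := by
  have h : frobenius (ZMod p) p = RingHom.id _ := ZMod.frobenius_zmod p
  have := MvPowerSeries.map_frobenius_expand (R := ZMod p) p hp (f := (U : MvPowerSeries Unit (ZMod p)))
  rw [h, MvPowerSeries.map_id] at this
  exact this.symm

theorem idx_prime {p : ℕ} (hp : p.Prime) :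
    idx p = insert ⟨p, 0⟩ ((Finset.range p).image fun b => ⟨1, b⟩) := by
  ext ⟨a, b⟩
  rw [mem_idx, Finset.mem_insert, Finset.mem_image]
  simp only [Finset.mem_range, Sigma.mk.injEq, heq_eq_eq]
  constructor
  · rintro ⟨⟨h1, -⟩, h2, -⟩
    rcases (Nat.dvd_prime hp).1 h1 with rfl | rfl
    · exact Or.inr ⟨b, by simpa using h2, rfl, rfl⟩
    · rw [Nat.div_self hp.pos] at h2
      exact Or.inl ⟨rfl, by omega⟩
  · rintro (⟨rfl, rfl⟩ | ⟨b', hb', rfl, rfl⟩)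
    · simp [Nat.div_self hp.pos, hp.ne_zero]
    · simpa [hp.ne_zero] using hb'

/-- At ζ = 1 the p twists with a = 1 all equal V(t), and (X - V(t))ᵖ = Xᵖ - V(tᵖ) in characteristic
p. The twist with a = p is V(t^{p²}) = V(tᵖ)ᵖ. -/
theorem prodSeries_one_prime {p : ℕ} (hp : p.Prime) (V : PowerSeries ℤ) :
    prodSeries V (1 : ZMod p) p =
      (X ^ p - C ((V.map (Int.castRingHom (ZMod p))).expand p hp.ne_zero)) *
      (X - C ((V.map (Int.castRingHom (ZMod p))).expand p hp.ne_zero ^ p)) := by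
  have : Fact p.Prime := ⟨hp⟩
  have : CharP (PowerSeries (ZMod p)) p :=
    charP_of_injective_ringHom (f := PowerSeries.C) PowerSeries.C_injective p
  have h1 : ∀ b, twist V (1 : ZMod p) ⟨1, b⟩ = V.map (Int.castRingHom (ZMod p)) := by
    intro b
    ext m
    simp [twist]
  have h2 : twist V (1 : ZMod p) ⟨p, 0⟩ =
      (V.map (Int.castRingHom (ZMod p))).expand p hp.ne_zero ^ p := by
    rw [twist_eq_expand V _ (pow_ne_zero 2 hp.ne_zero), pow_char_eq_expand hp.ne_zero,
      ← PowerSeries.expand_mul]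
    simp [pow_two]
  rw [prodSeries, idx_prime hp, Finset.prod_insert, Finset.prod_image fun b _ b' _ h => by simpa using h, h2]
  · simp only [h1, Finset.prod_const, Finset.card_range]
    rw [sub_pow_char, ← C_pow, ← pow_char_eq_expand hp.ne_zero, mul_comm]
  · simp [hp.one_lt.ne]

/-- Both sides agree modulo p after the inner variable is replaced by V(tᵖ), and this substitution
is injective over 𝔽_p because V = q + ⋯. -/
theorem IsLevelPoly.kronecker {p : ℕ} (hp : p.Prime) {Ψ : ℤ[X][Y]} (h : IsLevelPoly p Ψ) :
    Ψ - (X ^ p - C X) * (X - C (X ^ p)) ∈ Ideal.span {((p : ℕ) : ℤ[X][Y])} := by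
  obtain ⟨V, hV0, hV1, hV⟩ := exists_gTwo_expansion
  have h1 := h.map_expand_zmod hp hV
  rw [prodSeries_one_prime hp V] at h1
  set W := V.map (Int.castRingHom (ZMod p)) with hW
  have hX : evalAt (W.expand p hp.ne_zero) X = W.expand p hp.ne_zero := by simp [evalAt]
  set D := Ψ - (X ^ p - C X) * (X - C (X ^ p)) with hD
  have hmap : D.map (evalAt (W.expand p hp.ne_zero)) = 0 := by
    rw [hD, Polynomial.map_sub, h1, Polynomial.map_mul, Polynomial.map_sub, Polynomial.map_sub,
      Polynomial.map_pow, map_C, map_C, map_pow, map_pow, hX, map_X, map_pow, sub_self]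
  rw [← C_eq_natCast, Ideal.mem_span_singleton, C_dvd_iff_dvd_coeff]
  intro k
  rw [← C_eq_natCast, C_dvd_iff_dvd_coeff]
  have hk : evalAt (W.expand p hp.ne_zero) (D.coeff k) = 0 := by
    rw [← coeff_map, hmap, coeff_zero]
  have e := map_evalAt (PowerSeries.expand (R := ZMod p) p hp.ne_zero).toRingHom W (D.coeff k)
  have hk' : evalAt W (D.coeff k) = 0 := by
    ext m
    rw [← PowerSeries.coeff_expand_mul p hp.ne_zero]
    have := congrArg (PowerSeries.coeff (p * m)) (e.trans hk)
    simpa using this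
  rw [evalAt_powerSeries] at hk'
  have h0 := eq_zero_of_eval₂_C (V := W) (by simp [hW, hV0]) (by simp [hW, hV1]) hk'
  intro m
  have := congrArg (fun q => Polynomial.coeff q m) h0
  simp only [coeff_map, coeff_zero] at this
  exact (ZMod.intCast_zmod_eq_zero_iff_dvd _ _).1 this

/-! ### Bivariate relations between `gTwo` and its twists -/

theorem exists_hasExp_evalEval {w : ℝ} {F G : PowerSeries ℂ} {f h : ℂ → ℂ} (hF : HasExp w F f)
    (hG : HasExp w G h) (A : ℂ[X][Y]) :
    ∃ H, HasExp w H fun z => A.evalEval (h z) (f z) := by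
  induction A using Polynomial.induction_on' with
  | add p q hp hq =>
    obtain ⟨H, hH⟩ := hp
    obtain ⟨H', hH'⟩ := hq
    exact ⟨H + H', (hH.add hH').congr fun z _ => by simp⟩
  | monomial k a =>
    refine ⟨_, ((hG.eval a).mul (hF.pow k)).congr fun z _ => ?_⟩
    simp [evalEval, eval_monomial]

/-- Power series over ℂ form a domain and determine the functions they expand. -/
theorem HasExp.eqOn_zero_or_of_mul {w : ℝ} (hw : 0 < w) {F G : PowerSeries ℂ} {f h : ℂ → ℂ}
    (hF : HasExp w F f) (hG : HasExp w G h) (hfh : ∀ z : ℂ, 0 < z.im → f z * h z = 0) :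
    (∀ z : ℂ, 0 < z.im → f z = 0) ∨ ∀ z : ℂ, 0 < z.im → h z = 0 := by
  have h0 : ∀ {H : PowerSeries ℂ} {e : ℂ → ℂ}, HasExp w H e → H = 0 →
      ∀ z : ℂ, 0 < z.im → e z = 0 := by
    rintro H e he rfl z hz
    have := he ⟨z, hz⟩
    simp only [map_zero, zero_mul] at this
    exact this.unique hasSum_zero
  rcases mul_eq_zero.1 ((hF.mul hG).eq_zero hw hfh) with h | h
  · exact Or.inl (h0 hF h)
  · exact Or.inr (h0 hG h)

/-- The leading term ζ^{ab} t^{a²} determines a, and then b because 0 ≤ ab < n. -/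
theorem twist_injOn {V : PowerSeries ℤ} (hV1 : V.coeff 1 = 1) {n : ℕ} {ζ : ℂ}
    (hζ : IsPrimitiveRoot ζ n) {i j : Σ _ : ℕ, ℕ} (hi : i ∈ idx n) (hj : j ∈ idx n)
    (h : twist V ζ i = twist V ζ j) : i = j := by
  have hlead : ∀ i ∈ idx n, (twist V ζ i).coeff (i.1 ^ 2) = ζ ^ (i.1 * i.2) := by
    intro i hi
    have : 0 < i.1 ^ 2 := pow_pos (Nat.pos_of_ne_zero (fst_ne_zero_of_mem_idx hi)) 2
    simp [twist, Nat.div_self this, hV1]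
  have hn : n ≠ 0 := (mem_idx.1 hi).1.2
  have hζ0 : ζ ≠ 0 := hζ.ne_zero hn
  have hle : ∀ {i j}, i ∈ idx n → j ∈ idx n → twist V ζ i = twist V ζ j → j.1 ≤ i.1 := by
    intro i j hi hj h
    have h1 := hlead i hi
    rw [h, twist, PowerSeries.coeff_mk] at h1
    split_ifs at h1 with hd
    · exact Nat.le_of_dvd (Nat.pos_of_ne_zero (fst_ne_zero_of_mem_idx hi))
        ((Nat.pow_dvd_pow_iff two_ne_zero).1 hd)
    · exact absurd h1.symm (pow_ne_zero _ hζ0)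
  have hfst : i.1 = j.1 := le_antisymm (hle hj hi h.symm) (hle hi hj h)
  have h1 := hlead i hi
  rw [h, hfst, hlead j hj] at h1
  have hlt : ∀ i ∈ idx n, i.1 * i.2 < n := by
    intro i hi
    obtain ⟨⟨h1, -⟩, h2, -⟩ := mem_idx.1 hi
    calc i.1 * i.2 < i.1 * (n / i.1) :=
          Nat.mul_lt_mul_of_pos_left h2 (Nat.pos_of_ne_zero (fst_ne_zero_of_mem_idx hi))
      _ = n := Nat.mul_div_cancel' h1
  have h2 := hζ.pow_inj (hlt j hj) (hfst ▸ hlt i hi) h1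
  have h3 := Nat.eq_of_mul_eq_mul_left (Nat.pos_of_ne_zero (fst_ne_zero_of_mem_idx hj)) h2
  obtain ⟨a, b⟩ := i
  obtain ⟨a', b'⟩ := j
  simp only at hfst h3
  rw [hfst, h3]

/-- A discriminant: its expansion is nonzero, and it vanishes at each point where two conjugates
coincide. -/
theorem exists_hasExp_prod_sub {n : ℕ} : ∃ H : PowerSeries ℂ, H ≠ 0 ∧ HasExp n H fun z =>
    ∏ p ∈ (idx n).offDiag, (gTwo (moebius (upper n p.1) z) - gTwo (moebius (upper n p.2) z)) := by
  classical
  obtain ⟨V, hV0, hV1, hV⟩ := exists_gTwo_expansion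
  have hmem := (expSubring n).prod_mem (t := (idx n).offDiag)
    (f := fun p => (twist V (Complex.exp (2 * Real.pi * Complex.I / n)) p.1 -
      twist V (Complex.exp (2 * Real.pi * Complex.I / n)) p.2,
      (fun z => gTwo (moebius (upper n p.1) z)) - fun z => gTwo (moebius (upper n p.2) z)))
    fun p hp => by
      obtain ⟨h1, h2, -⟩ := Finset.mem_offDiag.1 hp
      exact (hasExp_twist hV h1).sub (hasExp_twist hV h2)
  refine ⟨_, ?_, HasExp.congr (hmem : HasExp _ _ _) fun z _ => ?_⟩
  · rw [Prod.fst_prod, Finset.prod_ne_zero_iff]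
    intro p hp
    obtain ⟨h1, h2, h3⟩ := Finset.mem_offDiag.1 hp
    have hn : n ≠ 0 := (mem_idx.1 h1).1.2
    exact fun h => h3 (twist_injOn hV1 (Complex.isPrimitiveRoot_exp n hn) h1 h2 (sub_eq_zero.1 h))
  · rw [Prod.snd_prod, Finset.prod_apply]
    rfl

theorem eq_zero_of_eval_gTwo {P : ℂ[X]} (h : ∀ z : ℂ, 0 < z.im → P.eval (gTwo z) = 0) : P = 0 := by
  obtain ⟨V, hV0, hV1, hV⟩ := exists_gTwo_expansion
  exact eq_zero_of_eval₂_C (V := V.map (Int.castRingHom ℂ)) (by simp [PowerSeries.coeff_map, hV0])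
    (by simp [PowerSeries.coeff_map, hV1]) ((hV.eval P).eq_zero one_pos h)

/-- By transitivity, evaluating the relation at γ'z carries it from nz to any other conjugate, while
gTwo(γ'z) = gTwo(z). -/
theorem evalEval_gTwo_upper {n : ℕ} (hn : n.Coprime 10) {A : ℂ[X][Y]}
    (hA : ∀ z : ℂ, 0 < z.im → A.evalEval (gTwo z) (gTwo (n * z)) = 0) {i : Σ _ : ℕ, ℕ}
    (hi : i ∈ idx n) {z : ℂ} (hz : 0 < z.im) :
    A.evalEval (gTwo z) (gTwo (moebius (upper n i) z)) = 0 := by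
  have hn0 := pos_of_coprime_ten hn
  obtain ⟨γ, γ', hγ, hγ', h⟩ := exists_upper_eq_mul hn hi
  have hz' := moebius_im_pos (det_coe_pos γ') hz
  have hup : 0 < (upper n ⟨n, 0⟩).det := by
    rw [det_upper (first_mem_idx hn0)]; exact_mod_cast hn0
  have hmul : moebius (upper n ⟨n, 0⟩) (moebius γ' z) = n * moebius γ' z := by
    generalize moebius γ' z = w
    simp [moebius, upper, Nat.div_self hn0]
  rw [h, moebius_mul (det_coe_pos γ) (by rw [Matrix.det_mul, γ'.det_coe, mul_one]; exact hup) hz,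
    moebius_mul hup (det_coe_pos γ') hz, hmul,
    gTwo_moebius hγ (im_natCast_mul_pos hz' hn0), ← gTwo_moebius hγ' hz]
  exact hA _ hz'

/-- A relation between `gTwo (n z)` and `gTwo z` of degree less than the number of twists is
trivial. -/
theorem eq_zero_of_evalEval_gTwo {n : ℕ} (hn : n.Coprime 10) {A : ℂ[X][Y]}
    (hdeg : A.natDegree < (idx n).card)
    (hA : ∀ z : ℂ, 0 < z.im → A.evalEval (gTwo z) (gTwo (n * z)) = 0) : A = 0 := by
  classical
  have hn0 := pos_of_coprime_ten hn
  have hnR : (0 : ℝ) < n := by exact_mod_cast hn0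
  obtain ⟨V, hV0, hV1, hV⟩ := exists_gTwo_expansion
  obtain ⟨H, hH0, hH⟩ := exists_hasExp_prod_sub (n := n)
  ext1 k
  rw [coeff_zero]
  refine eq_zero_of_eval_gTwo ?_
  -- Where the conjugates are distinct, A has more roots than its degree, so its coefficients
  -- vanish; elsewhere the discriminant vanishes. The product is thus zero everywhere.
  have hprod := HasExp.eqOn_zero_or_of_mul hnR hH
    (hasExp_expand (hV.eval (A.coeff k)) hn0.ne') fun z hz => ?_
  · rcases hprod with h | h
    · exact absurd (hH.eq_zero hnR h) hH0
    · exact h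
  · by_cases hinj : Set.InjOn (fun i => gTwo (moebius (upper n i) z)) (idx n)
    · have h0 : A.map (evalRingHom (gTwo z)) = 0 := by
        refine eq_zero_of_natDegree_lt_card_of_eval_eq_zero' _
          ((idx n).image fun i => gTwo (moebius (upper n i) z)) (fun x hx => ?_) ?_
        · obtain ⟨i, hi, rfl⟩ := Finset.mem_image.1 hx
          rw [map_evalRingHom_eval]
          exact evalEval_gTwo_upper hn hA hi hz
        · rw [Finset.card_image_of_injOn hinj]
          exact natDegree_map_le.trans_lt hdeg
      have := congrArg (fun p => Polynomial.coeff p k) h0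
      simp only [coeff_map, coeff_zero, coe_evalRingHom] at this
      rw [this, mul_zero]
    · simp only [Set.InjOn, not_forall] at hinj
      obtain ⟨i, hi, j, hj, hij, hne⟩ := hinj
      rw [Finset.prod_eq_zero (i := (i, j)) (Finset.mem_offDiag.2 ⟨hi, hj, hne⟩)
        (sub_eq_zero.2 hij), zero_mul]

/-! ### Irreducibility and symmetry -/

/-- Extension of scalars from `ℤ` to `ℂ` for bivariate polynomials. -/
noncomputable def toComplex : ℤ[X][Y] →+* ℂ[X][Y] := mapRingHom (mapRingHom (Int.castRingHom ℂ))

theorem toComplex_apply (A : ℤ[X][Y]) : toComplex A = A.map (mapRingHom (Int.castRingHom ℂ)) := rfl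

theorem toComplex_injective : Function.Injective toComplex :=
  map_injective _ (map_injective _ Int.cast_injective)

theorem evalEval_toComplex (A : ℤ[X][Y]) (x y : ℂ) :
    (toComplex A).evalEval x y = (A.map (evalAt x)).eval y := by
  rw [eval_map, evalAt, eval₂_eval₂RingHom_apply, toComplex_apply]

theorem aevalAeval_eq {A : Type*} [CommRing A] (x y : A) (Ψ : ℤ[X][Y]) :
    aevalAeval (R := ℤ) x y Ψ = (Ψ.map (evalAt x)).eval y := by
  induction Ψ using Polynomial.induction_on' with
  | add p q hp hq => rw [map_add, hp, hq, Polynomial.map_add, eval_add]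
  | monomial k a =>
    rw [← C_mul_X_pow_eq_monomial, map_mul, map_pow, aevalAeval_C, aevalAeval_Y,
      Polynomial.map_mul, Polynomial.map_pow, map_C, map_X, eval_mul, eval_C, eval_pow, eval_X]
    rfl

theorem eval_map_swap {A : Type*} [CommRing A] (Ψ : ℤ[X][Y]) (x y : A) :
    ((Bivariate.swap Ψ).map (evalAt x)).eval y = (Ψ.map (evalAt y)).eval x := by
  rw [← aevalAeval_eq, ← aevalAeval_eq, Bivariate.aevalAeval_swap]

theorem evalEval_toComplex_swap (A : ℤ[X][Y]) (x y : ℂ) :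
    (toComplex (Bivariate.swap A)).evalEval x y = (toComplex A).evalEval y x := by
  rw [evalEval_toComplex, evalEval_toComplex, eval_map_swap]

theorem eval_prodPoly_eq_zero {f : ℂ → ℂ} {n : ℕ} {i : Σ _ : ℕ, ℕ} (hi : i ∈ idx n) (z : ℂ) :
    (prodPoly f n z).eval (f (moebius (upper n i) z)) = 0 := by
  rw [prodPoly, eval_prod]
  exact Finset.prod_eq_zero hi (by simp)

theorem IsLevelPoly.evalEval_gTwo_mul {n : ℕ} (hn : 0 < n) {Ψ : ℤ[X][Y]} (h : IsLevelPoly n Ψ) {z : ℂ}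
    (hz : 0 < z.im) : (toComplex Ψ).evalEval (gTwo z) (gTwo (n * z)) = 0 := by
  rw [evalEval_toComplex, h.map_gTwo z hz]
  have := eval_prodPoly_eq_zero (f := gTwo) (first_mem_idx hn) z
  simpa [moebius, upper, Nat.div_self hn] using this

theorem last_mem_idx {n : ℕ} (hn : 0 < n) : ⟨1, 0⟩ ∈ idx n := by
  rw [mem_idx]
  simp [hn.ne', hn]

/-- The representative (1 0; 0 n) sends nz back to z. -/
theorem IsLevelPoly.evalEval_gTwo_mul_swap {n : ℕ} (hn : 0 < n) {Ψ : ℤ[X][Y]} (h : IsLevelPoly n Ψ)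
    {z : ℂ} (hz : 0 < z.im) : (toComplex Ψ).evalEval (gTwo (n * z)) (gTwo z) = 0 := by
  rw [evalEval_toComplex, h.map_gTwo _ (im_natCast_mul_pos hz hn)]
  have := eval_prodPoly_eq_zero (f := gTwo) (last_mem_idx hn) (n * z)
  have hn' : (n : ℂ) ≠ 0 := by exact_mod_cast hn.ne'
  simpa [moebius, upper, mul_div_cancel_left₀ z hn'] using this

theorem IsLevelPoly.monic_toComplex {n : ℕ} {Ψ : ℤ[X][Y]} (h : IsLevelPoly n Ψ) :
    (toComplex Ψ).Monic := h.monic.map _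

theorem IsLevelPoly.natDegree_toComplex {n : ℕ} {Ψ : ℤ[X][Y]} (h : IsLevelPoly n Ψ) :
    (toComplex Ψ).natDegree = (idx n).card := by
  rw [toComplex_apply, h.monic.natDegree_map, h.natDegree_eq]

/-- One of two monic factors vanishes along (gTwo(z), gTwo(nz)), so it has full degree and the other
has degree 0. -/
theorem IsLevelPoly.irreducible_toComplex {n : ℕ} (hn : n.Coprime 10) {Ψ : ℤ[X][Y]}
    (h : IsLevelPoly n Ψ) : Irreducible (toComplex Ψ) := by
  have hn0 := pos_of_coprime_ten hn
  have hnR : (0 : ℝ) < n := by exact_mod_cast hn0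
  have hcard : 0 < (idx n).card := Finset.card_pos.2 ⟨_, first_mem_idx hn0⟩
  obtain ⟨V, -, -, hV⟩ := exists_gTwo_expansion
  rw [h.monic_toComplex.irreducible_iff_natDegree]
  refine ⟨fun h1 => ?_, fun A B hA hB hAB => ?_⟩
  · have := h.natDegree_toComplex
    rw [h1, natDegree_one] at this
    omega
  have hdeg : A.natDegree + B.natDegree = (idx n).card := by
    rw [← h.natDegree_toComplex, ← hAB, hA.natDegree_mul hB]
  have hV1 := hasExp_expand hV hn0.ne'
  have hV2 : HasExp n _ fun z => gTwo (n * z) :=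
    (hasExp_twist hV (first_mem_idx hn0)).congr fun z hz => by
      simp [moebius, upper, Nat.div_self hn0]
  obtain ⟨F, hF⟩ := exists_hasExp_evalEval hV2 hV1 A
  obtain ⟨G, hG⟩ := exists_hasExp_evalEval hV2 hV1 B
  rcases hF.eqOn_zero_or_of_mul hnR hG fun z hz => by
    rw [← evalEval_mul, hAB, h.evalEval_gTwo_mul hn0 hz] with h0 | h0
  · by_contra! hc
    exact hA.ne_zero (eq_zero_of_evalEval_gTwo hn (by omega) h0)
  · by_contra! hc
    exact hB.ne_zero (eq_zero_of_evalEval_gTwo hn (by omega) h0)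

theorem inYOverRatFunc_eq (Ψ : ℤ[X][Y]) :
    inYOverRatFunc Ψ = (toComplex Ψ).map (algebraMap ℂ[X] (RatFunc ℂ)) := by
  rw [inYOverRatFunc, toComplex_apply, Polynomial.map_map]

theorem IsLevelPoly.irreducible_inYOverRatFunc {n : ℕ} (hn : n.Coprime 10) {Ψ : ℤ[X][Y]}
    (h : IsLevelPoly n Ψ) : Irreducible (inYOverRatFunc Ψ) := by
  rw [inYOverRatFunc_eq]
  exact h.monic_toComplex.irreducible_iff_irreducible_map_fraction_map.1
    (h.irreducible_toComplex hn)

/-- The remainder of the swapped polynomial modulo Ψ is a relation of too small a degree. -/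
theorem IsLevelPoly.dvd_swap {n : ℕ} (hn : n.Coprime 10) {Ψ : ℤ[X][Y]} (h : IsLevelPoly n Ψ) :
    Ψ ∣ Bivariate.swap Ψ := by
  have hn0 := pos_of_coprime_ten hn
  have hcard : 0 < (idx n).card := Finset.card_pos.2 ⟨_, first_mem_idx hn0⟩
  rw [← modByMonic_eq_zero_iff_dvd h.monic]
  refine toComplex_injective ?_
  rw [map_zero]
  refine eq_zero_of_evalEval_gTwo hn ?_ fun z hz => ?_
  · refine natDegree_map_le.trans_lt ?_
    rw [← h.natDegree_eq]
    refine natDegree_modByMonic_lt _ h.monic fun h1 => ?_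
    have := h.natDegree_eq
    rw [h1, natDegree_one] at this
    omega
  · have := modByMonic_add_div (Bivariate.swap Ψ) Ψ
    have h1 := congrArg (fun A => (toComplex A).evalEval (gTwo z) (gTwo (n * z))) this
    simp only [map_add, map_mul, evalEval_add, evalEval_mul, h.evalEval_gTwo_mul hn0 hz, zero_mul,
      add_zero] at h1
    rw [h1, evalEval_toComplex_swap, h.evalEval_gTwo_mul_swap hn0 hz]

/-- Swapping is an involution, so the quotient is a unit of ℤ[X][Y]. The minus sign does occur for n
= 1. -/
theorem IsLevelPoly.swap_eq_or {n : ℕ} (hn : n.Coprime 10) {Ψ : ℤ[X][Y]} (h : IsLevelPoly n Ψ) :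
    Bivariate.swap Ψ = Ψ ∨ Bivariate.swap Ψ = -Ψ := by
  obtain ⟨Q, hQ⟩ := h.dvd_swap hn
  have h1 : Ψ * (Q * Bivariate.swap Q) = Ψ * 1 := by
    conv_rhs => rw [mul_one, ← Bivariate.swap_swap_apply Ψ, hQ, map_mul, hQ, mul_assoc]
  have h2 : IsUnit Q := IsUnit.of_mul_eq_one _ (mul_left_cancel₀ h.monic.ne_zero h1)
  obtain ⟨r, hr, rfl⟩ := Polynomial.isUnit_iff.1 h2
  obtain ⟨s, hs, rfl⟩ := Polynomial.isUnit_iff.1 hr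
  rcases Int.isUnit_iff.1 hs with rfl | rfl
  · left; simpa using hQ
  · have hneg : (C (C (-1)) : ℤ[X][Y]) = -1 := by simp
    exact Or.inr (by rw [hQ, hneg]; ring)

theorem one_lt_card_idx {n : ℕ} (hn : 1 < n) : 1 < (idx n).card :=
  Finset.one_lt_card.2 ⟨_, first_mem_idx (by omega), _, last_mem_idx (by omega), by simp; omega⟩

/-- Antisymmetry would make Ψ vanish on the diagonal, so X - Y would divide an irreducible
polynomial of degree at least 2. -/
theorem IsLevelPoly.swap_eq {n : ℕ} (hn : n.Coprime 10) (h1n : 1 < n) {Ψ : ℤ[X][Y]}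
    (h : IsLevelPoly n Ψ) : Bivariate.swap Ψ = Ψ := by
  refine (h.swap_eq_or hn).resolve_right fun hneg => ?_
  have hdiag : Ψ.eval X = 0 := by
    have e : (Bivariate.swap Ψ).eval X = Ψ.eval X := by
      have := eval_map_swap Ψ (X : ℤ[X]) X
      have hid : evalAt (X : ℤ[X]) = RingHom.id _ := by ext <;> simp [evalAt]
      rwa [hid, Polynomial.map_id, Polynomial.map_id] at this
    rw [hneg, eval_neg] at e
    exact self_eq_neg.1 e.symm
  obtain ⟨Q, hQ⟩ := dvd_iff_isRoot.2 hdiag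
  have hdvd : (X - C X : ℂ[X][Y]) ∣ toComplex Ψ := ⟨toComplex Q, by
    rw [hQ, map_mul]
    simp [toComplex]⟩
  have hX : Irreducible (X - C X : ℂ[X][Y]) := irreducible_X_sub_C _
  have := natDegree_eq_of_degree_eq (degree_eq_degree_of_associated
    (hX.associated_of_dvd (h.irreducible_toComplex hn) hdvd))
  rw [natDegree_X_sub_C, h.natDegree_toComplex] at this
  have := one_lt_card_idx h1n
  omega

/-! ### The number of factors -/

theorem card_filter_coprime_range_mul (e k : ℕ) :
    ((Finset.range (e * k)).filter fun b => e.Coprime b).card = k * e.totient := by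
  rw [← Nat.count_eq_card_filter_range]
  induction k with
  | zero => simp
  | succ k ih =>
    rw [mul_add_one, Nat.count_add, ih, add_one_mul]
    congr 1
    simp only [Nat.coprime_mul_left_add_right]
    rw [Nat.count_eq_card_filter_range]
    rfl

/-- The number of `b < d` with `gcd(a, b, d) = 1`. -/
def fiberCard (a d : ℕ) : ℕ := d / a.gcd d * (a.gcd d).totient

theorem card_filter_gcd_eq_one (a d : ℕ) :
    ((Finset.range d).filter fun b => (a.gcd b).gcd d = 1).card = fiberCard a d := by
  rw [fiberCard, ← card_filter_coprime_range_mul, Nat.mul_div_cancel' (Nat.gcd_dvd_right a d)]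
  congr 2
  funext b
  rw [Nat.Coprime, Nat.gcd_assoc, Nat.gcd_assoc, Nat.gcd_comm b d]

theorem card_idx_eq_sum (n : ℕ) : (idx n).card = ∑ a ∈ n.divisors, fiberCard a (n / a) := by
  rw [idx, Finset.card_sigma]
  exact Finset.sum_congr rfl fun a _ => card_filter_gcd_eq_one a _

theorem fiberCard_mul {a d a' d' : ℕ} (h : (a * d).Coprime (a' * d')) :
    fiberCard (a * a') (d * d') = fiberCard a d * fiberCard a' d' := by
  have had' : a.Coprime d' := h.coprime_mul_right.coprime_mul_left_right
  have had : a'.Coprime d := h.coprime_mul_left.coprime_mul_right_right.symm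
  have hdd : d.Coprime d' := h.coprime_mul_left.coprime_mul_left_right
  have haa : a.Coprime a' := h.coprime_mul_right.coprime_mul_right_right
  have hg : (a * a').gcd (d * d') = a.gcd d * a'.gcd d' := by
    rw [Nat.Coprime.gcd_mul _ hdd, Nat.Coprime.gcd_mul_right_cancel _ had,
      Nat.Coprime.gcd_mul_left_cancel _ had']
  have hc : (a.gcd d).Coprime (a'.gcd d') :=
    (hdd.coprime_dvd_left (Nat.gcd_dvd_right _ _)).coprime_dvd_right (Nat.gcd_dvd_right _ _)
  rw [fiberCard, hg, Nat.totient_mul hc,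
    Nat.mul_div_mul_comm (Nat.gcd_dvd_right _ _) (Nat.gcd_dvd_right _ _), fiberCard, fiberCard]
  ring

theorem card_idx_mul {m n : ℕ} (h : m.Coprime n) :
    (idx (m * n)).card = (idx m).card * (idx n).card := by
  rw [card_idx_eq_sum, card_idx_eq_sum, card_idx_eq_sum, h.divisors_mul, Finset.sum_map,
    Finset.sum_mul_sum, ← Finset.sum_product', ← Finset.sum_attach (m.divisors ×ˢ n.divisors)]
  refine Finset.sum_congr rfl fun p _ => ?_
  obtain ⟨⟨a, a'⟩, hp⟩ := p
  obtain ⟨h1, h2⟩ := Finset.mem_product.1 hp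
  obtain ⟨h1, -⟩ := Nat.mem_divisors.1 h1
  obtain ⟨h2, -⟩ := Nat.mem_divisors.1 h2
  change fiberCard (a * a') (m * n / (a * a')) = fiberCard a (m / a) * fiberCard a' (n / a')
  simp only at h1 h2
  rw [Nat.mul_div_mul_comm h1 h2, fiberCard_mul]
  rwa [Nat.mul_div_cancel' h1, Nat.mul_div_cancel' h2]

theorem fiberCard_prime_pow {p : ℕ} (hp : p.Prime) {i j : ℕ} (hi : 0 < i) (hj : 0 < j) :
    (fiberCard (p ^ i) (p ^ j) : ℤ) = p ^ j - p ^ (j - 1) := by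
  have hg : (p ^ i).gcd (p ^ j) = p ^ min i j := by
    rcases le_total i j with h | h
    · rw [min_eq_left h, Nat.gcd_eq_left (pow_dvd_pow p h)]
    · rw [min_eq_right h, Nat.gcd_eq_right (pow_dvd_pow p h)]
  have hm : 0 < min i j := lt_min hi hj
  rw [fiberCard, hg, Nat.totient_prime_pow hp hm, Nat.pow_div (min_le_right i j) hp.pos,
    ← mul_assoc, ← pow_add, show j - min i j + (min i j - 1) = j - 1 by omega]
  obtain ⟨k, rfl⟩ : ∃ k, j = k + 1 := ⟨j - 1, by omega⟩
  push_cast [hp.one_le]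
  ring

/-- The divisors 1 and p^(k+1) contribute p^(k+1) and 1; those in between telescope to p^k - 1. -/
theorem card_idx_prime_pow {p : ℕ} (hp : p.Prime) (k : ℕ) :
    (idx (p ^ (k + 1))).card = p ^ (k + 1) + p ^ k := by
  zify
  have hdiv : ∀ i ≤ k + 1, p ^ (k + 1) / p ^ i = p ^ (k + 1 - i) := fun i hi =>
    Nat.pow_div hi hp.pos
  rw [card_idx_eq_sum, Nat.divisors_prime_pow hp, Finset.sum_map, Finset.sum_range_succ,
    Finset.sum_range_succ']
  simp only [Function.Embedding.coeFn_mk]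
  have h0 : fiberCard (p ^ 0) (p ^ (k + 1) / p ^ 0) = p ^ (k + 1) := by simp [fiberCard]
  have h1 : fiberCard (p ^ (k + 1)) (p ^ (k + 1) / p ^ (k + 1)) = 1 := by
    simp [fiberCard, Nat.div_self (pow_pos hp.pos (k + 1))]
  rw [h0, h1]
  have h2 : ∀ i ∈ Finset.range k, ((fiberCard (p ^ (i + 1)) (p ^ (k + 1) / p ^ (i + 1)) : ℕ) : ℤ) =
      (p : ℤ) ^ (k - i) - p ^ (k - (i + 1)) := by
    intro i hi
    have := Finset.mem_range.1 hi
    rw [hdiv _ (by omega), fiberCard_prime_pow hp (by omega) (by omega),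
      show k + 1 - (i + 1) = k - i by omega, show k - i - 1 = k - (i + 1) by omega]
  push_cast
  rw [Finset.sum_congr rfl h2, Finset.sum_range_sub' (fun i => (p : ℤ) ^ (k - i))]
  simp
  ring

theorem card_idx_one : (idx 1).card = 1 := by
  rw [card_idx_eq_sum]
  simp [fiberCard]

theorem psi_mul {m n : ℕ} (h : m.Coprime n) : psi (m * n) = psi m * psi n := by
  rw [psi, psi, psi, h.primeFactors_mul, Finset.prod_union h.disjoint_primeFactors]
  push_cast
  ring

theorem card_idx_eq_psi {n : ℕ} (hn : n ≠ 0) : ((idx n).card : ℚ) = psi n := by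
  induction n using Nat.recOnPosPrimePosCoprime with
  | prime_pow p k hp hk =>
    obtain ⟨k, rfl⟩ : ∃ j, k = j + 1 := ⟨k - 1, by omega⟩
    have hp0 : (p : ℚ) ≠ 0 := by exact_mod_cast hp.ne_zero
    rw [card_idx_prime_pow hp, psi, Nat.primeFactors_prime_pow (by omega) hp,
      Finset.prod_singleton]
    push_cast
    field_simp
    ring
  | zero => exact absurd rfl hn
  | one => simp [card_idx_one, psi]
  | coprime a b ha hb hab iha ihb =>
    rw [card_idx_mul hab, psi_mul hab, ← iha (by omega), ← ihb (by omega)]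
    push_cast
    rfl

/-! ### The product over the matrices `α_{a,b}` and uniqueness -/

/-- Each σ_a lies in Γ₀(10), so it does not affect the value of `g`. -/
theorem modularProduct_eq {n : ℕ} (hn : n.Coprime 10) {σ : ℤ → SL(2, ℤ)}
    (hσ : ∀ a : ℤ, IsCoprime a 10 → IsSigma a (σ a)) (τ : ℍ) :
    modularProduct σ n τ = prodPoly g n τ := by
  have hn0 := pos_of_coprime_ten hn
  rw [modularProduct, prodPoly, idx, Finset.prod_sigma]
  refine Finset.prod_congr rfl fun a ha => Finset.prod_congr rfl fun b hb => ?_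
  have hi : (⟨a, b⟩ : Σ _ : ℕ, ℕ) ∈ idx n := Finset.mem_sigma.2 ⟨ha, hb⟩
  have hcop : IsCoprime (a : ℤ) 10 := by
    have := Nat.Coprime.coprime_dvd_left (Nat.dvd_of_mem_divisors ha) hn
    exact_mod_cast Nat.isCoprime_iff_coprime.2 this
  have hs : (10 : ℤ) ∣ σ a 1 0 := Int.modEq_zero_iff_dvd.1 (hσ a hcop).2.2.1
  have hpos : 0 < (upper n ⟨a, b⟩).det := by rw [det_upper hi]; exact_mod_cast hn0
  have : alpha σ n a b = (σ a : Matrix (Fin 2) (Fin 2) ℤ) * upper n ⟨a, b⟩ := rfl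
  rw [this, moebius_mul (det_coe_pos _) hpos τ.im_pos,
    g_moebius hs (moebius_im_pos hpos τ.im_pos)]

theorem eq_zero_of_eval_g {P : ℂ[X]} (h : ∀ z : ℂ, 0 < z.im → P.eval (g z) = 0) : P = 0 := by
  have hW : 0 < atkinLehnerTwo.det := by rw [det_atkinLehnerTwo]; norm_num
  refine eq_zero_of_eval_gTwo fun z hz => ?_
  rw [← g_moebius_atkinLehnerTwo hz]
  exact h _ (moebius_im_pos hW hz)

theorem ratFunc_eval_algebraMap (P : ℂ[X]) (w : ℂ) :
    (algebraMap ℂ[X] (RatFunc ℂ) P).eval (RingHom.id ℂ) w = P.eval w := by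
  rw [RatFunc.eval_algebraMap]
  simp

theorem ratFunc_eq_algebraMap_of_eval {F : RatFunc ℂ} {P : ℂ[X]}
    (h : ∀ z : ℂ, 0 < z.im → F.denom.eval (g z) ≠ 0 →
      F.eval (RingHom.id ℂ) (g z) = P.eval (g z)) : F = algebraMap ℂ[X] (RatFunc ℂ) P := by
  -- The extra factor `F.denom` covers the points where the hypothesis says nothing.
  have h0 : (F.num - P * F.denom) * F.denom = 0 := by
    refine eq_zero_of_eval_g fun z hz => ?_
    by_cases hd : F.denom.eval (g z) = 0
    · rw [eval_mul, hd, mul_zero]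
    · have := h z hz hd
      rw [RatFunc.eval, eval₂_id, eval₂_id, div_eq_iff hd] at this
      rw [eval_mul, eval_sub, eval_mul, this, sub_self, zero_mul]
  have h1 := sub_eq_zero.1 ((mul_eq_zero.1 h0).resolve_right F.denom_ne_zero)
  have hd : algebraMap ℂ[X] (RatFunc ℂ) F.denom ≠ 0 := by
    simpa using F.denom_ne_zero
  rw [← F.num_div_denom, h1, map_mul, mul_div_cancel_right₀ _ hd]

theorem IsLevelPoly.isModularPolynomial_iff {n : ℕ} (hn : n.Coprime 10) {σ : ℤ → SL(2, ℤ)}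
    (hσ : ∀ a : ℤ, IsCoprime a 10 → IsSigma a (σ a)) {Ψ : ℤ[X][Y]} (h : IsLevelPoly n Ψ)
    (F : (RatFunc ℂ)[X]) : IsModularPolynomial σ n F ↔ F = inYOverRatFunc Ψ := by
  have hcoeff : ∀ k, (inYOverRatFunc Ψ).coeff k =
      algebraMap ℂ[X] (RatFunc ℂ) ((Ψ.coeff k).map (Int.castRingHom ℂ)) := fun k => by
    rw [inYOverRatFunc, coeff_map]; rfl
  have heval : ∀ (k : ℕ) (τ : ℍ), (modularProduct σ n τ).coeff k =
      ((Ψ.coeff k).map (Int.castRingHom ℂ)).eval (g τ) := fun k τ => by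
    rw [modularProduct_eq hn hσ, ← h.map_g τ τ.im_pos, coeff_map, evalAt_apply]
  constructor
  · intro hF
    ext1 k
    rw [hcoeff]
    exact ratFunc_eq_algebraMap_of_eval fun z hz hd => by rw [hF k ⟨z, hz⟩ hd, heval]
  · rintro rfl k τ -
    rw [hcoeff, ratFunc_eval_algebraMap, heval]

theorem swap_kronecker_factors (n : ℕ) :
    Bivariate.swap ((X ^ n - C X) * (X - C (X ^ n)) : ℤ[X][Y]) =
      (C X ^ n - Y) * (C X - Y ^ n) := by
  simp only [map_mul, map_sub, map_pow, Bivariate.swap_X, Bivariate.swap_Y]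

end ModularPolynomialTen

/-! ### Assembly of the four properties -/

theorem theorem4p8 (n : ℕ) (hn : n.Coprime 10) (σ : ℤ → SL(2, ℤ))
    (hσ : ∀ a : ℤ, IsCoprime a 10 → IsSigma a (σ a)) :
    ∃ Φ : ℤ[X][Y],
      (∀ F : (RatFunc ℂ)[X], IsModularPolynomial σ n F ↔ F = inXOverRatFunc Φ) ∧
      ((degX Φ : ℚ) = psi n ∧ (degY Φ : ℚ) = psi n) ∧
      (Irreducible (inXOverRatFunc Φ) ∧ Irreducible (inYOverRatFunc Φ)) ∧
      (1 < n → Bivariate.swap Φ = Φ) ∧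
      (n.Prime →
        Φ - (C X ^ n - Y) * (C X - Y ^ n) ∈ Ideal.span {((n : ℕ) : ℤ[X][Y])}) := by
  obtain ⟨Ψ, h⟩ := exists_isLevelPoly hn
  have hn0 := (pos_of_coprime_ten hn).ne'
  have hX : inXOverRatFunc (Bivariate.swap Ψ) = inYOverRatFunc Ψ := by
    rw [inXOverRatFunc, Bivariate.swap_swap_apply]
  have hirr := h.irreducible_inYOverRatFunc hn
  -- In Ψ the root variable is the outer one, whereas X is the inner variable of Φ; hence the swap.
  refine ⟨Bivariate.swap Ψ, fun F => ?_, ⟨?_, ?_⟩, ⟨?_, ?_⟩, fun h1 => ?_, fun hp => ?_⟩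
  · rw [hX, h.isModularPolynomial_iff hn hσ]
  · rw [degX, Bivariate.swap_swap_apply, h.natDegree_eq, card_idx_eq_psi hn0]
  · rw [degY, ← card_idx_eq_psi hn0, ← h.natDegree_eq]
    rcases h.swap_eq_or hn with e | e
    · rw [e]
    · rw [e, natDegree_neg]
  · rwa [hX]
  · rcases h.swap_eq_or hn with e | e
    · rwa [e]
    · rw [e, inYOverRatFunc, Polynomial.map_neg]
      exact (Associated.refl _).neg_right.irreducible hirr
  · rw [Bivariate.swap_swap_apply, h.swap_eq hn h1]
  · have hk := h.kronecker hp
    rw [Ideal.mem_span_singleton] at hk ⊢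
    obtain ⟨Q, hQ⟩ := hk
    refine ⟨Bivariate.swap Q, ?_⟩
    rw [← swap_kronecker_factors, ← map_sub, hQ, map_mul, map_natCast]
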